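/- \textbf{Setting.} Let $\mathbb D=\{z\in\mathbb C:|z|<1\}$, let $\mathcal H(\mathbb D)$ be the space of analytic functions in $\mathbb D$, and $dA=\frac{dx\,dy}{\pi}$. A radial weight is a nonnegative function $\omega\in L^1([0,1))$, extended to $\mathbb D$ by $\omega(z)=\omega(|z|)$, such that $\widehat\omega(r)=\int_r^1\omega(s)\,ds>0$ for all $0\le r<1$. Write $\omega\in\widehat{\mathcal D}$ if there is a constant $C\ge1$ with $\widehat\omega(r)\le C\,\widehat\omega\left(\frac{1+r}2\right)$ for all $0\le r<1$. For $1<p<\infty$, $L^p_\omega$ consists of the measurable functions $f$ on $\mathbb D$ with $\|f\|_{L^p_\omega}^p=\int_{\mathbb D}|f|^p\omega\,dA<\infty$, and $A^p_\omega=L^p_\omega\cap\mathcal H(\mathbb D)$ with the same norm. Put $p'=\frac p{p-1}$ and $\omega_{[\beta]}(z)=\omega(z)(1-|z|)^\beta$. For $k\in\mathbb N=\{1,2,\dots\}$, $D^p_{\omega,k}$ consists of the $f\in\mathcal H(\mathbb D)$ with $$\|f\|_{D^p_{\omega,k}}=\big\|f^{(k)}\big\|_{L^p_{\omega_{[kp]}}}+\sum_{j=0}^k|f^{(j)}(0)|<\infty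 .$$ Let $B^\omega_z$ be the reproducing kernels of the Hilbert space $A^2_\omega$, let $$P_\omega(f)(z)=\int_{\mathbb D}f(\zeta)\overline{B^\omega_z(\zeta)}\,\omega(\zeta)\,dA(\zeta)$$ be the Bergman projection, and, for $f,g\in\mathcal H(\mathbb D)$ and $f_r(z)=f(rz)$, let $$\langle f,g\rangle_{A^2_\omega}=\lim_{r\to1^-}\int_{\mathbb D}f_r(z)\overline{g(z)}\,\omega(z)\,dA(z)$$ whenever the limit exists, where the integral over $\mathbb D$ is understood as $\lim_{\rho\to1^-}\int_{|z|<\rho}$ (this agrees with the Lebesgue integral when the integrand is integrable). \textbf{Theorem.} Let $\omega$ be a radial weight, $1<p<\infty$ and $k\in\mathbb N$. Then the following statements are equivalent: (i) $P_\omega:L^p_\omega\to D^p_{\omega,k}$ is bounded; (ii) $(A^{p'}_\omega)^\star$ is continuously embedded into $D^p_{\omega,k}$ via the $A^2_\omega$-pairing: there exists a constant $C>0$ such that for each bounded linear functional $L$ on $A^{p'}_\omega$ there is a unique $g\in D^p_{\omega,k}$ with $L(f)=\langle f,g\rangle_{A^2_\omega}$ for all $f\in A^{p'}_\omega$, and this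 $g$ satisfies $\|g\|_{D^p_{\omega,k}}\le C\|L\|$; (iii) the identity operator $A^p_\omega\to D^p_{\omega,k}$ is bounded, that is, $A^p_\omega\subset D^p_{\omega,k}$ and $\|f\|_{D^p_{\omega,k}}\le C\|f\|_{A^p_\omega}$ for some constant $C>0$ and all $f\in A^p_\omega$; (iv) $\omega\in\widehat{\mathcal D}$. -/

import Mathlib

open MeasureTheory Set Filter Topology Metric

noncomputable section

namespace RadialBergman

/-- The tail integral of `ω` from `r` to `1`. -/
def tail (ω : ℝ → ℝ) (r : ℝ) : ℝ := ∫ s in Ico r 1, ω s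

/-- Radial weights: nonnegative integrable functions on `[0,1)` all of whose tail integrals are
positive. Values of `ω` outside `[0,1)` are irrelevant. -/
structure IsRadialWeight (ω : ℝ → ℝ) : Prop where
  nonneg : ∀ r ∈ Ico (0 : ℝ) 1, 0 ≤ ω r
  integrable : IntegrableOn ω (Ico (0 : ℝ) 1)
  tail_pos : ∀ r ∈ Ico (0 : ℝ) 1, 0 < tail ω r

/-- The doubling property of the tail integrals. -/
def IsDoubling (ω : ℝ → ℝ) : Prop :=
  ∃ C : ℝ, 1 ≤ C ∧ ∀ r ∈ Ico (0 : ℝ) 1, tail ω r ≤ C * tail ω ((1 + r) / 2)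

/-- The measure `ω(|z|) dA(z)` on the unit disc, where `dA = dx dy / π`,
regarded as a measure on `ℂ` that does not charge the complement of the disc. -/
def areaMeasure (ω : ℝ → ℝ) : Measure ℂ :=
  ENNReal.ofReal (1 / Real.pi) •
    (volume.restrict (ball (0 : ℂ) 1)).withDensity (fun z => ENNReal.ofReal (ω ‖z‖))

/-- Membership in the Lebesgue space `L^p_ω`. -/
def MemLebesgue (ω : ℝ → ℝ) (p : ℝ) (f : ℂ → ℂ) : Prop :=
  MemLp f (ENNReal.ofReal p) (areaMeasure ω)

/-- The norm of `L^p_ω` (meaningful for members of the space). -/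
def lebesgueNorm (ω : ℝ → ℝ) (p : ℝ) (f : ℂ → ℂ) : ℝ :=
  (eLpNorm f (ENNReal.ofReal p) (areaMeasure ω)).toReal

/-- `f` is analytic in the unit disc. -/
def IsAnalytic (f : ℂ → ℂ) : Prop := DifferentiableOn ℂ f (ball (0 : ℂ) 1)

/-- The weighted Bergman space `A^p_ω`. -/
def bergmanSpace (ω : ℝ → ℝ) (p : ℝ) : Submodule ℂ (ℂ → ℂ) where
  carrier := {f | IsAnalytic f ∧ MemLebesgue ω p f}
  add_mem' := fun hf hg => ⟨hf.1.add hg.1, MemLp.add hf.2 hg.2⟩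
  zero_mem' := ⟨differentiableOn_const 0, MemLp.zero⟩
  smul_mem' := fun c _ hf => ⟨hf.1.const_smul c, MemLp.const_smul hf.2 c⟩

/-- The weight `ω_{[β]}(r) = ω(r) (1 - r)^β`. -/
def bracketWeight (ω : ℝ → ℝ) (β : ℝ) : ℝ → ℝ := fun r => ω r * (1 - r) ^ β

/-- Membership in the Dirichlet-type space `D^p_{ω,k}`. -/
def MemDirichlet (ω : ℝ → ℝ) (p : ℝ) (k : ℕ) (f : ℂ → ℂ) : Prop :=
  IsAnalytic f ∧ MemLebesgue (bracketWeight ω (k * p)) p (iteratedDeriv k f)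

/-- The norm of `D^p_{ω,k}` (meaningful for members of the space). -/
def dirichletNorm (ω : ℝ → ℝ) (p : ℝ) (k : ℕ) (f : ℂ → ℂ) : ℝ :=
  lebesgueNorm (bracketWeight ω (k * p)) p (iteratedDeriv k f) +
    ∑ j ∈ Finset.range (k + 1), ‖iteratedDeriv j f 0‖

/-- `B z` (for `z` in the disc) are the reproducing kernels of the Hilbert space `A^2_ω`. -/
def IsReproducingKernel (ω : ℝ → ℝ) (B : ℂ → ℂ → ℂ) : Prop :=
  ∀ z ∈ ball (0 : ℂ) 1, B z ∈ bergmanSpace ω 2 ∧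
    ∀ f ∈ bergmanSpace ω 2,
      f z = ∫ ζ, f ζ * (starRingEnd ℂ) (B z ζ) ∂(areaMeasure ω)

/-- The Bergman reproducing kernel `(z, ζ) ↦ B^ω_z(ζ)`; it is determined on the disc by its
reproducing property. -/
def bergmanKernel (ω : ℝ → ℝ) : ℂ → ℂ → ℂ := Classical.epsilon (IsReproducingKernel ω)

/-- The Bergman projection `P_ω`. -/
def bergmanProjection (ω : ℝ → ℝ) (f : ℂ → ℂ) (z : ℂ) : ℂ :=
  ∫ ζ, f ζ * (starRingEnd ℂ) (bergmanKernel ω z ζ) ∂(areaMeasure ω)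

/-- The pairing `⟨f, g⟩ = lim_{r → 1-} ∫_𝔻 f(rz) conj(g z) ω(z) dA(z)` exists and equals `c`.
Members of `D^p_{ω,k}` need not be in `L^1_ω`, so the area integral is
`lim_{ρ → 1-} ∫_{|z|<ρ}`; this coincides with the Lebesgue integral when the integrand
is integrable. -/
def HasPairing (ω : ℝ → ℝ) (f g : ℂ → ℂ) (c : ℂ) : Prop :=
  ∃ I : ℝ → ℂ,
    (∀ r ∈ Ioo (0 : ℝ) 1,
      Tendsto
        (fun ρ : ℝ => ∫ z in ball (0 : ℂ) ρ,
          f ((r : ℂ) * z) * (starRingEnd ℂ) (g z) ∂(areaMeasure ω))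
        (𝓝[<] 1) (𝓝 (I r))) ∧
    Tendsto I (𝓝[<] 1) (𝓝 c)

/-- `M` is an admissible constant in the boundedness of the functional `L` on `A^q_ω`. -/
def IsFunctionalBound (ω : ℝ → ℝ) (q : ℝ) (L : bergmanSpace ω q →ₗ[ℂ] ℂ) (M : ℝ) : Prop :=
  0 ≤ M ∧ ∀ f : bergmanSpace ω q, ‖L f‖ ≤ M * lebesgueNorm ω q (f : ℂ → ℂ)

/-- `L` is a bounded linear functional, that is, an element of the dual of `A^q_ω`. -/
def IsBoundedFunctional (ω : ℝ → ℝ) (q : ℝ) (L : bergmanSpace ω q →ₗ[ℂ] ℂ) : Prop :=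
  ∃ M : ℝ, IsFunctionalBound ω q L M

/-- The norm `‖L‖` in the dual of `A^q_ω`: the smallest admissible constant. -/
def functionalNorm (ω : ℝ → ℝ) (q : ℝ) (L : bergmanSpace ω q →ₗ[ℂ] ℂ) : ℝ :=
  sInf {M : ℝ | IsFunctionalBound ω q L M}

/-- `g` represents the functional `L` through the pairing. -/
def Represents (ω : ℝ → ℝ) (q : ℝ) (L : bergmanSpace ω q →ₗ[ℂ] ℂ) (g : ℂ → ℂ) : Prop :=
  ∀ f : bergmanSpace ω q, HasPairing ω (f : ℂ → ℂ) g (L f)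

/-- `P_ω : L^p_ω → D^p_{ω,k}` is bounded. -/
def ProjectionBounded (ω : ℝ → ℝ) (p : ℝ) (k : ℕ) : Prop :=
  ∃ C : ℝ, 0 < C ∧ ∀ f : ℂ → ℂ, MemLebesgue ω p f →
    MemDirichlet ω p k (bergmanProjection ω f) ∧
      dirichletNorm ω p k (bergmanProjection ω f) ≤ C * lebesgueNorm ω p f

/-- The dual of `A^{p'}_ω`, `p' = p / (p - 1)`, is continuously embedded into `D^p_{ω,k}`:
each functional has exactly one representative in `D^p_{ω,k}` (as a function on the disc), and
its norm is controlled. -/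
def DualEmbedded (ω : ℝ → ℝ) (p : ℝ) (k : ℕ) : Prop :=
  ∃ C : ℝ, 0 < C ∧
    ∀ L : bergmanSpace ω (Real.conjExponent p) →ₗ[ℂ] ℂ,
      IsBoundedFunctional ω (Real.conjExponent p) L →
      ∃ g : ℂ → ℂ, MemDirichlet ω p k g ∧
        Represents ω (Real.conjExponent p) L g ∧
        dirichletNorm ω p k g ≤ C * functionalNorm ω (Real.conjExponent p) L ∧
        ∀ g' : ℂ → ℂ, MemDirichlet ω p k g' →
          Represents ω (Real.conjExponent p) L g' → EqOn g' g (ball (0 : ℂ) 1)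

/-- The identity `A^p_ω → D^p_{ω,k}` is bounded. -/
def IdentityBounded (ω : ℝ → ℝ) (p : ℝ) (k : ℕ) : Prop :=
  ∃ C : ℝ, 0 < C ∧ ∀ f ∈ bergmanSpace ω p,
    MemDirichlet ω p k f ∧ dirichletNorm ω p k f ≤ C * lebesgueNorm ω p f

end RadialBergman

end

open scoped ENNReal ComplexConjugate

noncomputable section

namespace RadialBergman

/-! Everything is read off Taylor coefficients. Monomials are orthogonal for every radial measure,
so with $W_n=\int|z|^{2n}\omega\,dA$ (`moment`) the kernel is $\sum (\bar z\zeta)^n/W_n$, the $n$-th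
coefficient of $P_\omega f$ is $W_n^{-1}\int f\bar\zeta^n\omega\,dA$, and an analytic $g$
representing $L$ must have coefficients $\overline{L(z^n)}/W_n$. Positivity of `tail` up to the
boundary keeps $W_n$ from decaying geometrically, so all these series converge in the disc.
Consequently $P_\omega$ fixes $A^p_\omega$, which gives (i) ⇒ (iii). For $f\in A^p_\omega$ the only
possible representative of $u\mapsto\int u\bar f\omega\,dA$ is $f$, and Hölder bounds the functional
by the norm of $f$, which gives (ii) ⇒ (iii).

(iv) ⇒ (i). Doubling makes `tail` grow at most polynomially in $1-r$, so that $s^n$ absorbs its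
growth and the moments are regular: $W_n\lesssim W_{n+1}$ and $n(W_n-W_{n+1})\lesssim W_n$.
Multiplying the $k$-th derivative of $\sum x^n/W_n$ by $1-x$ therefore gains a power of $n$ in the
coefficients, and Parseval with Cauchy–Schwarz bounds its $L^1$ mean on $|x|=r$ by
$K/(\widehat\omega(r)(1-r)^k)$ (`exists_integral_norm_kernel_le`). The factor $(1-|z|)^k$ cancels,
leaving a positive kernel whose circle means in either variable are at most
$C/\widehat\omega(\min(|z|,|\zeta|))$. Schur's test with a power of $\widehat\omega$ concludes
(`exists_lintegral_rpow_le`); it needs only $\int\omega\,\widehat\omega^{-a}$, an exact derivative.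

(iv) ⇒ (ii). The function $g$ with the forced coefficients represents $L$, by dominated convergence
in $\rho$ and convergence $f_r\to f$ in norm. To bound $(1-|z|)^kg^{(k)}$ in $L^p_\omega$, test it
against bounded $\varphi$: the result is $L$ applied to a dilate of the transposed operator
evaluated at $\varphi$. That operator is bounded on $L^{p'}_\omega$ by the same Schur test, and
dilations contract $A^{p'}_\omega$ by a Poisson average. Fatou removes the dilation.

(iii) ⇒ (iv). Testing on $z^{j+k}$ shows that $A_j=\int|z|^{pj}\omega\,dA$ satisfies
$(j+1)(A_j-A_{j+1})\le cA_j$. Then $A_j(j+1)^N$ is eventually nondecreasing, so enlarging the index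
by a factor costs only a power of that factor. The part of a large moment below $(1+r)/2$ is
exponentially small in the factor and is absorbed, which leaves the tail at $(1+r)/2$. -/

/-! ### Weighted area measure in polar coordinates -/

/-- Normalized arc length on `(-π, π)`. -/
def arcMeasure : Measure ℝ :=
  ENNReal.ofReal (1 / (2 * Real.pi)) • volume.restrict (Ioo (-Real.pi) Real.pi)

/-- The radial part of `areaMeasure ω` in polar coordinates. -/
def radialMeasure (ω : ℝ → ℝ) : Measure ℝ :=
  (volume.restrict (Ioo (0 : ℝ) 1)).withDensity (fun r => ENNReal.ofReal (2 * r * ω r))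

/-- The parametrization of the plane by polar coordinates. -/
def polarMap (x : ℝ × ℝ) : ℂ := (x.1 : ℂ) * Complex.exp (x.2 * Complex.I)

theorem continuous_polarMap : Continuous polarMap := by
  unfold polarMap; fun_prop

theorem measurable_polarMap : Measurable polarMap := continuous_polarMap.measurable

instance : IsProbabilityMeasure arcMeasure := by
  constructor
  have hpi := Real.pi_pos
  simp only [arcMeasure, Measure.smul_apply, Measure.restrict_apply MeasurableSet.univ,
    univ_inter, Real.volume_Ioo, smul_eq_mul]
  rw [← ENNReal.ofReal_mul (by positivity), ← ENNReal.ofReal_one]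
  congr 1
  field_simp
  ring

instance (ω : ℝ → ℝ) : SFinite (radialMeasure ω) := by
  unfold radialMeasure; infer_instance

theorem IsRadialWeight.aemeasurable {ω : ℝ → ℝ} (h : IsRadialWeight ω) :
    AEMeasurable ω (volume.restrict (Ioo (0 : ℝ) 1)) :=
  (h.integrable.mono_set Ioo_subset_Ico_self).aemeasurable

theorem IsRadialWeight.integrable_Ioo {ω : ℝ → ℝ} (h : IsRadialWeight ω) :
    IntegrableOn ω (Ioo (0 : ℝ) 1) :=
  h.integrable.mono_set Ioo_subset_Ico_self

/-- The Jacobian $r$ and the normalization $1/\pi$ are distributed as density $2r\omega(r)$ on radii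
and a probability measure on angles. Only a.e. measurability is assumed, so that the formula also
applies to `bracketWeight`. -/
theorem areaMeasure_eq_map {ω : ℝ → ℝ}
    (hω : AEMeasurable ω (volume.restrict (Ioo (0 : ℝ) 1))) :
    areaMeasure ω = ((radialMeasure ω).prod arcMeasure).map polarMap := by
  ext s hs
  have hπ := Real.pi_pos
  have hsb : MeasurableSet (s ∩ ball (0 : ℂ) 1) := hs.inter measurableSet_ball
  rw [Measure.map_apply measurable_polarMap hs, Measure.prod_apply (measurable_polarMap hs)]
  have hd : AEMeasurable (fun r => ENNReal.ofReal (2 * r * ω r))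
      (volume.restrict (Ioo (0 : ℝ) 1)) :=
    ((measurable_const.mul measurable_id).aemeasurable.mul hω).ennreal_ofReal
  have hm : Measurable fun r : ℝ => arcMeasure (Prod.mk r ⁻¹' (polarMap ⁻¹' s)) :=
    measurable_measure_prodMk_left (measurable_polarMap hs)
  rw [radialMeasure, lintegral_withDensity_eq_lintegral_mul₀ hd hm.aemeasurable]
  simp only [areaMeasure, Measure.smul_apply, smul_eq_mul]
  rw [withDensity_apply _ hs, Measure.restrict_restrict hs, ← lintegral_indicator hsb,
    ← Complex.lintegral_comp_polarCoord_symm]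
  have key : ∀ x ∈ Complex.polarCoord.target,
      ENNReal.ofReal x.1 • (s ∩ ball (0 : ℂ) 1).indicator (fun z => ENNReal.ofReal (ω ‖z‖))
        (Complex.polarCoord.symm x) =
      (Ioo (0 : ℝ) 1).indicator (fun r => ENNReal.ofReal (r * ω r)) x.1 *
        (polarMap ⁻¹' s).indicator 1 x := by
    intro x hx
    have hx1 : 0 < x.1 := by
      have := hx; simp [Complex.polarCoord_target] at this; exact this.1
    have e : Complex.polarCoord.symm x = polarMap x := by
      rw [Complex.polarCoord_symm_apply, polarMap, Complex.exp_mul_I]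
      push_cast; rfl
    have hn : ‖polarMap x‖ = x.1 := by
      simp [polarMap, Complex.norm_exp_ofReal_mul_I, abs_of_pos hx1]
    rw [e]
    by_cases h1 : polarMap x ∈ s <;> by_cases h2 : x.1 < 1
    · simp [indicator, h1, h2, hn, hx1, ENNReal.ofReal_mul hx1.le]
    · simp [indicator, h1, h2, hn]
    · simp [indicator, h1, h2, hn]
    · simp [indicator, h1, h2, hn]
  have htar : polarCoord.target = Ioi (0 : ℝ) ×ˢ Ioo (-Real.pi) Real.pi := rfl
  rw [setLIntegral_congr_fun polarCoord.open_target.measurableSet (fun x hx => key x hx), htar,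
    Measure.volume_eq_prod, ← Measure.prod_restrict]
  have hd₁ : AEMeasurable (fun r => ENNReal.ofReal (r * ω r))
      (volume.restrict (Ioo (0 : ℝ) 1)) :=
    (measurable_id.aemeasurable.mul hω).ennreal_ofReal
  have hd' : AEMeasurable ((Ioo (0 : ℝ) 1).indicator fun r => ENNReal.ofReal (r * ω r))
      (volume.restrict (Ioi (0:ℝ))) :=
    ((aemeasurable_indicator_iff measurableSet_Ioo).2 hd₁).mono_measure Measure.restrict_le_self
  have hs' := measurable_polarMap hs
  have hprod : AEMeasurable (fun x : ℝ × ℝ =>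
      (Ioo (0 : ℝ) 1).indicator (fun r => ENNReal.ofReal (r * ω r)) x.1 *
        (polarMap ⁻¹' s).indicator 1 x)
      ((volume.restrict (Ioi (0 : ℝ))).prod (volume.restrict (Ioo (-Real.pi) Real.pi))) :=
    (hd'.comp_quasiMeasurePreserving Measure.quasiMeasurePreserving_fst).mul
      (measurable_const.indicator hs').aemeasurable
  rw [lintegral_prod _ hprod]
  have inner : ∀ r : ℝ, ∫⁻ θ in Ioo (-Real.pi) Real.pi,
      (Ioo (0 : ℝ) 1).indicator (fun r => ENNReal.ofReal (r * ω r)) r *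
        (polarMap ⁻¹' s).indicator 1 (r, θ) =
      (Ioo (0 : ℝ) 1).indicator (fun r => ENNReal.ofReal (r * ω r) *
        volume.restrict (Ioo (-Real.pi) Real.pi) (Prod.mk r ⁻¹' (polarMap ⁻¹' s))) r := by
    intro r
    have hsr : MeasurableSet (Prod.mk r ⁻¹' (polarMap ⁻¹' s)) := measurable_prodMk_left hs'
    have : (fun θ => (polarMap ⁻¹' s).indicator (1 : ℝ × ℝ → ℝ≥0∞) (r, θ)) =
        (Prod.mk r ⁻¹' (polarMap ⁻¹' s)).indicator 1 := by
      rfl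
    rw [lintegral_const_mul _ (this ▸ measurable_const.indicator hsr), this,
      lintegral_indicator_one hsr]
    by_cases hr : r ∈ Ioo (0 : ℝ) 1 <;> simp [hr]
  simp only [inner]
  rw [lintegral_indicator measurableSet_Ioo, Measure.restrict_restrict measurableSet_Ioo,
    inter_eq_left.2 Ioo_subset_Ioi_self, ← lintegral_const_mul'' _ (hd₁.fun_mul (measurable_measure_prodMk_left hs').aemeasurable)]
  refine setLIntegral_congr_fun measurableSet_Ioo fun r hr => ?_
  simp only [arcMeasure, Measure.smul_apply, smul_eq_mul, Pi.mul_apply]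
  rw [← mul_assoc, ← mul_assoc]
  congr 1
  rw [← ENNReal.ofReal_mul (by positivity), ← ENNReal.ofReal_mul' (by positivity)]
  congr 1
  field_simp


theorem IsRadialWeight.isFiniteMeasure_radialMeasure {ω : ℝ → ℝ} (h : IsRadialWeight ω) :
    IsFiniteMeasure (radialMeasure ω) := by
  refine isFiniteMeasure_withDensity_ofReal (Integrable.hasFiniteIntegral ?_)
  refine Integrable.mono' (h.integrable_Ioo.norm.const_mul 2)
    ((measurable_const.mul measurable_id).aestronglyMeasurable.mul
      h.integrable_Ioo.aestronglyMeasurable) ?_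
  filter_upwards [ae_restrict_mem measurableSet_Ioo] with r hr
  rw [norm_mul, norm_mul, Real.norm_of_nonneg hr.1.le]
  have := hr.2.le
  simp only [Real.norm_ofNat]
  gcongr
  linarith

theorem ae_radialMeasure (ω : ℝ → ℝ) : ∀ᵐ r ∂radialMeasure ω, r ∈ Ioo (0 : ℝ) 1 :=
  (withDensity_absolutelyContinuous _ _).ae_le (ae_restrict_mem measurableSet_Ioo)

theorem ae_areaMeasure (ω : ℝ → ℝ) : ∀ᵐ z ∂areaMeasure ω, z ∈ ball (0 : ℂ) 1 :=
  Measure.ae_smul_measure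
    ((withDensity_absolutelyContinuous _ _).ae_le (ae_restrict_mem measurableSet_ball)) _

theorem norm_polarMap (r θ : ℝ) : ‖polarMap (r, θ)‖ = |r| := by
  simp [polarMap, Complex.norm_exp_ofReal_mul_I]

section

variable {ω : ℝ → ℝ} (h : IsRadialWeight ω)
include h

theorem IsRadialWeight.isFiniteMeasure_areaMeasure : IsFiniteMeasure (areaMeasure ω) := by
  have := h.isFiniteMeasure_radialMeasure
  rw [areaMeasure_eq_map h.aemeasurable]
  infer_instance

theorem IsRadialWeight.lintegral_areaMeasure {F : ℂ → ℝ≥0∞} (hF : Measurable F) :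
    ∫⁻ z, F z ∂areaMeasure ω =
      ∫⁻ r, ∫⁻ θ, F (polarMap (r, θ)) ∂arcMeasure ∂radialMeasure ω := by
  rw [areaMeasure_eq_map h.aemeasurable, lintegral_map hF measurable_polarMap,
    lintegral_prod (fun x => F (polarMap x)) (hF.comp measurable_polarMap).aemeasurable]

theorem IsRadialWeight.integral_areaMeasure {F : ℂ → ℂ} (hF : Integrable F (areaMeasure ω)) :
    ∫ z, F z ∂areaMeasure ω =
      ∫ r, ∫ θ, F (polarMap (r, θ)) ∂arcMeasure ∂radialMeasure ω := by
  have := h.isFiniteMeasure_radialMeasure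
  have h0 := hF
  rw [areaMeasure_eq_map h.aemeasurable] at h0 ⊢
  rw [integral_map measurable_polarMap.aemeasurable h0.1, integral_prod]
  exact (integrable_map_measure h0.1 measurable_polarMap.aemeasurable).1 h0

theorem IsRadialWeight.lintegral_radialMeasure {F : ℝ → ℝ≥0∞} (hF : Measurable F) :
    ∫⁻ r, F r ∂radialMeasure ω =
      ∫⁻ r in Ioo (0 : ℝ) 1, ENNReal.ofReal (2 * r * ω r) * F r := by
  rw [radialMeasure, lintegral_withDensity_eq_lintegral_mul₀ _ hF.aemeasurable]
  · rfl
  · exact ((measurable_const.mul measurable_id).aemeasurable.mul h.aemeasurable).ennreal_ofReal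

end

/-! ### Calculus of the tail integral -/

theorem tail_one (ω : ℝ → ℝ) : tail ω 1 = 0 := by simp [tail]

section
variable {ω : ℝ → ℝ} (h : IsRadialWeight ω)
include h

theorem IsRadialWeight.tail_anti {x y : ℝ} (hx : 0 ≤ x) (hxy : x ≤ y) : tail ω y ≤ tail ω x := by
  refine setIntegral_mono_set (h.integrable.mono_set (Ico_subset_Ico_left hx)) ?_
    (Ico_subset_Ico_left hxy).eventuallyLE
  filter_upwards [ae_restrict_mem measurableSet_Ico] with r hr
  exact h.nonneg r ⟨hx.trans hr.1, hr.2⟩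

theorem IsRadialWeight.tail_nonneg {x : ℝ} (hx : 0 ≤ x) : 0 ≤ tail ω x :=
  setIntegral_nonneg measurableSet_Ico fun r hr => h.nonneg r ⟨hx.trans hr.1, hr.2⟩

theorem IsRadialWeight.intervalIntegrable : IntervalIntegrable ω volume 0 1 := by
  rw [intervalIntegrable_iff_integrableOn_Ioo_of_le zero_le_one]
  exact h.integrable_Ioo

theorem IsRadialWeight.tail_eq {x : ℝ} (hx : x ∈ Icc (0 : ℝ) 1) :
    tail ω x = tail ω 0 - ∫ t in (0 : ℝ)..x, ω t := by
  have e : ∀ y ∈ Icc (0 : ℝ) 1, tail ω y = ∫ t in y..(1 : ℝ), ω t := fun y hy => by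
    rw [tail, intervalIntegral.integral_of_le hy.2, integral_Ico_eq_integral_Ioo,
      integral_Ioc_eq_integral_Ioo]
  rw [e x hx, e 0 (by simp)]
  have h1 : IntervalIntegrable ω volume 0 x := h.intervalIntegrable.mono_set (by
    rw [uIcc_of_le hx.1, uIcc_of_le zero_le_one]; exact Icc_subset_Icc_right hx.2)
  have h2 : IntervalIntegrable ω volume x 1 := h.intervalIntegrable.mono_set (by
    rw [uIcc_of_le hx.2, uIcc_of_le zero_le_one]; exact Icc_subset_Icc_left hx.1)
  rw [← intervalIntegral.integral_add_adjacent_intervals h1 h2]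
  ring

theorem IsRadialWeight.ae_hasDerivAt_tail :
    ∀ᵐ x, x ∈ Ioo (0 : ℝ) 1 → HasDerivAt (tail ω) (-ω x) x := by
  filter_upwards [h.intervalIntegrable.ae_hasDerivAt_integral] with x hx hx1
  rw [uIcc_of_le zero_le_one] at hx
  have := ((hx (Ioo_subset_Icc_self hx1) 0 (by simp)).const_sub (tail ω 0))
  refine this.congr_of_eventuallyEq ?_
  filter_upwards [Ioo_mem_nhds hx1.1 hx1.2] with y hy
  exact h.tail_eq (Ioo_subset_Icc_self hy)

/-- Integration of a derivative of a monotone function of the tail. -/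
theorem IsRadialWeight.lintegral_deriv_tail_le {g g' : ℝ → ℝ} {x y : ℝ} (hx : 0 ≤ x) (hxy : x ≤ y)
    (hy : y ≤ 1) (hg : AntitoneOn g (tail ω '' Icc x y))
    (hd : ∀ t, 0 < t → HasDerivAt g (g' t) t) :
    ∫⁻ s in Ioo x y, ENNReal.ofReal (ω s * -g' (tail ω s)) ≤
      ENNReal.ofReal (g (tail ω y) - g (tail ω x)) := by
  set G := fun s => g (tail ω s)
  have hG : MonotoneOn G (uIcc x y) := by
    rw [uIcc_of_le hxy]
    intro a ha b hb hab
    exact hg ⟨b, hb, rfl⟩ ⟨a, ha, rfl⟩ (h.tail_anti (hx.trans ha.1) hab)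
  have hle : G x ≤ G y := hG (by simp) (by simp) hxy
  -- For a monotone function the integral of the a.e. derivative is at most the increment, so
  -- absolute continuity of `G` is not needed.
  have h1 := hG.intervalIntegral_deriv_mem_uIcc
  rw [uIcc_of_le (by linarith)] at h1
  have hi := hG.intervalIntegrable_deriv
  rw [intervalIntegrable_iff_integrableOn_Ioo_of_le hxy] at hi
  rw [intervalIntegral.integral_of_le hxy, integral_Ioc_eq_integral_Ioo] at h1
  have hae : ∀ᵐ s ∂volume.restrict (Ioo x y), deriv G s = ω s * -g' (tail ω s) := by
    filter_upwards [ae_restrict_of_ae h.ae_hasDerivAt_tail, ae_restrict_mem measurableSet_Ioo]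
      with s hs hs1
    have hs2 : s ∈ Ioo (0 : ℝ) 1 := ⟨hx.trans_lt hs1.1, hs1.2.trans_le hy⟩
    have := (hd (tail ω s) (h.tail_pos s (Ioo_subset_Ico_self hs2))).comp s (hs hs2)
    rw [show G = g ∘ tail ω from rfl, this.deriv]
    ring
  have hnn : 0 ≤ᵐ[volume.restrict (Ioo x y)] deriv G := by
    filter_upwards [ae_restrict_mem measurableSet_Ioo] with s hs
    have : derivWithin G (Icc x y) s = deriv G s :=
      derivWithin_of_mem_nhds (Icc_mem_nhds hs.1 hs.2)
    rw [← this]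
    rw [uIcc_of_le hxy] at hG
    exact hG.derivWithin_nonneg
  calc ∫⁻ s in Ioo x y, ENNReal.ofReal (ω s * -g' (tail ω s))
      = ∫⁻ s in Ioo x y, ENNReal.ofReal (deriv G s) :=
        lintegral_congr_ae (by filter_upwards [hae] with s hs; rw [hs])
    _ = ENNReal.ofReal (∫ s in Ioo x y, deriv G s) :=
        (ofReal_integral_eq_lintegral_ofReal hi hnn).symm
    _ ≤ _ := ENNReal.ofReal_le_ofReal h1.2

/-- The integrand is a.e. the derivative of $\widehat\omega^{-b}/b$. This controls the part of a
radial integral inside the circle through `x`; its companion below controls the part outside. With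
$b=a\in(0,1)$ the two give the Schur estimate, and $b=1$ enters the moment comparison. -/
theorem IsRadialWeight.lintegral_tail_rpow_le_left {b x : ℝ} (hb : 0 < b) (hx : x ∈ Ioo (0 : ℝ) 1) :
    ∫⁻ s in Ioo 0 x, ENNReal.ofReal (ω s * tail ω s ^ (-b - 1)) ≤
      ENNReal.ofReal (tail ω x ^ (-b) / b) := by
  have hpos : ∀ s ∈ Icc 0 x, 0 < tail ω s := fun s hs => h.tail_pos s ⟨hs.1, hs.2.trans_lt hx.2⟩
  refine le_trans (le_of_eq ?_) ((h.lintegral_deriv_tail_le (g := fun t => t ^ (-b) / b)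
    (g' := fun t => (-b * t ^ (-b - 1)) / b) le_rfl hx.1.le hx.2.le ?_ ?_).trans
      (ENNReal.ofReal_le_ofReal ?_))
  · refine lintegral_congr fun s => ?_
    congr 2; field_simp
  · rintro _ ⟨s, hs, rfl⟩ _ ⟨t, ht, rfl⟩ hst
    have := Real.rpow_le_rpow_of_nonpos (hpos s hs) hst (by linarith : -b ≤ 0)
    simp only
    gcongr
  · intro t ht
    exact (Real.hasDerivAt_rpow_const (Or.inl ht.ne')).div_const b
  · have := Real.rpow_nonneg (hpos 0 ⟨le_rfl, hx.1.le⟩).le (-b)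
    have : 0 ≤ tail ω 0 ^ (-b) / b := by positivity
    linarith

theorem IsRadialWeight.lintegral_tail_rpow_le_right {a x : ℝ} (ha : a < 1)
    (hx : x ∈ Ioo (0 : ℝ) 1) :
    ∫⁻ s in Ioo x 1, ENNReal.ofReal (ω s * tail ω s ^ (-a)) ≤
      ENNReal.ofReal (tail ω x ^ (1 - a) / (1 - a)) := by
  have h1a : 0 < 1 - a := by linarith
  refine le_trans (le_of_eq ?_) ((h.lintegral_deriv_tail_le (g := fun t => -(t ^ (1 - a) / (1 - a)))
    (g' := fun t => -(((1 - a) * t ^ (1 - a - 1)) / (1 - a))) hx.1.le hx.2.le le_rfl ?_ ?_).trans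
      (ENNReal.ofReal_le_ofReal ?_))
  · refine lintegral_congr fun s => ?_
    rw [show 1 - a - 1 = -a by ring]
    congr 2; field_simp
  · rintro _ ⟨s, hs, rfl⟩ _ ⟨t, ht, rfl⟩ hst
    have := Real.rpow_le_rpow (h.tail_nonneg (hx.1.le.trans hs.1)) hst h1a.le
    simp only [neg_le_neg_iff]
    gcongr
  · intro t ht
    exact ((Real.hasDerivAt_rpow_const (Or.inl ht.ne')).div_const _).neg
  · simp [tail_one, Real.zero_rpow h1a.ne']

end

/-! ### Power series and Taylor coefficients in the unit disc -/

/-- The power series with coefficients `c` converges absolutely in the unit disc. -/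
def HasUnitRadius (c : ℕ → ℂ) : Prop := ∀ x ∈ Ico (0 : ℝ) 1, Summable fun n => ‖c n‖ * x ^ n

/-- The sum of the power series with coefficients `c`. -/
def powerSum (c : ℕ → ℂ) (z : ℂ) : ℂ := ∑' n, c n * z ^ n

/-- The coefficients of the derivative of a power series. -/
def derivCoeff (c : ℕ → ℂ) (n : ℕ) : ℂ := ((n + 1 : ℕ) : ℂ) * c (n + 1)

/-- The Taylor coefficients at the origin. -/
def taylorCoeff (f : ℂ → ℂ) (n : ℕ) : ℂ := (n.factorial : ℂ)⁻¹ * iteratedDeriv n f 0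

theorem hasUnitRadius_of_bound {c : ℕ → ℂ}
    (hc : ∀ x ∈ Ioo (0 : ℝ) 1, ∃ C, ∀ n, ‖c n‖ * x ^ n ≤ C) : HasUnitRadius c := by
  intro x hx
  obtain ⟨y, hxy, hy⟩ := exists_between hx.2
  have hy0 : 0 < y := hx.1.trans_lt hxy
  obtain ⟨C, hC⟩ := hc y ⟨hy0, hy⟩
  have hs : Summable fun n : ℕ => C * (x / y) ^ n :=
    (summable_geometric_of_lt_one (div_nonneg hx.1 hy0.le) ((div_lt_one hy0).2 hxy)).mul_left C
  refine Summable.of_nonneg_of_le (fun n => mul_nonneg (norm_nonneg _) (pow_nonneg hx.1 _))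
    (fun n => ?_) hs
  calc ‖c n‖ * x ^ n = (‖c n‖ * y ^ n) * (x / y) ^ n := by
        rw [div_pow]; field_simp
    _ ≤ C * (x / y) ^ n := mul_le_mul_of_nonneg_right (hC n) (pow_nonneg (div_nonneg hx.1 hy0.le) _)

theorem HasUnitRadius.of_norm_le {c d : ℕ → ℂ} {C : ℝ} (hd : HasUnitRadius d)
    (h : ∀ n, ‖c n‖ ≤ C * ‖d n‖) : HasUnitRadius c := by
  intro x hx
  refine Summable.of_nonneg_of_le (fun n => mul_nonneg (norm_nonneg _) (pow_nonneg hx.1 _))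
    (fun n => ?_) ((hd x hx).mul_left C)
  rw [← mul_assoc]
  exact mul_le_mul_of_nonneg_right (h n) (pow_nonneg hx.1 _)

section
variable {c : ℕ → ℂ} (hc : HasUnitRadius c)
include hc

theorem HasUnitRadius.exists_bound {x : ℝ} (hx : x ∈ Ico (0 : ℝ) 1) :
    ∃ C, 0 ≤ C ∧ ∀ n, ‖c n‖ * x ^ n ≤ C :=
  ⟨∑' n, ‖c n‖ * x ^ n, tsum_nonneg fun _ => mul_nonneg (norm_nonneg _) (pow_nonneg hx.1 _),
    fun n => (hc x hx).le_tsum n fun _ _ => mul_nonneg (norm_nonneg _) (pow_nonneg hx.1 _)⟩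

theorem HasUnitRadius.summable_norm {z : ℂ} (hz : ‖z‖ < 1) :
    Summable fun n => ‖c n * z ^ n‖ := by
  simpa using hc ‖z‖ ⟨norm_nonneg _, hz⟩

theorem HasUnitRadius.hasSum {z : ℂ} (hz : ‖z‖ < 1) :
    HasSum (fun n => c n * z ^ n) (powerSum c z) :=
  (hc.summable_norm hz).of_norm.hasSum

theorem HasUnitRadius.norm_powerSum_le {z : ℂ} {x : ℝ} (hx : x ∈ Ico (0 : ℝ) 1) (hz : ‖z‖ ≤ x) :
    ‖powerSum c z‖ ≤ ∑' n, ‖c n‖ * x ^ n := by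
  refine tsum_of_norm_bounded (hc x hx).hasSum fun n => ?_
  rw [norm_mul, norm_pow]
  gcongr

theorem HasUnitRadius.mul_pow {w : ℂ} (hw : ‖w‖ ≤ 1) : HasUnitRadius fun n => c n * w ^ n := by
  refine HasUnitRadius.of_norm_le (C := 1) hc fun n => ?_
  rw [norm_mul, norm_pow, one_mul]
  exact mul_le_of_le_one_right (norm_nonneg _) (pow_le_one₀ (norm_nonneg _) hw)

/-- At a slightly larger radius the coefficients are bounded, and the resulting geometric ratio
absorbs the factor $n+1$. -/
theorem HasUnitRadius.derivCoeff : HasUnitRadius (derivCoeff c) := by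
  refine hasUnitRadius_of_bound fun x hx => ?_
  obtain ⟨y, hxy, hy⟩ := exists_between hx.2
  have hy0 : 0 < y := hx.1.trans hxy
  obtain ⟨C, hC0, hC⟩ := hc.exists_bound ⟨hy0.le, hy⟩
  have hxy1 : ‖x / y‖ < 1 := by
    rw [Real.norm_of_nonneg (div_nonneg hx.1.le hy0.le)]
    exact (div_lt_one hy0).2 hxy
  have hs := summable_pow_mul_geometric_of_norm_lt_one 1 hxy1
  obtain ⟨K, hK⟩ := hs.tendsto_atTop_zero.bddAbove_range
  refine ⟨C * K / x, fun n => ?_⟩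
  have h1 := hK ⟨n + 1, rfl⟩
  simp only [pow_one] at h1
  have hx0 := hx.1
  rw [RadialBergman.derivCoeff, norm_mul, Complex.norm_natCast, le_div_iff₀ hx0]
  calc ((n + 1 : ℕ) : ℝ) * ‖c (n + 1)‖ * x ^ n * x
      = (‖c (n + 1)‖ * y ^ (n + 1)) * (((n + 1 : ℕ) : ℝ) * (x / y) ^ (n + 1)) := by
        rw [div_pow]; field_simp; ring
    _ ≤ C * K := mul_le_mul (hC _) h1 (by positivity) hC0

theorem HasUnitRadius.iterate_derivCoeff (k : ℕ) :
    HasUnitRadius (RadialBergman.derivCoeff^[k] c) := by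
  induction k with
  | zero => exact hc
  | succ k ih => rw [Function.iterate_succ_apply']; exact ih.derivCoeff

theorem HasUnitRadius.isAnalytic : IsAnalytic (powerSum c) := by
  intro z hz
  obtain ⟨x, hx1, hx2⟩ := exists_between (mem_ball_zero_iff.1 hz)
  have hx0 := (norm_nonneg z).trans_lt hx1
  have : DifferentiableOn ℂ (powerSum c) (ball 0 x) :=
    Complex.differentiableOn_tsum_of_summable_norm (hc x ⟨hx0.le, hx2⟩) (fun n => by fun_prop) isOpen_ball
      fun n w hw => by
        rw [norm_mul, norm_pow]
        have := (mem_ball_zero_iff.1 hw).le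
        gcongr
  exact (this.differentiableAt (isOpen_ball.mem_nhds (by simpa using hx1))).differentiableWithinAt

theorem HasUnitRadius.deriv_powerSum {z : ℂ} (hz : ‖z‖ < 1) :
    deriv (powerSum c) z = powerSum (RadialBergman.derivCoeff c) z := by
  obtain ⟨x, hx1, hx2⟩ := exists_between hz
  have hx0 := (norm_nonneg z).trans_lt hx1
  have h1 := Complex.hasSum_deriv_of_summable_norm (F := fun n z => c n * z ^ n) (U := ball 0 x)
    (hc x ⟨hx0.le, hx2⟩) (fun n => by fun_prop) isOpen_ball
      (fun n w hw => by
        rw [norm_mul, norm_pow]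
        have := (mem_ball_zero_iff.1 hw).le
        gcongr) (z := z) (by simpa using hx1)
  have h2 := (hasSum_nat_add_iff' 1).2 h1
  have h3 := hc.derivCoeff.hasSum hz
  refine HasSum.unique (f := fun n => RadialBergman.derivCoeff c n * z ^ n) ?_ h3
  have e : deriv (fun w => ∑' i, c i * w ^ i) z - ∑ i ∈ Finset.range 1,
      deriv (fun z => c i * z ^ i) z = deriv (powerSum c) z := by
    simp only [Finset.range_one, Finset.sum_singleton, pow_zero, mul_one, deriv_const, sub_zero]
    rfl
  rw [e] at h2
  have e2 : (fun n => deriv (fun z => c (n + 1) * z ^ (n + 1)) z) =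
      fun n => RadialBergman.derivCoeff c n * z ^ n := by
    ext n
    rw [deriv_const_mul_field, deriv_pow_field]
    simp [RadialBergman.derivCoeff]; ring
  rwa [e2] at h2
end

theorem iteratedDeriv_congr_ball {f g : ℂ → ℂ} (h : EqOn f g (ball (0 : ℂ) 1)) (k : ℕ) :
    EqOn (iteratedDeriv k f) (iteratedDeriv k g) (ball (0 : ℂ) 1) := by
  intro z hz
  refine Filter.EventuallyEq.iteratedDeriv_eq k ?_
  filter_upwards [isOpen_ball.mem_nhds hz] with w hw using h hw

theorem HasUnitRadius.iteratedDeriv_powerSum {c : ℕ → ℂ} (hc : HasUnitRadius c) (k : ℕ) :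
    EqOn (iteratedDeriv k (powerSum c)) (powerSum (RadialBergman.derivCoeff^[k] c)) (ball 0 1) := by
  induction k with
  | zero => intro z _; simp
  | succ k ih =>
    intro z hz
    rw [iteratedDeriv_succ, Function.iterate_succ_apply',
      ← (hc.iterate_derivCoeff k).deriv_powerSum (mem_ball_zero_iff.1 hz)]
    refine Filter.EventuallyEq.deriv_eq ?_
    filter_upwards [isOpen_ball.mem_nhds hz] with w hw using ih hw

theorem iterate_derivCoeff_apply (c : ℕ → ℂ) (k n : ℕ) :
    derivCoeff^[k] c n = ((n + k).descFactorial k : ℂ) * c (n + k) := by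
  induction k generalizing n with
  | zero => simp
  | succ k ih =>
    rw [Function.iterate_succ_apply', derivCoeff, ih, ← mul_assoc,
      show n + 1 + k = n + (k + 1) by ring]
    congr 1
    norm_cast
    rw [Nat.descFactorial_succ, show n + (k + 1) - k = n + 1 by omega]

theorem powerSum_zero (c : ℕ → ℂ) : powerSum c 0 = c 0 := by
  rw [powerSum, tsum_eq_single 0]
  · simp
  · intro n hn; simp [hn]

theorem HasUnitRadius.taylorCoeff_powerSum {c : ℕ → ℂ} (hc : HasUnitRadius c) :
    taylorCoeff (powerSum c) = c := by
  ext n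
  rw [taylorCoeff, hc.iteratedDeriv_powerSum n (by simp), powerSum_zero, iterate_derivCoeff_apply]
  simp only [zero_add, Nat.descFactorial_self]
  rw [inv_mul_cancel_left₀]
  exact_mod_cast n.factorial_ne_zero

section
variable {f : ℂ → ℂ} (hf : IsAnalytic f)
include hf

theorem IsAnalytic.hasUnitRadius : HasUnitRadius (taylorCoeff f) := by
  intro x hx
  have := (Complex.hasSum_taylorSeries_on_ball hf (z := (x : ℂ))
    (by simpa [abs_of_nonneg hx.1] using hx.2)).summable.norm
  refine this.congr fun n => ?_
  simp [taylorCoeff, abs_of_nonneg hx.1]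
  ring

theorem IsAnalytic.eqOn_powerSum : EqOn f (powerSum (taylorCoeff f)) (ball 0 1) := by
  intro z hz
  rw [← (Complex.hasSum_taylorSeries_on_ball hf hz).tsum_eq, powerSum]
  refine tsum_congr fun n => ?_
  simp [taylorCoeff]
  ring
end

theorem taylorCoeff_congr {f g : ℂ → ℂ} (h : EqOn f g (ball (0 : ℂ) 1)) :
    taylorCoeff f = taylorCoeff g := by
  ext n
  rw [taylorCoeff, taylorCoeff, iteratedDeriv_congr_ball h n (by simp)]

theorem IsAnalytic.eqOn_of_taylorCoeff_eq {f g : ℂ → ℂ} (hf : IsAnalytic f) (hg : IsAnalytic g)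
    (h : taylorCoeff f = taylorCoeff g) : EqOn f g (ball 0 1) := fun z hz => by
  rw [hf.eqOn_powerSum hz, hg.eqOn_powerSum hz, h]

theorem IsAnalytic.congr {f g : ℂ → ℂ} (hf : IsAnalytic f) (h : EqOn g f (ball (0 : ℂ) 1)) :
    IsAnalytic g := DifferentiableOn.congr hf h

/-! ### Orthogonality and Parseval on circles -/

/-- The point `exp (iθ)` of the unit circle. -/
def unitExp (θ : ℝ) : ℂ := Complex.exp (θ * Complex.I)

theorem norm_unitExp (θ : ℝ) : ‖unitExp θ‖ = 1 := Complex.norm_exp_ofReal_mul_I θ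

theorem continuous_unitExp : Continuous unitExp := by unfold unitExp; fun_prop

theorem norm_mul_unitExp (w : ℂ) (θ : ℝ) : ‖w * unitExp θ‖ = ‖w‖ := by
  rw [norm_mul, norm_unitExp, mul_one]

theorem polarMap_eq (r θ : ℝ) : polarMap (r, θ) = r * unitExp θ := rfl

theorem unitExp_mul_conj (θ : ℝ) : unitExp θ * conj (unitExp θ) = 1 := by
  rw [Complex.mul_conj, Complex.normSq_eq_norm_sq, norm_unitExp]; simp

theorem integral_arcMeasure (f : ℝ → ℂ) :
    ∫ θ, f θ ∂arcMeasure = (1 / (2 * Real.pi) : ℝ) * ∫ θ in -Real.pi..Real.pi, f θ := by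
  have hπ := Real.pi_pos
  rw [arcMeasure, integral_smul_measure, ENNReal.toReal_ofReal (by positivity),
    intervalIntegral.integral_of_le (by linarith), integral_Ioc_eq_integral_Ioo,
    Complex.real_smul]

theorem integral_unitExp_mul_conj (n m : ℕ) :
    ∫ θ, unitExp θ ^ n * conj (unitExp θ) ^ m ∂arcMeasure = if n = m then 1 else 0 := by
  have hπ := Real.pi_pos
  split_ifs with hnm
  · subst hnm
    simp_rw [← mul_pow, unitExp_mul_conj]
    simp
  · have e : ∀ θ : ℝ, unitExp θ ^ n * conj (unitExp θ) ^ m =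
        Complex.exp ((((n : ℂ) - m) * Complex.I) * θ) := fun θ => by
      rw [unitExp, ← Complex.exp_conj, ← Complex.exp_nat_mul, ← Complex.exp_nat_mul,
        ← Complex.exp_add]
      congr 1
      simp
      ring
    have hne : (n : ℂ) - m ≠ 0 := sub_ne_zero.2 (by exact_mod_cast hnm)
    simp_rw [e]
    rw [integral_arcMeasure, integral_exp_mul_complex (mul_ne_zero hne Complex.I_ne_zero)]
    have : Complex.exp (((n : ℂ) - m) * Complex.I * (Real.pi : ℝ)) =
        Complex.exp (((n : ℂ) - m) * Complex.I * ((-Real.pi : ℝ) : ℂ)) := by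
      rw [Complex.exp_eq_exp_iff_exists_int]
      refine ⟨(n : ℤ) - m, ?_⟩
      push_cast
      ring
    rw [this]
    simp

section
variable {c d : ℕ → ℂ} (hc : HasUnitRadius c) (hd : HasUnitRadius d)
include hc

theorem HasUnitRadius.continuousOn : ContinuousOn (powerSum c) (ball 0 1) :=
  DifferentiableOn.continuousOn hc.isAnalytic

theorem HasUnitRadius.continuous_circle {w : ℂ} (hw : ‖w‖ < 1) :
    Continuous fun θ => powerSum c (w * unitExp θ) :=
  hc.continuousOn.comp_continuous (continuous_const.mul continuous_unitExp)
    fun θ => by simpa [norm_unitExp] using hw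

theorem HasUnitRadius.integral_mul_conj_unitExp {w : ℂ} (hw : ‖w‖ < 1) (m : ℕ) :
    ∫ θ, powerSum c (w * unitExp θ) * conj (unitExp θ) ^ m ∂arcMeasure = c m * w ^ m := by
  have hnorm : ∀ n θ, ‖c n * (w * unitExp θ) ^ n * conj (unitExp θ) ^ m‖ = ‖c n‖ * ‖w‖ ^ n :=
    fun n θ => by simp [norm_unitExp]
  have hcont : ∀ n, Continuous fun θ => c n * (w * unitExp θ) ^ n * conj (unitExp θ) ^ m :=
    fun n => by
      have := continuous_unitExp
      fun_prop
  have h1 := hasSum_integral_of_summable_integral_norm (μ := arcMeasure)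
    (F := fun n θ => c n * (w * unitExp θ) ^ n * conj (unitExp θ) ^ m)
    (fun n => (integrable_const (‖c n‖ * ‖w‖ ^ n)).mono' (hcont n).aestronglyMeasurable
      (Eventually.of_forall fun θ => (hnorm n θ).le))
    (by simpa only [hnorm, integral_const, probReal_univ, one_smul]
      using hc ‖w‖ ⟨norm_nonneg _, hw⟩)
  have h2 : ∀ θ, ∑' n, c n * (w * unitExp θ) ^ n * conj (unitExp θ) ^ m =
      powerSum c (w * unitExp θ) * conj (unitExp θ) ^ m := fun θ => by
    rw [tsum_mul_right, powerSum]
  simp_rw [h2] at h1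
  rw [← h1.tsum_eq, tsum_eq_single m]
  · have : ∀ θ, c m * (w * unitExp θ) ^ m * conj (unitExp θ) ^ m =
        c m * w ^ m * (unitExp θ ^ m * conj (unitExp θ) ^ m) := fun θ => by ring
    simp_rw [this]
    rw [integral_const_mul, integral_unitExp_mul_conj]
    simp
  · intro n hn
    have : ∀ θ, c n * (w * unitExp θ) ^ n * conj (unitExp θ) ^ m =
        c n * w ^ n * (unitExp θ ^ n * conj (unitExp θ) ^ m) := fun θ => by ring
    simp_rw [this]
    rw [integral_const_mul, integral_unitExp_mul_conj]
    simp [hn]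

-- Parseval: only the second series is expanded, the first factor being bounded on the circle, and
-- each term is a Fourier coefficient of the first.
include hd in
theorem HasUnitRadius.hasSum_integral_mul_conj {w v : ℂ} (hw : ‖w‖ < 1) (hv : ‖v‖ < 1) :
    HasSum (fun n => c n * w ^ n * conj (d n * v ^ n))
      (∫ θ, powerSum c (w * unitExp θ) * conj (powerSum d (v * unitExp θ)) ∂arcMeasure) := by
  set M := ∑' n, ‖c n‖ * ‖w‖ ^ n
  have hM : ∀ θ, ‖powerSum c (w * unitExp θ)‖ ≤ M := fun θ =>
    hc.norm_powerSum_le ⟨norm_nonneg _, hw⟩ (by simp [norm_unitExp])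
  have hnorm : ∀ n θ, ‖powerSum c (w * unitExp θ) * conj (d n * (v * unitExp θ) ^ n)‖ ≤
      M * (‖d n‖ * ‖v‖ ^ n) := fun n θ => by
    rw [norm_mul]
    refine mul_le_mul (hM θ) ?_ (norm_nonneg _) ((norm_nonneg _).trans (hM θ))
    simp [norm_unitExp]
  have hcont : ∀ n, Continuous fun θ =>
      powerSum c (w * unitExp θ) * conj (d n * (v * unitExp θ) ^ n) := fun n => by
    have := continuous_unitExp
    have := hc.continuous_circle hw
    fun_prop
  have hint : ∀ n, Integrable (fun θ =>
      powerSum c (w * unitExp θ) * conj (d n * (v * unitExp θ) ^ n)) arcMeasure := fun n =>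
    (integrable_const (M * (‖d n‖ * ‖v‖ ^ n))).mono' (hcont n).aestronglyMeasurable
      (Eventually.of_forall (hnorm n))
  have h1 := hasSum_integral_of_summable_integral_norm hint (by
    refine Summable.of_nonneg_of_le (fun n => integral_nonneg fun θ => norm_nonneg _) (fun n => ?_)
      ((hd ‖v‖ ⟨norm_nonneg _, hv⟩).mul_left M)
    refine (integral_mono (hint n).norm (integrable_const _) (hnorm n)).trans ?_
    simp)
  have h2 : ∀ θ, ∑' n, powerSum c (w * unitExp θ) * conj (d n * (v * unitExp θ) ^ n) =
      powerSum c (w * unitExp θ) * conj (powerSum d (v * unitExp θ)) := fun θ => by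
    rw [tsum_mul_left, powerSum, powerSum, Complex.conj_tsum]
  simp_rw [h2] at h1
  have e : (fun n => ∫ θ, powerSum c (w * unitExp θ) * conj (d n * (v * unitExp θ) ^ n)
      ∂arcMeasure) = fun n => c n * w ^ n * conj (d n * v ^ n) := by
    ext n
    have : ∀ θ, powerSum c (w * unitExp θ) * conj (d n * (v * unitExp θ) ^ n) =
        conj (d n * v ^ n) * (powerSum c (w * unitExp θ) * conj (unitExp θ) ^ n) := fun θ => by
      simp only [map_mul, map_pow]; ring
    simp_rw [this]
    rw [integral_const_mul, hc.integral_mul_conj_unitExp hw]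
    ring
  rwa [e] at h1

theorem HasUnitRadius.hasSum_norm_sq {w : ℂ} (hw : ‖w‖ < 1) :
    HasSum (fun n => ‖c n‖ ^ 2 * ‖w‖ ^ (2 * n))
      (∫ θ, ‖powerSum c (w * unitExp θ)‖ ^ 2 ∂arcMeasure) := by
  have h1 := hc.hasSum_integral_mul_conj hc hw hw
  have e1 : (fun n => c n * w ^ n * conj (c n * w ^ n)) =
      fun n => ((‖c n‖ ^ 2 * ‖w‖ ^ (2 * n) : ℝ) : ℂ) := by
    ext n
    rw [Complex.mul_conj, Complex.normSq_eq_norm_sq, norm_mul, norm_pow]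
    congr 1; ring
  have e2 : ∀ θ, powerSum c (w * unitExp θ) * conj (powerSum c (w * unitExp θ)) =
      ((‖powerSum c (w * unitExp θ)‖ ^ 2 : ℝ) : ℂ) := fun θ => by
    rw [Complex.mul_conj, Complex.normSq_eq_norm_sq]
  simp_rw [e1, e2] at h1
  rw [integral_complex_ofReal] at h1
  exact_mod_cast h1

end

/-! ### Moments and area integrals of products -/

/-- The even moments of the radial measure. -/
def moment (ω : ℝ → ℝ) (n : ℕ) : ℝ := ∫ r, r ^ (2 * n) ∂radialMeasure ω

/-- The even moments of the radial measure restricted to `r < ρ`. -/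
def partialMoment (ω : ℝ → ℝ) (ρ : ℝ) (n : ℕ) : ℝ := ∫ r in Iio ρ, r ^ (2 * n) ∂radialMeasure ω

theorem partialMoment_nonneg (ω : ℝ → ℝ) (ρ : ℝ) (n : ℕ) : 0 ≤ partialMoment ω ρ n :=
  integral_nonneg fun r => by simp only [pow_mul]; positivity

section
variable {ω : ℝ → ℝ} (h : IsRadialWeight ω)
include h

theorem IsRadialWeight.integral_radialMeasure (F : ℝ → ℝ) :
    ∫ r, F r ∂radialMeasure ω = ∫ r in Ioo (0 : ℝ) 1, 2 * r * ω r * F r := by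
  rw [radialMeasure, integral_withDensity_eq_integral_toReal_smul₀]
  · refine setIntegral_congr_fun measurableSet_Ioo fun r hr => ?_
    have := h.nonneg r (Ioo_subset_Ico_self hr)
    have := hr.1.le
    simp only [smul_eq_mul]
    rw [ENNReal.toReal_ofReal (by positivity)]
  · exact ((measurable_const.mul measurable_id).aemeasurable.mul h.aemeasurable).ennreal_ofReal
  · exact Eventually.of_forall fun _ => ENNReal.ofReal_lt_top

theorem IsRadialWeight.integrable_of_bound {F : ℝ → ℝ} (hF : Measurable F) {C : ℝ}
    (hC : ∀ r ∈ Ioo (0 : ℝ) 1, |F r| ≤ C) : Integrable F (radialMeasure ω) := by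
  have := h.isFiniteMeasure_radialMeasure
  refine (integrable_const C).mono' hF.aestronglyMeasurable ?_
  filter_upwards [ae_radialMeasure ω] with r hr using hC r hr

theorem IsRadialWeight.integrable_pow (n : ℕ) :
    Integrable (fun r => r ^ n) (radialMeasure ω) :=
  h.integrable_of_bound (C := 1) (by fun_prop) fun r hr => by
    rw [abs_of_nonneg (pow_nonneg hr.1.le _)]
    exact pow_le_one₀ hr.1.le hr.2.le

theorem IsRadialWeight.integrableOn_mul {F : ℝ → ℝ} (hF : Measurable F) {C : ℝ}
    (hC : ∀ r ∈ Ioo (0 : ℝ) 1, |F r| ≤ C) : IntegrableOn (fun r => ω r * F r) (Ioo 0 1) := by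
  refine Integrable.mono' (h.integrable_Ioo.norm.mul_const C)
    (h.integrable_Ioo.aestronglyMeasurable.mul hF.aestronglyMeasurable) ?_
  filter_upwards [ae_restrict_mem measurableSet_Ioo] with r hr
  rw [norm_mul]
  exact mul_le_mul_of_nonneg_left (hC r hr) (norm_nonneg _)

theorem IsRadialWeight.tail_le_moment (n : ℕ) {y : ℝ} (hy : y ∈ Ico (0 : ℝ) 1) :
    2 * y ^ (2 * n + 1) * tail ω y ≤ moment ω n := by
  rw [moment, h.integral_radialMeasure, tail, ← integral_const_mul]
  have hi : IntegrableOn (fun r => 2 * r * ω r * r ^ (2 * n)) (Ioo 0 1) := by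
    refine (h.integrableOn_mul (F := fun r => 2 * r * r ^ (2 * n)) (by fun_prop) (C := 2)
      fun r hr => ?_).congr_fun (fun r _ => ?_) measurableSet_Ioo
    · have := hr.1.le
      rw [abs_of_nonneg (by positivity)]
      have := pow_le_one₀ (n := 2 * n) hr.1.le hr.2.le
      have := hr.2.le
      calc 2 * r * r ^ (2 * n) ≤ 2 * 1 * 1 := by gcongr
        _ = 2 := by norm_num
    · ring
  rw [integral_Ico_eq_integral_Ioo]
  have hsub : Ioo y 1 ⊆ Ioo 0 1 := Ioo_subset_Ioo_left hy.1
  refine (setIntegral_mono_on ((h.integrable_Ioo.mono_set hsub).const_mul _) (hi.mono_set hsub)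
    measurableSet_Ioo fun r hr => ?_).trans (setIntegral_mono_set hi ?_ hsub.eventuallyLE)
  · have h0 := h.nonneg r (Ioo_subset_Ico_self (hsub hr))
    have := pow_le_pow_left₀ hy.1 hr.1.le (2 * n + 1)
    calc 2 * y ^ (2 * n + 1) * ω r ≤ 2 * r ^ (2 * n + 1) * ω r := by gcongr
      _ = _ := by ring
  · filter_upwards [ae_restrict_mem measurableSet_Ioo] with r hr
    have h0 := h.nonneg r (Ioo_subset_Ico_self hr)
    have := hr.1.le
    positivity

theorem IsRadialWeight.moment_pos (n : ℕ) : 0 < moment ω n := by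
  have h1 := h.tail_le_moment n (y := 1 / 2) (by norm_num)
  have h2 := h.tail_pos (1 / 2) (by norm_num)
  exact lt_of_lt_of_le (by positivity) h1

/-- At radius $\sqrt x$ the lower bound `tail_le_moment` reads $W_n\ge 2x^n\sqrt
x\,\widehat\omega(\sqrt x)$, so $x^n/W_n$ is bounded for every $x<1$. This is where positivity of
the tail near the boundary makes the kernel converge. -/
theorem IsRadialWeight.hasUnitRadius_inv_moment :
    HasUnitRadius fun n => ((moment ω n)⁻¹ : ℝ) := by
  refine hasUnitRadius_of_bound fun x hx => ?_
  have hs : Real.sqrt x ∈ Ioo (0 : ℝ) 1 :=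
    ⟨Real.sqrt_pos.2 hx.1, by rw [Real.sqrt_lt' one_pos]; simpa using hx.2⟩
  have hT := h.tail_pos _ (Ioo_subset_Ico_self hs)
  refine ⟨(2 * Real.sqrt x * tail ω (Real.sqrt x))⁻¹, fun n => ?_⟩
  have h1 := h.tail_le_moment n (Ioo_subset_Ico_self hs)
  have h2 := h.moment_pos n
  have h3 : Real.sqrt x ^ (2 * n + 1) = x ^ n * Real.sqrt x := by
    rw [pow_succ, pow_mul, Real.sq_sqrt hx.1.le]
  rw [h3] at h1
  have hs0 := hs.1
  rw [Complex.norm_real, Real.norm_of_nonneg (inv_pos.2 h2).le, inv_mul_eq_div,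
    div_le_iff₀ h2, inv_mul_eq_div, le_div_iff₀ (by positivity)]
  linarith

theorem IsRadialWeight.integral_mul_conj_pow {f : ℂ → ℂ} (hf : IsAnalytic f)
    (hi : Integrable f (areaMeasure ω)) (n : ℕ) :
    ∫ z, f z * conj z ^ n ∂areaMeasure ω = taylorCoeff f n * moment ω n := by
  have hi' : Integrable (fun z => f z * conj z ^ n) (areaMeasure ω) := by
    refine hi.norm.mono' (hi.1.mul (by fun_prop)) ?_
    filter_upwards [ae_areaMeasure ω] with z hz
    rw [norm_mul, norm_pow, Complex.norm_conj]
    exact mul_le_of_le_one_right (norm_nonneg _)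
      (pow_le_one₀ (norm_nonneg _) (mem_ball_zero_iff.1 hz).le)
  rw [h.integral_areaMeasure hi', moment, ← integral_complex_ofReal, ← integral_const_mul]
  refine integral_congr_ae ?_
  filter_upwards [ae_radialMeasure ω] with r hr
  have hr1 : ‖(r : ℂ)‖ < 1 := by simpa [abs_of_pos hr.1] using hr.2
  have e : ∀ θ, f (polarMap (r, θ)) * conj (polarMap (r, θ)) ^ n =
      (r : ℂ) ^ n * (powerSum (taylorCoeff f) (r * unitExp θ) * conj (unitExp θ) ^ n) := fun θ => by
    rw [hf.eqOn_powerSum (by simpa [norm_polarMap, abs_of_pos hr.1] using hr.2), polarMap_eq]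
    simp only [map_mul, Complex.conj_ofReal]
    ring
  simp_rw [e]
  rw [integral_const_mul, hf.hasUnitRadius.integral_mul_conj_unitExp hr1]
  push_cast
  ring

/-- On a smaller disc both series converge uniformly, so no growth condition at the boundary is
needed. The pairing is then computed by letting the partial moments tend to the moments. -/
theorem IsRadialWeight.hasSum_setIntegral_mul_conj {c d : ℕ → ℂ} (hc : HasUnitRadius c)
    (hd : HasUnitRadius d) {ρ : ℝ} (hρ : ρ ∈ Ioo (0 : ℝ) 1) :
    HasSum (fun n => c n * conj (d n) * partialMoment ω ρ n)
      (∫ z in ball (0 : ℂ) ρ, powerSum c z * conj (powerSum d z) ∂areaMeasure ω) := by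
  have := h.isFiniteMeasure_radialMeasure
  have := h.isFiniteMeasure_areaMeasure
  have hρ' : ρ ∈ Ico (0 : ℝ) 1 := Ioo_subset_Ico_self hρ
  have hsub : ball (0 : ℂ) ρ ⊆ ball 0 1 := ball_subset_ball hρ.2.le
  have hcont : ContinuousOn (fun z => powerSum c z * conj (powerSum d z)) (ball (0 : ℂ) ρ) :=
    (hc.continuousOn.mono hsub).mul
      (Complex.continuous_conj.comp_continuousOn (hd.continuousOn.mono hsub))
  have hi : IntegrableOn (fun z => powerSum c z * conj (powerSum d z)) (ball (0 : ℂ) ρ)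
      (areaMeasure ω) := by
    refine Integrable.mono' (integrable_const ((∑' n, ‖c n‖ * ρ ^ n) * (∑' n, ‖d n‖ * ρ ^ n)))
      (hcont.aestronglyMeasurable measurableSet_ball) ?_
    filter_upwards [ae_restrict_mem measurableSet_ball] with z hz
    have hz' := (mem_ball_zero_iff.1 hz).le
    rw [norm_mul, Complex.norm_conj]
    have h1 := hc.norm_powerSum_le hρ' hz'
    exact mul_le_mul h1 (hd.norm_powerSum_le hρ' hz') (norm_nonneg _) ((norm_nonneg _).trans h1)
  rw [← integral_indicator measurableSet_ball,
    h.integral_areaMeasure ((integrable_indicator_iff measurableSet_ball).2 hi)]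
  have hmeas : ∀ n : ℕ, Measurable fun r : ℝ => c n * conj (d n) * (r : ℂ) ^ (2 * n) := by
    intro n; fun_prop
  have hbd : ∀ n, ∀ᵐ r : ℝ ∂(radialMeasure ω).restrict (Iio ρ),
      ‖c n * conj (d n) * (r : ℂ) ^ (2 * n)‖ ≤ (‖c n‖ * ρ ^ n) * (‖d n‖ * ρ ^ n) := fun n => by
    filter_upwards [ae_restrict_mem measurableSet_Iio, ae_restrict_of_ae (ae_radialMeasure ω)]
      with r hr hr1
    simp only [norm_mul, Complex.norm_conj, norm_pow, Complex.norm_real,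
      Real.norm_of_nonneg hr1.1.le]
    have := pow_le_pow_left₀ hr1.1.le (le_of_lt hr) (2 * n)
    calc ‖c n‖ * ‖d n‖ * r ^ (2 * n) ≤ ‖c n‖ * ‖d n‖ * ρ ^ (2 * n) := by gcongr
      _ = _ := by ring
  have hint : ∀ n, Integrable (fun r : ℝ => c n * conj (d n) * (r : ℂ) ^ (2 * n))
      ((radialMeasure ω).restrict (Iio ρ)) := fun n =>
    (integrable_const _).mono' (hmeas n).aestronglyMeasurable (hbd n)
  have h1 := hasSum_integral_of_summable_integral_norm hint (by
    obtain ⟨K, hK0, hK⟩ := hc.exists_bound hρ'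
    refine Summable.of_nonneg_of_le (fun n => integral_nonneg fun θ => norm_nonneg _) (fun n => ?_)
      (((hd ρ hρ').mul_left K).mul_right (((radialMeasure ω).restrict (Iio ρ)).real univ))
    refine (integral_mono_ae (hint n).norm (integrable_const (K * (‖d n‖ * ρ ^ n))) ?_).trans ?_
    · filter_upwards [hbd n] with r hr
      exact hr.trans (mul_le_mul_of_nonneg_right (hK n)
        (mul_nonneg (norm_nonneg _) (pow_nonneg hρ.1.le _)))
    · rw [integral_const, smul_eq_mul, mul_comm])
  have e1 : (fun n => ∫ r in Iio ρ, c n * conj (d n) * (r : ℂ) ^ (2 * n) ∂radialMeasure ω) =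
      fun n => c n * conj (d n) * partialMoment ω ρ n := by
    ext n
    rw [integral_const_mul, partialMoment, ← integral_complex_ofReal]
    push_cast
    rfl
  rw [e1] at h1
  refine Eq.subst (motive := fun t => HasSum _ t) (Eq.symm ?_) h1
  rw [← integral_indicator measurableSet_Iio]
  refine integral_congr_ae ?_
  filter_upwards [ae_radialMeasure ω] with r hr
  have hr1 : ‖(r : ℂ)‖ < 1 := by simpa [abs_of_pos hr.1] using hr.2
  by_cases hrρ : r < ρ
  · have : ∀ θ, polarMap (r, θ) ∈ ball (0 : ℂ) ρ := fun θ => by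
      simpa [norm_polarMap, abs_of_pos hr.1] using hrρ
    simp only [indicator_of_mem (this _), indicator_of_mem (show r ∈ Iio ρ from hrρ)]
    simp_rw [polarMap_eq]
    rw [← (hc.hasSum_integral_mul_conj hd hr1 hr1).tsum_eq]
    refine tsum_congr fun n => ?_
    simp only [map_mul, map_pow, Complex.conj_ofReal]
    ring
  · have : ∀ θ, polarMap (r, θ) ∉ ball (0 : ℂ) ρ := fun θ => by
      simpa [norm_polarMap, abs_of_pos hr.1] using not_lt.1 hrρ
    simp only [indicator_of_notMem (this _), indicator_of_notMem (show r ∉ Iio ρ from hrρ),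
      integral_zero]

theorem IsRadialWeight.tendsto_partialMoment (n : ℕ) :
    Tendsto (fun ρ => partialMoment ω ρ n) (𝓝[<] 1) (𝓝 (moment ω n)) := by
  unfold partialMoment moment
  simp_rw [← integral_indicator (measurableSet_Iio (α := ℝ))]
  refine tendsto_integral_filter_of_dominated_convergence (fun r => |r ^ (2 * n)|)
    (Eventually.of_forall fun ρ => ?_) (Eventually.of_forall fun ρ => Eventually.of_forall
      fun r => norm_indicator_le_norm_self _ _) (h.integrable_pow (2 * n)).abs ?_
  · exact ((measurable_id.pow_const _).indicator measurableSet_Iio).aestronglyMeasurable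
  · filter_upwards [ae_radialMeasure ω] with r hr
    refine tendsto_const_nhds.congr' ?_
    filter_upwards [Ioo_mem_nhdsLT hr.2] with ρ hρ
    rw [indicator_of_mem]
    exact hρ.1

theorem IsRadialWeight.partialMoment_le (ρ : ℝ) (n : ℕ) : partialMoment ω ρ n ≤ moment ω n :=
  setIntegral_le_integral (h.integrable_pow _)
    (Eventually.of_forall fun r => by simp only [pow_mul]; positivity)

end

/-! ### The Bergman kernel and projection as power series -/

/-- The reciprocals of the moments, as complex numbers. -/
def invMoment (ω : ℝ → ℝ) (n : ℕ) : ℂ := ((moment ω n)⁻¹ : ℝ)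

/-- The reproducing kernel as a power series. -/
def kernelSeries (ω : ℝ → ℝ) (z : ℂ) : ℂ → ℂ := powerSum fun n => invMoment ω n * conj z ^ n

/-- The Taylor coefficients of the Bergman projection of `f`. -/
def projCoeff (ω : ℝ → ℝ) (f : ℂ → ℂ) (n : ℕ) : ℂ :=
  invMoment ω n * ∫ ζ, f ζ * conj ζ ^ n ∂areaMeasure ω

theorem conj_invMoment (ω : ℝ → ℝ) (n : ℕ) : conj (invMoment ω n) = invMoment ω n :=
  Complex.conj_ofReal _

theorem norm_integral_mul_conj_pow_le {ω : ℝ → ℝ} {f : ℂ → ℂ} (hf : Integrable f (areaMeasure ω))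
    (n : ℕ) : ‖∫ ζ, f ζ * conj ζ ^ n ∂areaMeasure ω‖ ≤ ∫ ζ, ‖f ζ‖ ∂areaMeasure ω := by
  refine norm_integral_le_of_norm_le hf.norm ?_
  filter_upwards [ae_areaMeasure ω] with z hz
  rw [norm_mul, norm_pow, Complex.norm_conj]
  exact mul_le_of_le_one_right (norm_nonneg _)
    (pow_le_one₀ (norm_nonneg _) (mem_ball_zero_iff.1 hz).le)

/-- Hölder's inequality for the integral of a product. -/
theorem norm_integral_mul_le {μ : Measure ℂ} {p q : ℝ} (hpq : p.HolderConjugate q) {u f : ℂ → ℂ}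
    (hu : MemLp u (ENNReal.ofReal p) μ) (hf : MemLp f (ENNReal.ofReal q) μ) :
    ‖∫ z, u z * f z ∂μ‖ ≤ (eLpNorm u (ENNReal.ofReal p) μ).toReal *
      (eLpNorm f (ENNReal.ofReal q) μ).toReal := by
  have hpq' : ENNReal.HolderConjugate (ENNReal.ofReal p) (ENNReal.ofReal q) := hpq.ennrealOfReal
  have h1 : eLpNorm (u • f) 1 μ ≤ eLpNorm u (ENNReal.ofReal p) μ * eLpNorm f (ENNReal.ofReal q) μ :=
    eLpNorm_smul_le_mul_eLpNorm hf.1 hu.1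
  have hint : Integrable (fun z => u z * f z) μ :=
    MemLp.integrable_mul (p := ENNReal.ofReal p) (q := ENNReal.ofReal q) hu hf
  calc ‖∫ z, u z * f z ∂μ‖ ≤ ∫ z, ‖u z * f z‖ ∂μ := norm_integral_le_integral_norm _
    _ = (eLpNorm (u • f) 1 μ).toReal := by
      rw [eLpNorm_one_eq_lintegral_enorm, integral_norm_eq_lintegral_enorm hint.1]; rfl
    _ ≤ _ := by
      rw [← ENNReal.toReal_mul]
      exact ENNReal.toReal_mono (ENNReal.mul_ne_top hu.2.ne hf.2.ne) h1

section
variable {ω : ℝ → ℝ} (h : IsRadialWeight ω)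
include h

theorem IsRadialWeight.hasUnitRadius_invMoment : HasUnitRadius (invMoment ω) :=
  h.hasUnitRadius_inv_moment

theorem IsRadialWeight.invMoment_mul_moment (n : ℕ) : invMoment ω n * moment ω n = 1 := by
  rw [invMoment, ← Complex.ofReal_mul, inv_mul_cancel₀ (h.moment_pos n).ne', Complex.ofReal_one]

theorem IsRadialWeight.hasUnitRadius_kernel {z : ℂ} (hz : ‖z‖ ≤ 1) :
    HasUnitRadius fun n => invMoment ω n * conj z ^ n :=
  h.hasUnitRadius_invMoment.mul_pow (by simpa using hz)

omit h in
theorem IsAnalytic.aestronglyMeasurable {f : ℂ → ℂ} (hf : IsAnalytic f) :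
    AEStronglyMeasurable f (areaMeasure ω) := by
  have : (areaMeasure ω).restrict (ball 0 1) = areaMeasure ω :=
    Measure.restrict_eq_self_of_ae_mem (ae_areaMeasure ω)
  rw [← this]
  exact (DifferentiableOn.continuousOn hf).aestronglyMeasurable measurableSet_ball

theorem IsRadialWeight.mem_bergmanSpace_of_bound {f : ℂ → ℂ} (hf : IsAnalytic f) {C : ℝ}
    (hC : ∀ z ∈ ball (0 : ℂ) 1, ‖f z‖ ≤ C) (p : ℝ) : f ∈ bergmanSpace ω p := by
  have := h.isFiniteMeasure_areaMeasure
  refine ⟨hf, MemLp.of_bound hf.aestronglyMeasurable C ?_⟩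
  filter_upwards [ae_areaMeasure ω] with z hz using hC z hz

theorem IsRadialWeight.pow_mem_bergmanSpace (n : ℕ) (p : ℝ) :
    (fun z => z ^ n) ∈ bergmanSpace ω p :=
  h.mem_bergmanSpace_of_bound (C := 1) (DifferentiableOn.pow differentiableOn_id n)
    (fun z hz => by
      change ‖z ^ n‖ ≤ 1
      rw [norm_pow]
      exact pow_le_one₀ (norm_nonneg _) (mem_ball_zero_iff.1 hz).le) p

theorem IsRadialWeight.integrable_of_memLebesgue {p : ℝ} (hp : 1 < p) {f : ℂ → ℂ}
    (hf : MemLebesgue ω p f) : Integrable f (areaMeasure ω) := by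
  have := h.isFiniteMeasure_areaMeasure
  exact MemLp.integrable (by rw [← ENNReal.ofReal_one]; exact ENNReal.ofReal_le_ofReal hp.le) hf

theorem IsRadialWeight.hasUnitRadius_projCoeff {f : ℂ → ℂ}
    (hf : Integrable f (areaMeasure ω)) : HasUnitRadius (projCoeff ω f) := by
  refine HasUnitRadius.of_norm_le (C := ∫ ζ, ‖f ζ‖ ∂areaMeasure ω) h.hasUnitRadius_invMoment
    fun n => ?_
  rw [projCoeff, norm_mul, mul_comm]
  exact mul_le_mul_of_nonneg_right (norm_integral_mul_conj_pow_le hf n) (norm_nonneg _)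

-- Termwise integration: $|z\bar\zeta|\le|z|<1$ gives a summable bound independent of $\zeta$. It
-- produces the series of the projection, of its derivatives, of the transposed operator and of the
-- functionals.
omit h in
theorem integral_mul_powerSum {μ : Measure ℂ} {f : ℂ → ℂ} (hf : Integrable f μ)
    (hμ : ∀ᵐ z ∂μ, z ∈ ball (0 : ℂ) 1) {c : ℕ → ℂ} (hc : HasUnitRadius c) {z : ℂ} (hz : ‖z‖ < 1) :
    HasSum (fun n => c n * z ^ n * ∫ ζ, f ζ * conj ζ ^ n ∂μ)
      (∫ ζ, f ζ * powerSum c (z * conj ζ) ∂μ) := by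
  have hb : ∀ n, ∀ᵐ ζ ∂μ, ‖f ζ * (c n * (z * conj ζ) ^ n)‖ ≤ ‖f ζ‖ * (‖c n‖ * ‖z‖ ^ n) := by
    intro n
    filter_upwards [hμ] with ζ hζ
    have h1 := pow_le_one₀ (n := n) (norm_nonneg _) (mem_ball_zero_iff.1 hζ).le
    rw [norm_mul, norm_mul, norm_pow, norm_mul, Complex.norm_conj, mul_pow]
    have : ‖z‖ ^ n * ‖ζ‖ ^ n ≤ ‖z‖ ^ n * 1 := by gcongr
    rw [mul_one] at this
    gcongr
  have hi : ∀ n, Integrable (fun ζ => f ζ * (c n * (z * conj ζ) ^ n)) μ := fun n =>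
    (hf.norm.mul_const _).mono' (hf.1.mul (by fun_prop)) (hb n)
  have h1 := hasSum_integral_of_summable_integral_norm hi (by
    refine Summable.of_nonneg_of_le (fun n => integral_nonneg fun θ => norm_nonneg _) (fun n => ?_)
      ((hc ‖z‖ ⟨norm_nonneg _, hz⟩).mul_left (∫ ζ, ‖f ζ‖ ∂μ))
    refine (integral_mono_ae (hi n).norm (hf.norm.mul_const _) (hb n)).trans ?_
    rw [integral_mul_const])
  have e1 : ∀ n, ∫ ζ, f ζ * (c n * (z * conj ζ) ^ n) ∂μ =
      c n * z ^ n * ∫ ζ, f ζ * conj ζ ^ n ∂μ := fun n => by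
    rw [← integral_const_mul]
    congr 1
    ext ζ
    ring
  simp_rw [e1, tsum_mul_left] at h1
  exact h1

omit h in
theorem conj_kernelSeries (z ζ : ℂ) :
    conj (kernelSeries ω z ζ) = powerSum (invMoment ω) (z * conj ζ) := by
  rw [kernelSeries, powerSum, powerSum, Complex.conj_tsum]
  refine tsum_congr fun n => ?_
  simp only [map_mul, map_pow, Complex.conj_conj, conj_invMoment]
  ring

theorem IsRadialWeight.integral_mul_conj_kernelSeries {f : ℂ → ℂ}
    (hf : Integrable f (areaMeasure ω)) {z : ℂ} (hz : ‖z‖ < 1) :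
    ∫ ζ, f ζ * conj (kernelSeries ω z ζ) ∂areaMeasure ω = powerSum (projCoeff ω f) z := by
  simp_rw [conj_kernelSeries]
  rw [← (integral_mul_powerSum hf (ae_areaMeasure ω) h.hasUnitRadius_invMoment hz).tsum_eq,
    powerSum]
  refine tsum_congr fun n => ?_
  rw [projCoeff]
  ring

theorem IsRadialWeight.projCoeff_of_isAnalytic {f : ℂ → ℂ} (hf : IsAnalytic f)
    (hi : Integrable f (areaMeasure ω)) : projCoeff ω f = taylorCoeff f := by
  ext n
  rw [projCoeff, h.integral_mul_conj_pow hf hi, mul_left_comm, h.invMoment_mul_moment, mul_one]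

theorem IsRadialWeight.kernelSeries_mem {z : ℂ} (hz : ‖z‖ < 1) (p : ℝ) :
    kernelSeries ω z ∈ bergmanSpace ω p := by
  refine h.mem_bergmanSpace_of_bound (h.hasUnitRadius_kernel hz.le).isAnalytic
    (C := ∑' n, ‖invMoment ω n‖ * ‖z‖ ^ n) (fun ζ hζ => ?_) p
  refine tsum_of_norm_bounded (h.hasUnitRadius_invMoment ‖z‖ ⟨norm_nonneg _, hz⟩).hasSum
    fun n => ?_
  simp only [norm_mul, norm_pow, Complex.norm_conj]
  exact mul_le_of_le_one_right (by positivity)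
    (pow_le_one₀ (norm_nonneg _) (mem_ball_zero_iff.1 hζ).le)

theorem IsRadialWeight.isReproducingKernel_kernelSeries :
    IsReproducingKernel ω (kernelSeries ω) := by
  intro z hz
  have hz' := mem_ball_zero_iff.1 hz
  refine ⟨h.kernelSeries_mem hz' 2, fun f hf => ?_⟩
  have hi := h.integrable_of_memLebesgue one_lt_two hf.2
  rw [h.integral_mul_conj_kernelSeries hi hz', h.projCoeff_of_isAnalytic hf.1 hi]
  exact hf.1.eqOn_powerSum hz

/-- The chosen kernel satisfies the reproducing property because the series is one witness; applying
that property to each monomial and conjugating determines all its Taylor coefficients. -/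
theorem IsRadialWeight.bergmanKernel_eqOn {z : ℂ} (hz : z ∈ ball (0 : ℂ) 1) :
    EqOn (bergmanKernel ω z) (kernelSeries ω z) (ball 0 1) := by
  have hB : IsReproducingKernel ω (bergmanKernel ω) :=
    Classical.epsilon_spec ⟨_, h.isReproducingKernel_kernelSeries⟩
  obtain ⟨hm, hr⟩ := hB z hz
  have hz' := mem_ball_zero_iff.1 hz
  refine IsAnalytic.eqOn_of_taylorCoeff_eq hm.1 (h.kernelSeries_mem hz' 2).1 ?_
  rw [kernelSeries, (h.hasUnitRadius_kernel hz'.le).taylorCoeff_powerSum]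
  ext n
  have h1 := hr _ (h.pow_mem_bergmanSpace n 2)
  have hi := h.integrable_of_memLebesgue one_lt_two hm.2
  have h2 := h.integral_mul_conj_pow hm.1 hi n
  have h3 := congrArg conj h1
  rw [← integral_conj] at h3
  simp only [map_mul, Complex.conj_conj, map_pow] at h3
  simp_rw [mul_comm _ (bergmanKernel ω z _)] at h3
  rw [h2] at h3
  rw [h3, mul_left_comm, h.invMoment_mul_moment, mul_one]

theorem IsRadialWeight.bergmanProjection_eqOn {f : ℂ → ℂ} (hf : Integrable f (areaMeasure ω)) :
    EqOn (bergmanProjection ω f) (powerSum (projCoeff ω f)) (ball 0 1) := by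
  intro z hz
  rw [← h.integral_mul_conj_kernelSeries hf (mem_ball_zero_iff.1 hz), bergmanProjection]
  refine integral_congr_ae ?_
  filter_upwards [ae_areaMeasure ω] with ζ hζ
  rw [h.bergmanKernel_eqOn hz hζ]

theorem IsRadialWeight.bergmanProjection_of_isAnalytic {f : ℂ → ℂ} (hf : IsAnalytic f)
    (hi : Integrable f (areaMeasure ω)) : EqOn (bergmanProjection ω f) f (ball 0 1) := by
  intro z hz
  rw [h.bergmanProjection_eqOn hi hz, h.projCoeff_of_isAnalytic hf hi, hf.eqOn_powerSum hz]

omit h in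
theorem lebesgueNorm_congr {p : ℝ} {f g : ℂ → ℂ} (hfg : EqOn f g (ball (0 : ℂ) 1)) :
    lebesgueNorm ω p f = lebesgueNorm ω p g := by
  rw [lebesgueNorm, lebesgueNorm, eLpNorm_congr_ae]
  filter_upwards [ae_areaMeasure ω] with z hz using hfg hz

omit h in
theorem MemLebesgue.congr {p : ℝ} {f g : ℂ → ℂ} (hfg : EqOn f g (ball (0 : ℂ) 1))
    (hf : MemLebesgue ω p f) : MemLebesgue ω p g := by
  refine MemLp.ae_eq ?_ hf
  filter_upwards [ae_areaMeasure ω] with z hz using hfg hz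

omit h in
theorem MemDirichlet.congr {p : ℝ} {k : ℕ} {f g : ℂ → ℂ} (hfg : EqOn f g (ball (0 : ℂ) 1))
    (hf : MemDirichlet ω p k f) : MemDirichlet ω p k g :=
  ⟨hf.1.congr hfg.symm, hf.2.congr (iteratedDeriv_congr_ball hfg k)⟩

omit h in
theorem dirichletNorm_congr {p : ℝ} {k : ℕ} {f g : ℂ → ℂ} (hfg : EqOn f g (ball (0 : ℂ) 1)) :
    dirichletNorm ω p k f = dirichletNorm ω p k g := by
  rw [dirichletNorm, dirichletNorm, lebesgueNorm_congr (iteratedDeriv_congr_ball hfg k)]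
  congr 1
  refine Finset.sum_congr rfl fun j _ => ?_
  rw [iteratedDeriv_congr_ball hfg j (by simp)]

/-- The projection fixes $A^p_\omega$: the coefficient formula requires only integrability, which
holds for $p>1$ since the measure is finite. -/
theorem IsRadialWeight.identityBounded_of_projectionBounded {p : ℝ} (hp : 1 < p) {k : ℕ}
    (hP : ProjectionBounded ω p k) : IdentityBounded ω p k := by
  obtain ⟨C, hC, hCf⟩ := hP
  refine ⟨C, hC, fun f hf => ?_⟩
  have he := h.bergmanProjection_of_isAnalytic hf.1 (h.integrable_of_memLebesgue hp hf.2)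
  obtain ⟨h1, h2⟩ := hCf f hf.2
  exact ⟨h1.congr he, by rwa [dirichletNorm_congr he] at h2⟩

/-! ### Representing functions are determined by the pairing with monomials -/

/-- Orthogonality leaves one term, $r^n$ times a coefficient times a partial moment; letting
$\rho\to1$ and then $r\to1$ gives the value, whatever the growth of `g`. Hence any representative of
a functional has prescribed coefficients. -/
theorem IsRadialWeight.hasPairing_pow {g : ℂ → ℂ} (hg : IsAnalytic g) (n : ℕ) {a : ℂ}
    (ha : HasPairing ω (fun z => z ^ n) g a) : a = conj (taylorCoeff g n) * moment ω n := by
  obtain ⟨I, hI, hIa⟩ := ha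
  have hpow : HasUnitRadius fun m => if m = n then (1 : ℂ) else 0 := by
    intro x _
    refine summable_of_ne_finset_zero (s := {n}) fun m hm => ?_
    simp at hm
    simp [hm]
  have hpowS : ∀ z, powerSum (fun m => if m = n then (1 : ℂ) else 0) z = z ^ n := fun z => by
    rw [powerSum, tsum_eq_single n]
    · simp
    · intro m hm; simp [hm]
  have e : ∀ r ∈ Ioo (0 : ℝ) 1, I r = (r : ℂ) ^ n * (conj (taylorCoeff g n) * moment ω n) := by
    intro r hr
    refine tendsto_nhds_unique (hI r hr) ?_
    have h1 : Tendsto (fun ρ => (r : ℂ) ^ n * (conj (taylorCoeff g n) * partialMoment ω ρ n))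
        (𝓝[<] 1) (𝓝 ((r : ℂ) ^ n * (conj (taylorCoeff g n) * moment ω n))) := by
      refine Tendsto.const_mul _ (Tendsto.const_mul _ ?_)
      exact (Complex.continuous_ofReal.tendsto _).comp (h.tendsto_partialMoment n)
    refine h1.congr' ?_
    filter_upwards [Ioo_mem_nhdsLT zero_lt_one] with ρ hρ
    have h2 := (h.hasSum_setIntegral_mul_conj hpow hg.hasUnitRadius hρ).tsum_eq
    rw [tsum_eq_single n (by intro m hm; simp [hm])] at h2
    simp only [if_true, one_mul] at h2
    rw [h2, ← integral_const_mul]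
    refine setIntegral_congr_fun measurableSet_ball fun z hz => ?_
    simp only [hpowS]
    rw [hg.eqOn_powerSum (ball_subset_ball hρ.2.le hz)]
    ring
  refine tendsto_nhds_unique hIa ?_
  have h1 : Tendsto (fun r : ℝ => (r : ℂ) ^ n * (conj (taylorCoeff g n) * moment ω n))
      (𝓝[<] 1) (𝓝 (((1 : ℝ) : ℂ) ^ n * (conj (taylorCoeff g n) * moment ω n))) :=
    (Continuous.tendsto (by fun_prop) 1).mono_left nhdsWithin_le_nhds
  simp only [Complex.ofReal_one, one_pow, one_mul] at h1
  refine h1.congr' ?_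
  filter_upwards [Ioo_mem_nhdsLT zero_lt_one] with r hr
  rw [e r hr]

/-- The Taylor coefficients of an analytic function representing `L`. -/
theorem IsRadialWeight.taylorCoeff_of_represents {q : ℝ} {L : bergmanSpace ω q →ₗ[ℂ] ℂ}
    {g : ℂ → ℂ} (hg : IsAnalytic g) (hL : Represents ω q L g) (n : ℕ) :
    taylorCoeff g n = conj (L ⟨_, h.pow_mem_bergmanSpace n q⟩) * invMoment ω n := by
  have h1 := h.hasPairing_pow hg n (hL ⟨_, h.pow_mem_bergmanSpace n q⟩)
  rw [h1]
  simp only [map_mul, Complex.conj_conj, Complex.conj_ofReal]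
  rw [mul_assoc, mul_comm (moment ω n : ℂ), h.invMoment_mul_moment, mul_one]

omit h in
theorem functionalNorm_le {q : ℝ} {L : bergmanSpace ω q →ₗ[ℂ] ℂ} {M : ℝ}
    (hM : IsFunctionalBound ω q L M) : functionalNorm ω q L ≤ M :=
  csInf_le ⟨0, fun _ hx => hx.1⟩ hM

/-- Apply the embedding to $u\mapsto\int u\bar f\omega\,dA$, whose norm is at most that of $f$ by
Hölder. The representative supplied has the Taylor coefficients of $f$, so it is $f$. -/
theorem IsRadialWeight.identityBounded_of_dualEmbedded {p : ℝ} (hp : 1 < p) {k : ℕ}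
    (hD : DualEmbedded ω p k) : IdentityBounded ω p k := by
  have := h.isFiniteMeasure_areaMeasure
  obtain ⟨C, hC, hCL⟩ := hD
  refine ⟨C, hC, fun f hf => ?_⟩
  set q := Real.conjExponent p
  have hpq : p.HolderConjugate q := Real.HolderConjugate.conjExponent hp
  have hpq' : ENNReal.HolderConjugate (ENNReal.ofReal q) (ENNReal.ofReal p) :=
    hpq.symm.ennrealOfReal
  have hf' : MemLp (fun z => conj (f z)) (ENNReal.ofReal p) (areaMeasure ω) := MemLp.star hf.2
  have hint : ∀ u : bergmanSpace ω q, Integrable (fun z => (u : ℂ → ℂ) z * conj (f z))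
      (areaMeasure ω) := fun u => MemLp.integrable_mul (p := ENNReal.ofReal q)
        (q := ENNReal.ofReal p) u.2.2 hf'
  let L : bergmanSpace ω q →ₗ[ℂ] ℂ :=
    { toFun := fun u => ∫ z, (u : ℂ → ℂ) z * conj (f z) ∂areaMeasure ω
      map_add' := fun u v => by
        rw [← integral_add (hint u) (hint v)]
        congr 1
        ext z
        simp [add_mul]
      map_smul' := fun a u => by
        rw [RingHom.id_apply, smul_eq_mul, ← integral_const_mul]
        congr 1
        ext z
        simp [mul_assoc] }
  have hLM : IsFunctionalBound ω q L (lebesgueNorm ω p f) := by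
    refine ⟨ENNReal.toReal_nonneg, fun u => ?_⟩
    have h2 : eLpNorm (fun z => conj (f z)) (ENNReal.ofReal p) (areaMeasure ω) =
        eLpNorm f (ENNReal.ofReal p) (areaMeasure ω) :=
      eLpNorm_congr_norm_ae (Eventually.of_forall fun z => by simp)
    have h1 := norm_integral_mul_le hpq.symm u.2.2 hf'
    rw [h2, mul_comm] at h1
    exact h1
  obtain ⟨g, hg, hrep, hnorm, -⟩ := hCL L ⟨_, hLM⟩
  have hgf : EqOn g f (ball 0 1) := by
    refine IsAnalytic.eqOn_of_taylorCoeff_eq hg.1 hf.1 (funext fun n => ?_)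
    rw [h.taylorCoeff_of_represents hg.1 hrep n]
    have h1 := h.integral_mul_conj_pow hf.1 (h.integrable_of_memLebesgue hp hf.2) n
    have h2 : conj (L ⟨_, h.pow_mem_bergmanSpace n q⟩) = taylorCoeff f n * moment ω n := by
      rw [← h1]
      change conj (∫ z, z ^ n * conj (f z) ∂areaMeasure ω) = _
      rw [← integral_conj]
      congr 1
      ext z
      simp [mul_comm]
    rw [h2, mul_assoc, mul_comm (moment ω n : ℂ), h.invMoment_mul_moment, mul_one]
  refine ⟨hg.congr hgf, ?_⟩
  rw [← dirichletNorm_congr hgf]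
  exact hnorm.trans (mul_le_mul_of_nonneg_left (functionalNorm_le hLM) hC.le)

end

/-! ### Regularity of the moments of a doubling weight -/

/-- The decay $s^n\le e^{-n(1-s)}$ beats any power, through $y^m\le m!\,e^y$. The exponents add up
to $1+(1-s)\le2$, whence $e^2$. -/
theorem exists_pow_mul_one_add_pow_le (m : ℕ) :
    ∃ K : ℝ, 0 < K ∧ ∀ n : ℕ, ∀ s ∈ Icc (0 : ℝ) 1, s ^ n * (1 + (1 - s) * (n + 1)) ^ m ≤ K := by
  refine ⟨m.factorial * Real.exp 2, by positivity, fun n s hs => ?_⟩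
  have h0 : 0 ≤ 1 - s := by linarith [hs.2]
  have h1 : s ≤ Real.exp (-(1 - s)) := by
    have := Real.add_one_le_exp (-(1 - s)); linarith
  have h2 : s ^ n ≤ Real.exp (-(n * (1 - s))) := by
    calc s ^ n ≤ Real.exp (-(1 - s)) ^ n := pow_le_pow_left₀ hs.1 h1 n
      _ = _ := by rw [← Real.exp_nat_mul]; congr 1; ring
  set y := 1 + (1 - s) * (n + 1 : ℝ)
  have hy : 0 ≤ y := by positivity
  have h3 : y ^ m ≤ m.factorial * Real.exp y := by
    have := Real.pow_div_factorial_le_exp y hy m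
    rw [div_le_iff₀ (by positivity)] at this
    linarith
  calc s ^ n * y ^ m ≤ Real.exp (-(n * (1 - s))) * (m.factorial * Real.exp y) := by
        gcongr
    _ = m.factorial * Real.exp (-(n * (1 - s)) + y) := by
        rw [Real.exp_add (-(n * (1 - s))) y]; ring
    _ ≤ m.factorial * Real.exp 2 := by
        gcongr
        simp only [y]
        nlinarith [hs.1]

/-- The radius `1 - 1 / (4n + 2)`, at which the tail controls the `n`-th moment. -/
def node (n : ℕ) : ℝ := 1 - 1 / (4 * n + 2)

theorem node_mem (n : ℕ) : node n ∈ Ioo (0 : ℝ) 1 := by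
  have : (0 : ℝ) ≤ n := n.cast_nonneg
  unfold node
  constructor
  · rw [sub_pos, div_lt_one (by positivity)]; linarith
  · have : (0 : ℝ) < 1 / (4 * n + 2) := by positivity
    linarith

section
variable {ω : ℝ → ℝ} (h : IsRadialWeight ω)
include h

/-- Bernoulli's inequality: the node is chosen so that its power $2n+1$ is at least $1/2$, which
cancels the factor 2 in `tail_le_moment`. -/
theorem IsRadialWeight.tail_node_le_moment (n : ℕ) : tail ω (node n) ≤ moment ω n := by
  have h1 := h.tail_le_moment n (Ioo_subset_Ico_self (node_mem n))
  have h2 : (1 : ℝ) ≤ 2 * node n ^ (2 * n + 1) := by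
    have : (0 : ℝ) ≤ n := n.cast_nonneg
    have h3 := one_add_mul_le_pow (a := -(1 / (4 * n + 2) : ℝ)) (by
      have : (1 : ℝ) / (4 * n + 2) ≤ 1 := by
        rw [div_le_one (by positivity)]; linarith
      linarith) (2 * n + 1)
    have h4 : (1 : ℝ) + (2 * n + 1 : ℕ) * -(1 / (4 * n + 2) : ℝ) = 1 / 2 := by
      push_cast; field_simp; ring
    rw [h4, ← sub_eq_add_neg] at h3
    change 1 / 2 ≤ node n ^ (2 * n + 1) at h3
    linarith
  have h5 := h.tail_nonneg (node_mem n).1.le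
  nlinarith

/-- Iterating the doubling inequality $j$ times covers a ratio $2^j$ of distances to the boundary at
cost $C^j\le(2^m)^j$. The summand 1 also covers the trivial case in which `s` is nearer to the
boundary. -/
theorem IsRadialWeight.exists_tail_le (hD : IsDoubling ω) :
    ∃ D : ℝ, 0 < D ∧ ∃ m : ℕ, ∀ s ∈ Ico (0 : ℝ) 1, ∀ t ∈ Ico (0 : ℝ) 1,
      tail ω s ≤ D * (1 + (1 - s) / (1 - t)) ^ m * tail ω t := by
  obtain ⟨C, hC1, hC⟩ := hD
  obtain ⟨m, hm⟩ := pow_unbounded_of_one_lt C one_lt_two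
  have key : ∀ j : ℕ, ∀ s ∈ Ico (0 : ℝ) 1, ∀ t ∈ Ico (0 : ℝ) 1, 1 - s ≤ 2 ^ j * (1 - t) →
      tail ω s ≤ C ^ j * tail ω t := by
    intro j
    induction j with
    | zero =>
      intro s hs t ht hst
      simpa using h.tail_anti ht.1 (by linarith : t ≤ s)
    | succ j ih =>
      intro s hs t ht hst
      have := ih ((1 + s) / 2) ⟨by linarith [hs.1], by linarith [hs.2]⟩ t ht (by
        rw [pow_succ] at hst; linarith)
      calc tail ω s ≤ C * tail ω ((1 + s) / 2) := hC s hs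
        _ ≤ C * (C ^ j * tail ω t) := by gcongr
        _ = _ := by ring
  refine ⟨2 ^ m, by positivity, m, fun s hs t ht => ?_⟩
  have hs1 : 0 < 1 - s := by linarith [hs.2]
  have ht1 : 0 < 1 - t := by linarith [ht.2]
  have hx : 0 < (1 - s) / (1 - t) := by positivity
  obtain ⟨n, hn1, hn2⟩ := exists_nat_pow_near (x := 1 + (1 - s) / (1 - t)) (y := 2)
    (by linarith) one_lt_two
  have h1 := key (n + 1) s hs t ht (by
    have : (1 - s) / (1 - t) ≤ 2 ^ (n + 1) := by linarith
    rwa [div_le_iff₀ ht1] at this)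
  have hT := h.tail_nonneg ht.1
  calc tail ω s ≤ C ^ (n + 1) * tail ω t := h1
    _ ≤ (2 ^ m) ^ (n + 1) * tail ω t := by gcongr
    _ = 2 ^ m * (2 ^ n) ^ m * tail ω t := by ring
    _ ≤ _ := by gcongr

theorem IsRadialWeight.exists_tail_le_node (hD : IsDoubling ω) :
    ∃ D : ℝ, 0 < D ∧ ∃ m : ℕ, ∀ s ∈ Ico (0 : ℝ) 1, ∀ n : ℕ,
      tail ω s ≤ D * (1 + (1 - s) * (n + 1)) ^ m * tail ω (node n) := by
  obtain ⟨D, hD0, m, hm⟩ := h.exists_tail_le hD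
  refine ⟨D * 4 ^ m, by positivity, m, fun s hs n => ?_⟩
  have h1 := hm s hs _ (Ioo_subset_Ico_self (node_mem n))
  have hs1 : 0 ≤ 1 - s := by linarith [hs.2]
  have hn : (0 : ℝ) ≤ n := n.cast_nonneg
  have e : (1 - s) / (1 - node n) = (1 - s) * (4 * n + 2) := by
    rw [node]; field_simp; ring
  have hT := h.tail_nonneg (node_mem n).1.le
  rw [e] at h1
  refine h1.trans ?_
  calc D * (1 + (1 - s) * (4 * n + 2)) ^ m * tail ω (node n)
      ≤ D * (4 * (1 + (1 - s) * (n + 1))) ^ m * tail ω (node n) := by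
        gcongr
        nlinarith
    _ = _ := by rw [mul_pow]; ring

/-- The tail at `s` exceeds the tail at the node by at most a power of $1+(1-s)(n+1)$, and $s^n$
absorbs that power. -/
theorem IsRadialWeight.exists_pow_mul_tail_le (hD : IsDoubling ω) :
    ∃ K : ℝ, 0 < K ∧ ∀ n : ℕ, ∀ s ∈ Ico (0 : ℝ) 1, s ^ n * tail ω s ≤ K * moment ω n := by
  obtain ⟨D, hD0, m, hm⟩ := h.exists_tail_le_node hD
  obtain ⟨K, hK0, hK⟩ := exists_pow_mul_one_add_pow_le m
  refine ⟨D * K, by positivity, fun n s hs => ?_⟩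
  have h1 := hK n s ⟨hs.1, hs.2.le⟩
  have hT := h.tail_nonneg (node_mem n).1.le
  calc s ^ n * tail ω s ≤ s ^ n * (D * (1 + (1 - s) * (n + 1)) ^ m * tail ω (node n)) :=
        mul_le_mul_of_nonneg_left (hm s hs n) (pow_nonneg hs.1 n)
    _ = D * (s ^ n * (1 + (1 - s) * (n + 1)) ^ m) * tail ω (node n) := by ring
    _ ≤ D * K * moment ω n := by
        have := h.tail_node_le_moment n
        gcongr

/-- Halving the exponent costs a constant, since `moment` carries $s^{2n+1}$. Beyond the node the
integral is at most the tail there, $\tau$. Before it, polynomial growth gives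
$s^n\lesssim\tau^2\,\widehat\omega(s)^{-2}$, and $\int\omega\,\widehat\omega^{-2}\le1/\tau$. This is
what lets one factor $s^n$ be spent later without losing the order of the moment. -/
theorem IsRadialWeight.exists_integral_pow_le (hD : IsDoubling ω) :
    ∃ K : ℝ, 0 < K ∧ ∀ n : ℕ, ∫ s in Ioo (0 : ℝ) 1, ω s * s ^ n ≤ K * moment ω n := by
  obtain ⟨D, hD0, m, hm⟩ := h.exists_tail_le_node hD
  obtain ⟨K, hK0, hK⟩ := exists_pow_mul_one_add_pow_le (m * 2)
  refine ⟨D ^ 2 * K + 1, by positivity, fun n => ?_⟩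
  set τ := tail ω (node n)
  have hn := node_mem n
  have hτ : 0 < τ := h.tail_pos _ (Ioo_subset_Ico_self hn)
  have hint : IntegrableOn (fun s => ω s * s ^ n) (Ioo 0 1) :=
    h.integrableOn_mul (by fun_prop) (C := 1) fun r hr => by
      rw [abs_of_nonneg (pow_nonneg hr.1.le _)]
      exact pow_le_one₀ hr.1.le hr.2.le
  have h1 : ∫ s in Ioo 0 (node n), ω s * s ^ n ≤ D ^ 2 * K * τ := by
    have hnn : ∀ s ∈ Ioo 0 (node n), 0 ≤ ω s := fun s hs => h.nonneg s ⟨hs.1.le, hs.2.trans hn.2⟩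
    rw [← ENNReal.ofReal_le_ofReal_iff (by positivity), ofReal_integral_eq_lintegral_ofReal
      (hint.mono_set (Ioo_subset_Ioo_right hn.2.le)) (by
        filter_upwards [ae_restrict_mem measurableSet_Ioo] with s hs
        exact mul_nonneg (hnn s hs) (pow_nonneg hs.1.le _))]
    calc ∫⁻ s in Ioo 0 (node n), ENNReal.ofReal (ω s * s ^ n)
        ≤ ∫⁻ s in Ioo 0 (node n), ENNReal.ofReal (D ^ 2 * K * τ ^ 2) *
            ENNReal.ofReal (ω s * tail ω s ^ (-1 - 1 : ℝ)) := by
          refine setLIntegral_mono' measurableSet_Ioo fun s hs => ?_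
          rw [← ENNReal.ofReal_mul (by positivity)]
          refine ENNReal.ofReal_le_ofReal ?_
          have hs' : s ∈ Ico (0 : ℝ) 1 := ⟨hs.1.le, hs.2.trans hn.2⟩
          have hT := h.tail_pos s hs'
          have e : tail ω s ^ (-1 - 1 : ℝ) = (tail ω s ^ 2)⁻¹ := by
            rw [show (-1 - 1 : ℝ) = -(2 : ℕ) by norm_num, Real.rpow_neg hT.le, Real.rpow_natCast]
          rw [e, mul_left_comm]
          refine mul_le_mul_of_nonneg_left ?_ (hnn s hs)
          rw [← div_eq_mul_inv, le_div_iff₀ (by positivity)]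
          calc s ^ n * tail ω s ^ 2
              ≤ s ^ n * (D * (1 + (1 - s) * (n + 1)) ^ m * τ) ^ 2 := by
                have := hm s hs' n
                have := pow_nonneg hs'.1 n
                gcongr
            _ = D ^ 2 * (s ^ n * (1 + (1 - s) * (n + 1)) ^ (m * 2)) * τ ^ 2 := by
                rw [pow_mul]; ring
            _ ≤ D ^ 2 * K * τ ^ 2 := by
                have := hK n s ⟨hs'.1, hs'.2.le⟩
                gcongr
      _ = ENNReal.ofReal (D ^ 2 * K * τ ^ 2) *
            ∫⁻ s in Ioo 0 (node n), ENNReal.ofReal (ω s * tail ω s ^ (-1 - 1 : ℝ)) :=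
          lintegral_const_mul' _ _ ENNReal.ofReal_ne_top
      _ ≤ ENNReal.ofReal (D ^ 2 * K * τ ^ 2) * ENNReal.ofReal (τ ^ (-1 : ℝ) / 1) := by
          gcongr
          exact h.lintegral_tail_rpow_le_left one_pos hn
      _ = ENNReal.ofReal (D ^ 2 * K * τ) := by
          rw [← ENNReal.ofReal_mul (by positivity), Real.rpow_neg_one, div_one]
          congr 1
          field_simp
  have h2 : ∫ s in Ico (node n) 1, ω s * s ^ n ≤ τ := by
    have hsub : Ico (node n) 1 ⊆ Ioo 0 1 := fun s hs => ⟨hn.1.trans_le hs.1, hs.2⟩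
    refine setIntegral_mono_on (hint.mono_set hsub) (h.integrable_Ioo.mono_set hsub)
      measurableSet_Ico fun s hs => ?_
    exact mul_le_of_le_one_right (h.nonneg s (Ioo_subset_Ico_self (hsub hs)))
      (pow_le_one₀ (hsub hs).1.le (hsub hs).2.le)
  rw [← Ioo_union_Ico_eq_Ioo hn.1 hn.2.le, setIntegral_union
    (Set.disjoint_left.2 fun s h1 h2 => absurd h1.2 (not_lt.2 h2.1)) measurableSet_Ico
    (hint.mono_set (Ioo_subset_Ioo_right hn.2.le))
    (hint.mono_set fun s hs => ⟨hn.1.trans_le hs.1, hs.2⟩)]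
  have := h.tail_node_le_moment n
  calc _ ≤ D ^ 2 * K * τ + τ := add_le_add h1 h2
    _ = (D ^ 2 * K + 1) * τ := by ring
    _ ≤ _ := by gcongr

theorem IsRadialWeight.moment_le_of_bound {F : ℝ → ℝ} (hF : Measurable F) {C : ℝ} (hC : 0 ≤ C)
    {n : ℕ} (hb : ∀ r ∈ Ioo (0 : ℝ) 1, |2 * r * F r| ≤ C * r ^ n) :
    ∫ r, F r ∂radialMeasure ω ≤ C * ∫ s in Ioo (0 : ℝ) 1, ω s * s ^ n := by
  have hpow : ∀ r ∈ Ioo (0 : ℝ) 1, r ^ n ≤ 1 := fun r hr => pow_le_one₀ hr.1.le hr.2.le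
  rw [h.integral_radialMeasure, ← integral_const_mul]
  refine setIntegral_mono_on ?_ ?_ measurableSet_Ioo fun r hr => ?_
  · refine (h.integrableOn_mul (F := fun r => 2 * r * F r) (by fun_prop) (C := C)
      fun r hr => (hb r hr).trans (mul_le_of_le_one_right hC (hpow r hr))).congr_fun
        (fun r _ => by ring) measurableSet_Ioo
  · refine Integrable.const_mul (h.integrableOn_mul (by fun_prop) (C := 1) fun r hr => ?_) C
    rw [abs_of_nonneg (pow_nonneg hr.1.le _)]
    exact hpow r hr
  · have h1 := (le_abs_self _).trans (hb r hr)
    have h2 := h.nonneg r (Ioo_subset_Ico_self hr)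
    calc 2 * r * ω r * F r = ω r * (2 * r * F r) := by ring
      _ ≤ ω r * (C * r ^ n) := by gcongr
      _ = _ := by ring

theorem IsRadialWeight.exists_moment_le_succ (hD : IsDoubling ω) :
    ∃ K : ℝ, 0 < K ∧ ∀ n : ℕ, moment ω n ≤ K * moment ω (n + 1) := by
  obtain ⟨K, hK0, hK⟩ := h.exists_integral_pow_le hD
  refine ⟨2 * K, by positivity, fun n => ?_⟩
  have h1 := h.moment_le_of_bound (F := fun r => r ^ (2 * n)) (by fun_prop) (C := 2) zero_le_two
    (n := n + 1) fun r hr => by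
      have h1 := hr.1.le
      rw [abs_of_nonneg (by positivity), mul_assoc, ← pow_succ']
      have := pow_le_pow_of_le_one h1 hr.2.le (by omega : n + 1 ≤ 2 * n + 1)
      gcongr
  calc moment ω n ≤ _ := h1
    _ ≤ 2 * (K * moment ω (n + 1)) := by gcongr; exact hK (n + 1)
    _ = _ := by ring

theorem IsRadialWeight.moment_succ_le (n : ℕ) : moment ω (n + 1) ≤ moment ω n := by
  refine integral_mono_ae (h.integrable_pow _) (h.integrable_pow _) ?_
  filter_upwards [ae_radialMeasure ω] with r hr
  exact pow_le_pow_of_le_one hr.1.le hr.2.le (by omega)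

/-- In $(n+1)(1-r)(1+r)r^{2n}$ one factor $r^n$ absorbs $(n+1)(1-r)$, and the integral of the
remaining $r^n$ is still comparable to the moment. -/
theorem IsRadialWeight.exists_moment_sub_le (hD : IsDoubling ω) :
    ∃ K : ℝ, 0 < K ∧ ∀ n : ℕ, (n + 1) * (moment ω n - moment ω (n + 1)) ≤ K * moment ω n := by
  obtain ⟨K, hK0, hK⟩ := h.exists_integral_pow_le hD
  obtain ⟨K', hK0', hK'⟩ := exists_pow_mul_one_add_pow_le 1
  refine ⟨4 * K' * K, by positivity, fun n => ?_⟩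
  rw [moment, moment, ← integral_sub (h.integrable_pow _) (h.integrable_pow _),
    ← integral_const_mul]
  have h1 := h.moment_le_of_bound
    (F := fun r : ℝ => ((n : ℝ) + 1) * (r ^ (2 * n) - r ^ (2 * (n + 1)))) (by fun_prop)
    (C := 4 * K') (by positivity) (n := n) fun r hr => by
      have h1 := hr.1.le
      have h2 := hr.2.le
      have h3 := hK' n r ⟨h1, h2⟩
      rw [pow_one] at h3
      have h4 : 0 ≤ 1 - r := by linarith
      have h5 : 0 ≤ r ^ n := by positivity
      have h6 : 2 * r * ((n + 1 : ℝ) * (r ^ (2 * n) - r ^ (2 * (n + 1)))) =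
          (2 * (r * (1 + r))) * (r ^ n * ((1 - r) * (n + 1))) * r ^ n := by ring
      rw [h6, abs_of_nonneg (by positivity)]
      have h7 : r * (1 + r) ≤ 2 := by nlinarith
      have h8 : r ^ n * ((1 - r) * (n + 1)) ≤ K' := by nlinarith
      calc (2 * (r * (1 + r))) * (r ^ n * ((1 - r) * (n + 1))) * r ^ n
          ≤ (2 * 2) * K' * r ^ n := by gcongr
        _ = _ := by ring
  calc _ ≤ _ := h1
    _ ≤ 4 * K' * (K * moment ω n) := by gcongr; exact hK n
    _ = _ := by rw [moment]; ring

end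

/-! ### Integral means of the derivatives of the kernel -/

/-- The coefficients of `(1 - z) * powerSum c z`. -/
def diffCoeff (c : ℕ → ℂ) : ℕ → ℂ
  | 0 => c 0
  | n + 1 => c (n + 1) - c n

theorem hasUnitRadius_one : HasUnitRadius fun _ => 1 := fun x hx => by
  simpa using summable_geometric_of_lt_one hx.1 hx.2

theorem powerSum_one {z : ℂ} (hz : ‖z‖ < 1) : powerSum (fun _ => 1) z = (1 - z)⁻¹ := by
  simp only [powerSum, one_mul]
  exact tsum_geometric_of_norm_lt_one hz

theorem HasUnitRadius.diffCoeff {c : ℕ → ℂ} (hc : HasUnitRadius c) :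
    HasUnitRadius (diffCoeff c) := by
  intro x hx
  rw [← summable_nat_add_iff 1]
  refine Summable.of_nonneg_of_le (fun n => mul_nonneg (norm_nonneg _) (pow_nonneg hx.1 _))
    (fun n => ?_) (((summable_nat_add_iff 1).2 (hc x hx)).add (hc x hx))
  have h1 : ‖RadialBergman.diffCoeff c (n + 1)‖ ≤ ‖c (n + 1)‖ + ‖c n‖ := norm_sub_le _ _
  have h2 : x ^ (n + 1) ≤ x ^ n := pow_le_pow_of_le_one hx.1 hx.2.le (by omega)
  have h3 : 0 ≤ x ^ (n + 1) := pow_nonneg hx.1 _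
  calc _ ≤ (‖c (n + 1)‖ + ‖c n‖) * x ^ (n + 1) := by gcongr
    _ = ‖c (n + 1)‖ * x ^ (n + 1) + ‖c n‖ * x ^ (n + 1) := by ring
    _ ≤ _ := by gcongr

theorem HasUnitRadius.powerSum_diffCoeff {c : ℕ → ℂ} (hc : HasUnitRadius c) {z : ℂ}
    (hz : ‖z‖ < 1) : powerSum (RadialBergman.diffCoeff c) z = (1 - z) * powerSum c z := by
  have h1 := (hasSum_nat_add_iff' 1).2 (hc.hasSum hz)
  have h2 := h1.sub ((hc.hasSum hz).mul_left z)
  have h3 := (hasSum_nat_add_iff' 1).2 (hc.diffCoeff.hasSum hz)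
  have e : (fun n => c (n + 1) * z ^ (n + 1) - z * (c n * z ^ n)) =
      fun n => RadialBergman.diffCoeff c (n + 1) * z ^ (n + 1) := by
    ext n
    simp only [RadialBergman.diffCoeff]
    ring
  rw [e] at h2
  have h4 := h2.unique h3
  simp only [Finset.range_one, Finset.sum_singleton, pow_zero, mul_one,
    RadialBergman.diffCoeff] at h4
  linear_combination -h4

/-- The `L¹` mean of a power series is controlled by the coefficients of its product with
`1 - z`. -/
theorem HasUnitRadius.integral_norm_le {c : ℕ → ℂ} (hc : HasUnitRadius c) {w : ℂ} (hw : ‖w‖ < 1)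
    {A B : ℝ} (hB : 0 < B)
    (hA : ∑' n, ‖RadialBergman.diffCoeff c n‖ ^ 2 * ‖w‖ ^ (2 * n) ≤ A) :
    ∫ θ, ‖powerSum c (w * unitExp θ)‖ ∂arcMeasure ≤ (B * A + (B * (1 - ‖w‖))⁻¹) / 2 := by
  have hone : (0 : ℝ) < 1 - ‖w‖ := by linarith
  have hd := hc.diffCoeff
  have h1 := hd.hasSum_norm_sq hw
  have h2 := hasUnitRadius_one.hasSum_norm_sq hw
  have c1 := hd.continuous_circle hw
  have c2 := hasUnitRadius_one.continuous_circle hw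
  have hint : ∀ {f : ℝ → ℝ}, Continuous f → Integrable f arcMeasure := by
    intro f hf
    refine Integrable.smul_measure (μ := volume.restrict _) ?_ ENNReal.ofReal_ne_top
    exact (hf.integrableOn_Icc (a := -Real.pi) (b := Real.pi)).mono_set Ioo_subset_Icc_self
  have i1 : Integrable (fun θ => ‖powerSum (RadialBergman.diffCoeff c) (w * unitExp θ)‖ ^ 2)
      arcMeasure := hint (c1.norm.pow 2)
  have i2 : Integrable (fun θ => ‖powerSum (fun _ => 1) (w * unitExp θ)‖ ^ 2) arcMeasure :=
    hint (c2.norm.pow 2)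
  rw [h1.tsum_eq] at hA
  have h3 : ∫ θ, ‖powerSum (fun _ => 1) (w * unitExp θ)‖ ^ 2 ∂arcMeasure ≤ (1 - ‖w‖)⁻¹ := by
    rw [← h2.tsum_eq, ← tsum_geometric_of_lt_one (norm_nonneg w) hw]
    refine h2.summable.tsum_le_tsum (fun n => ?_) (summable_geometric_of_lt_one (norm_nonneg w) hw)
    simp only [norm_one, one_pow, one_mul]
    exact pow_le_pow_of_le_one (norm_nonneg _) hw.le (by omega)
  -- Write $|F|=|(1-x)F|\cdot|1-x|^{-1}$ on $|x|=|w|$ and use $XY\le BX^2/2+Y^2/(2B)$. The free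
  -- parameter `B` is later chosen to balance the terms; the mean of $|1-x|^{-2}$ contributes
  -- $(1-|w|)^{-1}$.
  calc ∫ θ, ‖powerSum c (w * unitExp θ)‖ ∂arcMeasure
      ≤ ∫ θ, (B / 2 * ‖powerSum (RadialBergman.diffCoeff c) (w * unitExp θ)‖ ^ 2 +
          (2 * B)⁻¹ * ‖powerSum (fun _ => 1) (w * unitExp θ)‖ ^ 2) ∂arcMeasure := by
        refine integral_mono (hint (hc.continuous_circle hw).norm)
          ((i1.const_mul _).add (i2.const_mul _)) fun θ => ?_
        have hwθ : ‖w * unitExp θ‖ < 1 := by rwa [norm_mul_unitExp]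
        have hne : (1 : ℂ) - w * unitExp θ ≠ 0 := by
          intro h0
          rw [sub_eq_zero] at h0
          rw [← h0, norm_one] at hwθ
          exact lt_irrefl _ hwθ
        have e : ‖powerSum c (w * unitExp θ)‖ =
            ‖powerSum (RadialBergman.diffCoeff c) (w * unitExp θ)‖ *
              ‖powerSum (fun _ => 1) (w * unitExp θ)‖ := by
          rw [hc.powerSum_diffCoeff hwθ, powerSum_one hwθ, ← norm_mul]
          congr 1
          field_simp
        simp only
        rw [e]
        set X := ‖powerSum (RadialBergman.diffCoeff c) (w * unitExp θ)‖
        set Y := ‖powerSum (fun _ => 1) (w * unitExp θ)‖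
        have h5 : B / 2 * X ^ 2 + (2 * B)⁻¹ * Y ^ 2 - X * Y = (B * X - Y) ^ 2 / (2 * B) := by
          field_simp; ring
        have h6 : 0 ≤ (B * X - Y) ^ 2 / (2 * B) := by positivity
        linarith
    _ = B / 2 * (∫ θ, ‖powerSum (RadialBergman.diffCoeff c) (w * unitExp θ)‖ ^ 2 ∂arcMeasure) +
          (2 * B)⁻¹ * ∫ θ, ‖powerSum (fun _ => 1) (w * unitExp θ)‖ ^ 2 ∂arcMeasure := by
        rw [integral_add (i1.const_mul _) (i2.const_mul _), integral_const_mul, integral_const_mul]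
    _ ≤ B / 2 * A + (2 * B)⁻¹ * (1 - ‖w‖)⁻¹ := by gcongr
    _ = _ := by field_simp

/-- The coefficients of the `k`-th derivative of the kernel. -/
def kernelCoeff (ω : ℝ → ℝ) (k : ℕ) : ℕ → ℂ := derivCoeff^[k] (invMoment ω)

section
variable {ω : ℝ → ℝ} (h : IsRadialWeight ω)
include h

theorem IsRadialWeight.hasUnitRadius_kernelCoeff (k : ℕ) : HasUnitRadius (kernelCoeff ω k) :=
  h.hasUnitRadius_invMoment.iterate_derivCoeff k

/-- The coefficient is $P(n)/W_{n+k}$ with $P$ a product of $k$ consecutive integers. By the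
discrete product rule the difference falls on $P$ or on $1/W$, and each gains a factor $1/(n+1)$;
hence order $l=k-1$ instead of $k$. -/
theorem IsRadialWeight.exists_diffCoeff_le (hD : IsDoubling ω) (l : ℕ) :
    ∃ K : ℝ, 0 < K ∧ ∀ n : ℕ, ‖diffCoeff (kernelCoeff ω (l + 1)) n‖ ≤
      K * (n + 1) ^ l * (moment ω n)⁻¹ := by
  obtain ⟨K₁, hK₁, h₁⟩ := h.exists_moment_le_succ hD
  obtain ⟨K₂, hK₂, h₂⟩ := h.exists_moment_sub_le hD
  set β : ℕ → ℝ := fun n => (moment ω n)⁻¹ with hβ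
  have hβ0 : ∀ n, 0 < β n := fun n => inv_pos.2 (h.moment_pos n)
  have hβs : ∀ n, β (n + 1) ≤ K₁ * β n := fun n => by
    have a := h.moment_pos n
    have b := h.moment_pos (n + 1)
    simp only [hβ]
    rw [← div_eq_mul_inv, le_div_iff₀ a, inv_mul_le_iff₀ b, mul_comm]
    exact h₁ n
  have hβi : ∀ i n, β (n + i) ≤ K₁ ^ i * β n := by
    intro i n
    induction i with
    | zero => simp
    | succ i ih =>
      calc β (n + (i + 1)) ≤ K₁ * β (n + i) := hβs (n + i)
        _ ≤ K₁ * (K₁ ^ i * β n) := by gcongr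
        _ = _ := by ring
  have hβm : ∀ n, β n ≤ β (n + 1) := fun n => by
    have b := h.moment_pos (n + 1)
    exact inv_anti₀ b (h.moment_succ_le n)
  have hβd : ∀ n : ℕ, (n + 1) * (β (n + 1) - β n) ≤ K₂ * β (n + 1) := fun n => by
    have a := h.moment_pos n
    have b := h.moment_pos (n + 1)
    have e : (n + 1) * (β (n + 1) - β n) =
        ((n + 1) * (moment ω n - moment ω (n + 1))) * (β n * β (n + 1)) := by
      simp only [hβ]; field_simp
    rw [e]
    calc _ ≤ (K₂ * moment ω n) * (β n * β (n + 1)) :=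
          mul_le_mul_of_nonneg_right (h₂ n) (mul_pos (hβ0 n) (hβ0 _)).le
      _ = _ := by simp only [hβ]; field_simp
  set k := l + 1 with hk
  set P : ℕ → ℝ := fun n => ((n + k).descFactorial k : ℝ) with hP
  have hP0 : ∀ n, 0 ≤ P n := fun n => Nat.cast_nonneg _
  have hPle : ∀ n : ℕ, P n ≤ (k + 1) ^ k * (n + 1) ^ k := fun n => by
    have h1 : P n ≤ ((n + k : ℕ) : ℝ) ^ k := by
      simp only [hP]; exact_mod_cast Nat.descFactorial_le_pow _ _
    refine h1.trans ?_
    rw [← mul_pow]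
    gcongr
    push_cast
    have : (0 : ℝ) ≤ n := n.cast_nonneg
    have : (0 : ℝ) ≤ k := k.cast_nonneg
    nlinarith
  have hPd : ∀ n : ℕ, (n + 1) * (P (n + 1) - P n) = k * P n := fun n => by
    have h1 : (n + 1) * (n + 1 + k).descFactorial k = (n + 1 + k) * (n + k).descFactorial k := by
      have e1 := Nat.descFactorial_succ (n + 1 + k) k
      have e2 := Nat.succ_descFactorial_succ (n + k) k
      rw [show n + 1 + k - k = n + 1 by omega] at e1
      rw [← e1, show n + 1 + k = n + k + 1 by ring, e2]
    have h2 : ((n : ℝ) + 1) * P (n + 1) = (n + 1 + k) * P n := by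
      simp only [hP]; exact_mod_cast h1
    rw [mul_sub, h2]; ring
  have ha : ∀ n, kernelCoeff ω k n = ((P n * β (n + k) : ℝ) : ℂ) := fun n => by
    rw [kernelCoeff, iterate_derivCoeff_apply, invMoment]
    simp only [hP, hβ]
    push_cast
    rfl
  have hstep : ∀ n : ℕ, ‖diffCoeff (kernelCoeff ω k) (n + 1)‖ ≤
      ((k + 1) ^ k * (k + K₂) * K₁ ^ k) * ((n + 1 : ℕ) + 1) ^ l * β (n + 1) := fun n => by
    have hn : (0 : ℝ) < n + 1 := by positivity
    have hk0 : (0 : ℝ) ≤ k := k.cast_nonneg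
    simp only [diffCoeff, ha]
    rw [← Complex.ofReal_sub, Complex.norm_real]
    have e1 : P (n + 1) * β (n + 1 + k) - P n * β (n + k) =
        (P (n + 1) - P n) * β (n + k + 1) + P n * (β (n + k + 1) - β (n + k)) := by
      rw [show n + 1 + k = n + k + 1 by ring]; ring
    have e2 : P (n + 1) - P n = k * P n / (n + 1) := by
      rw [eq_div_iff hn.ne', mul_comm, hPd]
    have e3 : β (n + k + 1) - β (n + k) ≤ K₂ * β (n + k + 1) / (n + 1) := by
      rw [le_div_iff₀ hn, mul_comm]
      refine le_trans ?_ (hβd (n + k))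
      have := hβm (n + k)
      rw [Nat.cast_add]
      refine mul_le_mul_of_nonneg_right ?_ (by linarith)
      linarith
    have e4 := hβm (n + k)
    rw [e1, e2]
    have hPn := hP0 n
    have hb := (hβ0 (n + k + 1)).le
    rw [Real.norm_of_nonneg (add_nonneg (by positivity) (mul_nonneg hPn (by linarith)))]
    calc k * P n / (n + 1) * β (n + k + 1) + P n * (β (n + k + 1) - β (n + k))
        ≤ k * P n / (n + 1) * β (n + k + 1) + P n * (K₂ * β (n + k + 1) / (n + 1)) := by gcongr
      _ = P n * (k + K₂) / (n + 1) * β (n + k + 1) := by ring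
      _ ≤ ((k + 1) ^ k * (n + 1) ^ k) * (k + K₂) / (n + 1) * β (n + k + 1) := by
          gcongr; exact hPle n
      _ = ((k + 1) ^ k * (k + K₂)) * (n + 1) ^ l * β (n + k + 1) := by
          rw [hk, pow_succ (n + 1 : ℝ)]; field_simp
      _ ≤ ((k + 1) ^ k * (k + K₂)) * ((n + 1 : ℕ) + 1) ^ l * (K₁ ^ k * β (n + 1)) := by
          gcongr
          · linarith
          · rw [show n + k + 1 = n + 1 + k by ring]; exact hβi k (n + 1)
      _ = _ := by ring
  refine ⟨(k + 1) ^ k * (k + K₂) * K₁ ^ k + k.factorial * K₁ ^ k, by positivity, fun n => ?_⟩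
  cases n with
  | zero =>
    simp only [diffCoeff, ha]
    rw [Complex.norm_real, Real.norm_of_nonneg (mul_nonneg (hP0 0) (hβ0 _).le)]
    have e : P 0 = k.factorial := by simp [hP, Nat.descFactorial_self]
    have := hβi k 0
    rw [e]
    have h3 : 0 ≤ ((k : ℝ) + 1) ^ k * (k + K₂) * K₁ ^ k * β 0 := by
      have := (hβ0 0).le; positivity
    calc (k.factorial : ℝ) * β (0 + k) ≤ k.factorial * (K₁ ^ k * β 0) := by gcongr
      _ ≤ _ := by simp only [Nat.cast_zero, zero_add, one_pow, mul_one]; linarith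
  | succ n =>
    refine (hstep n).trans ?_
    have := (hβ0 (n + 1)).le
    have h3 : (0 : ℝ) ≤ k.factorial * K₁ ^ k := by positivity
    gcongr
    linarith

/-- Integral means of the derivatives of the kernel of a doubling weight. -/
theorem IsRadialWeight.exists_integral_norm_kernel_le (hD : IsDoubling ω) (l : ℕ) :
    ∃ K : ℝ, 0 < K ∧ ∀ w : ℂ, ‖w‖ < 1 →
      ∫ θ, ‖powerSum (kernelCoeff ω (l + 1)) (w * unitExp θ)‖ ∂arcMeasure ≤
        K / (tail ω ‖w‖ * (1 - ‖w‖) ^ (l + 1)) := by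
  obtain ⟨K₁, hK₁, h₁⟩ := h.exists_diffCoeff_le hD l
  obtain ⟨K₂, hK₂, h₂⟩ := h.exists_pow_mul_tail_le hD
  obtain ⟨K₃, hK₃, h₃⟩ := exists_pow_mul_one_add_pow_le (2 * l)
  obtain ⟨C, hC1, hC⟩ := hD
  set K := K₁ ^ 2 * K₂ ^ 2 * K₃ * C ^ 2 * 2 ^ (2 * l + 1)
  refine ⟨(K + 1) / 2, by positivity, fun w hw => ?_⟩
  set r := ‖w‖ with hr
  have hr0 : 0 ≤ r := norm_nonneg _
  have hr1 : 0 < 1 - r := by linarith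
  set T := tail ω r
  have hT : 0 < T := h.tail_pos r ⟨hr0, hw⟩
  -- Since $r^{2n}=x^{4n}$, there are four factors $x^n$: two absorb $W_n^{-2}$, one absorbs the
  -- polynomial, and the last sums to a geometric series. Both $1-x$ and, by doubling,
  -- $\widehat\omega(x)$ are bounded below by constant multiples of their values at $r$.
  set x := Real.sqrt r
  have hx0 : 0 ≤ x := Real.sqrt_nonneg _
  have hxr : x ^ 2 = r := Real.sq_sqrt hr0
  have hx1 : x < 1 := by nlinarith
  have hxle : x ≤ (1 + r) / 2 := by nlinarith [sq_nonneg (x - 1)]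
  have hTx0 : 0 < tail ω x := h.tail_pos x ⟨hx0, hx1⟩
  have hTx : T ≤ C * tail ω x := (hC r ⟨hr0, hw⟩).trans (by
    have := h.tail_anti hx0 hxle
    gcongr)
  have h1x : 0 < 1 - x := by linarith
  have h1x' : 1 - r ≤ 2 * (1 - x) := by linarith
  have hterm : ∀ n : ℕ, ‖diffCoeff (kernelCoeff ω (l + 1)) n‖ ^ 2 * r ^ (2 * n) ≤
      (K₁ ^ 2 * K₂ ^ 2 * K₃ / (tail ω x ^ 2 * (1 - x) ^ (2 * l))) * x ^ n := fun n => by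
    have hW := h.moment_pos n
    have hxn : 0 ≤ x ^ n := pow_nonneg hx0 n
    have a1 : (moment ω n)⁻¹ * x ^ n ≤ K₂ / tail ω x := by
      rw [inv_mul_le_iff₀ hW, mul_div_assoc', le_div_iff₀ hTx0, mul_comm (moment ω n)]
      exact h₂ n x ⟨hx0, hx1⟩
    have a2 : ((n : ℝ) + 1) ^ (2 * l) * x ^ n ≤ K₃ / (1 - x) ^ (2 * l) := by
      rw [le_div_iff₀ (by positivity)]
      calc ((n : ℝ) + 1) ^ (2 * l) * x ^ n * (1 - x) ^ (2 * l)
          = x ^ n * ((1 - x) * (n + 1)) ^ (2 * l) := by rw [mul_pow]; ring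
        _ ≤ x ^ n * (1 + (1 - x) * (n + 1)) ^ (2 * l) := by gcongr; linarith
        _ ≤ K₃ := h₃ n x ⟨hx0, hx1.le⟩
    calc ‖diffCoeff (kernelCoeff ω (l + 1)) n‖ ^ 2 * r ^ (2 * n)
        ≤ (K₁ * (n + 1) ^ l * (moment ω n)⁻¹) ^ 2 * r ^ (2 * n) := by gcongr; exact h₁ n
      _ = K₁ ^ 2 * ((moment ω n)⁻¹ * x ^ n) ^ 2 * (((n : ℝ) + 1) ^ (2 * l) * x ^ n) * x ^ n := by
          rw [← hxr]; ring
      _ ≤ K₁ ^ 2 * (K₂ / tail ω x) ^ 2 * (K₃ / (1 - x) ^ (2 * l)) * x ^ n := by gcongr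
      _ = _ := by field_simp
  have hsum : ∑' n, ‖diffCoeff (kernelCoeff ω (l + 1)) n‖ ^ 2 * r ^ (2 * n) ≤
      K / (T ^ 2 * (1 - r) ^ (2 * l + 1)) := by
    have hs := (h.hasUnitRadius_kernelCoeff (l + 1)).diffCoeff.hasSum_norm_sq hw
    have hg := (summable_geometric_of_lt_one hx0 hx1).mul_left
      (K₁ ^ 2 * K₂ ^ 2 * K₃ / (tail ω x ^ 2 * (1 - x) ^ (2 * l)))
    refine (hs.summable.tsum_le_tsum hterm hg).trans ?_
    rw [tsum_mul_left, tsum_geometric_of_lt_one hx0 hx1, ← div_eq_mul_inv, div_div,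
      mul_assoc (tail ω x ^ 2), ← pow_succ, div_le_div_iff₀ (by positivity) (by positivity)]
    calc K₁ ^ 2 * K₂ ^ 2 * K₃ * (T ^ 2 * (1 - r) ^ (2 * l + 1))
        ≤ K₁ ^ 2 * K₂ ^ 2 * K₃ * ((C * tail ω x) ^ 2 * (2 * (1 - x)) ^ (2 * l + 1)) := by
          gcongr
      _ = _ := by simp only [K]; rw [mul_pow, mul_pow]; ring
  -- This `B` makes both terms multiples of $1/(T(1-r)^{l+1})$, with factors $K$ and 1; hence the
  -- constant $(K+1)/2$.
  have := (h.hasUnitRadius_kernelCoeff (l + 1)).integral_norm_le hw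
    (B := T * (1 - r) ^ l) (by positivity) hsum
  refine this.trans (le_of_eq ?_)
  rw [← hr]
  field_simp
  ring

end

/-! ### Schur's test with powers of the tail -/

/-- Schur's test. -/
theorem lintegral_rpow_le_of_schur {α : Type*} [MeasurableSpace α] {μ : Measure α} [SFinite μ]
    {K : α → α → ℝ≥0∞} (hK : Measurable (Function.uncurry K)) {p q : ℝ}
    (hpq : p.HolderConjugate q) {H : α → ℝ≥0∞} (hH : Measurable H)
    (hH0 : ∀ᵐ x ∂μ, H x ≠ 0 ∧ H x ≠ ⊤) {A B : ℝ≥0∞}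
    (hA : ∀ᵐ x ∂μ, ∫⁻ y, K x y * H y ^ q ∂μ ≤ A * H x ^ q)
    (hB : ∀ᵐ y ∂μ, ∫⁻ x, K x y * H x ^ p ∂μ ≤ B * H y ^ p)
    {F : α → ℝ≥0∞} (hF : Measurable F) :
    ∫⁻ x, (∫⁻ y, K x y * F y ∂μ) ^ p ∂μ ≤ A ^ (p / q) * B * ∫⁻ x, F x ^ p ∂μ := by
  have hp := hpq.pos
  have hq := hpq.symm.pos
  have hKx : ∀ x, Measurable (K x) := fun x => hK.of_uncurry_left
  have step : ∀ᵐ x ∂μ, (∫⁻ y, K x y * F y ∂μ) ^ p ≤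
      A ^ (p / q) * (H x ^ p * ∫⁻ y, K x y * (F y ^ p * (H y ^ p)⁻¹) ∂μ) := by
    filter_upwards [hA] with x hx
    -- Hölder is applied to $K F=(K^{1/q}H)(K^{1/p}F/H)$, legitimate since $H$ is a.e. neither 0 nor
    -- infinite.
    have e : ∫⁻ y, K x y * F y ∂μ =
        ∫⁻ y, ((fun y => K x y ^ (1 / q) * H y) * fun y => K x y ^ (1 / p) * (F y * (H y)⁻¹)) y
          ∂μ := by
      refine lintegral_congr_ae ?_
      filter_upwards [hH0] with y hy
      have h1 : K x y ^ (1 / q) * K x y ^ (1 / p) = K x y := by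
        rw [← ENNReal.rpow_add_of_nonneg _ _ (by positivity) (by positivity),
          one_div, one_div, add_comm, hpq.inv_add_inv_eq_one, ENNReal.rpow_one]
      have h2 : H y * (H y)⁻¹ = 1 := ENNReal.mul_inv_cancel hy.1 hy.2
      calc K x y * F y = (K x y ^ (1 / q) * K x y ^ (1 / p)) * F y * (H y * (H y)⁻¹) := by
            rw [h1, h2, mul_one]
        _ = _ := by simp only [Pi.mul_apply]; ring
    rw [e]
    have holder := ENNReal.lintegral_mul_le_Lp_mul_Lq μ hpq.symm
      (f := fun y => K x y ^ (1 / q) * H y) (g := fun y => K x y ^ (1 / p) * (F y * (H y)⁻¹))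
      (((hKx x).pow_const _).mul hH).aemeasurable
      (((hKx x).pow_const _).mul (hF.mul hH.inv)).aemeasurable
    have e1 : ∀ y, (K x y ^ (1 / q) * H y) ^ q = K x y * H y ^ q := fun y => by
      rw [ENNReal.mul_rpow_of_nonneg _ _ hq.le, ← ENNReal.rpow_mul, one_div_mul_cancel hq.ne',
        ENNReal.rpow_one]
    have e2 : ∀ y, (K x y ^ (1 / p) * (F y * (H y)⁻¹)) ^ p = K x y * (F y ^ p * (H y ^ p)⁻¹) :=
      fun y => by
        rw [ENNReal.mul_rpow_of_nonneg _ _ hp.le, ← ENNReal.rpow_mul, one_div_mul_cancel hp.ne',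
          ENNReal.rpow_one, ENNReal.mul_rpow_of_nonneg _ _ hp.le, ENNReal.inv_rpow]
    simp_rw [e1, e2] at holder
    calc _ ≤ ((∫⁻ y, K x y * H y ^ q ∂μ) ^ (1 / q) *
          (∫⁻ y, K x y * (F y ^ p * (H y ^ p)⁻¹) ∂μ) ^ (1 / p)) ^ p := by gcongr
      _ ≤ ((A * H x ^ q) ^ (1 / q) *
          (∫⁻ y, K x y * (F y ^ p * (H y ^ p)⁻¹) ∂μ) ^ (1 / p)) ^ p := by gcongr
      _ = _ := by
        rw [ENNReal.mul_rpow_of_nonneg _ _ hp.le, ← ENNReal.rpow_mul, ← ENNReal.rpow_mul,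
          one_div_mul_cancel hp.ne', ENNReal.rpow_one, ENNReal.mul_rpow_of_nonneg _ _
          (by positivity), ← ENNReal.rpow_mul]
        rw [show 1 / q * p = p / q by ring, show q * (p / q) = p by field_simp]
        ring
  have hm : Measurable fun z : α × α => H z.1 ^ p *
      (K z.1 z.2 * (F z.2 ^ p * (H z.2 ^ p)⁻¹)) := by
    have := (hF.pow_const p).mul (hH.pow_const p).inv
    exact ((hH.pow_const p).comp measurable_fst).mul (hK.mul (this.comp measurable_snd))
  calc ∫⁻ x, (∫⁻ y, K x y * F y ∂μ) ^ p ∂μ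
      ≤ ∫⁻ x, A ^ (p / q) * ∫⁻ y, H x ^ p * (K x y * (F y ^ p * (H y ^ p)⁻¹)) ∂μ ∂μ := by
        refine lintegral_mono_ae ?_
        filter_upwards [step] with x hx
        refine hx.trans (le_of_eq ?_)
        rw [lintegral_const_mul]
        exact (hKx x).mul ((hF.pow_const p).mul (hH.pow_const p).inv)
    _ = A ^ (p / q) * ∫⁻ x, ∫⁻ y, H x ^ p * (K x y * (F y ^ p * (H y ^ p)⁻¹)) ∂μ ∂μ := by
        rw [lintegral_const_mul]
        exact hm.lintegral_prod_right'
    _ = A ^ (p / q) * ∫⁻ y, ∫⁻ x, H x ^ p * (K x y * (F y ^ p * (H y ^ p)⁻¹)) ∂μ ∂μ := by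
        rw [lintegral_lintegral_swap hm.aemeasurable]
    _ ≤ A ^ (p / q) * ∫⁻ y, B * F y ^ p ∂μ := by
        gcongr 1
        refine lintegral_mono_ae ?_
        filter_upwards [hB, hH0] with y hy hy0
        have e3 : ∀ x, H x ^ p * (K x y * (F y ^ p * (H y ^ p)⁻¹)) =
            (F y ^ p * (H y ^ p)⁻¹) * (K x y * H x ^ p) := fun x => by ring
        simp_rw [e3]
        have hm2 : Measurable fun x => K x y * H x ^ p :=
          hK.of_uncurry_right.mul (hH.pow_const p)
        rw [lintegral_const_mul _ hm2]
        have h3 : (H y ^ p)⁻¹ * H y ^ p = 1 := by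
          refine ENNReal.inv_mul_cancel ?_ (ENNReal.rpow_ne_top_of_nonneg hp.le hy0.2)
          simp [ENNReal.rpow_eq_zero_iff, hy0.1, hp.le]
        calc _ ≤ (F y ^ p * (H y ^ p)⁻¹) * (B * H y ^ p) := by gcongr
          _ = B * F y ^ p * ((H y ^ p)⁻¹ * H y ^ p) := by ring
          _ = B * F y ^ p := by rw [h3, mul_one]
    _ = _ := by
        rw [lintegral_const_mul _ (hF.pow_const p), mul_assoc]

theorem areaMeasure_absolutelyContinuous (ω : ℝ → ℝ) : areaMeasure ω ≪ volume :=
  (Measure.smul_absolutelyContinuous.trans (withDensity_absolutelyContinuous _ _)).trans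
    Measure.absolutelyContinuous_restrict

theorem ae_norm_mem_Ioo (ω : ℝ → ℝ) : ∀ᵐ z ∂areaMeasure ω, ‖z‖ ∈ Ioo (0 : ℝ) 1 := by
  have h0 : ∀ᵐ z ∂areaMeasure ω, z ≠ 0 :=
    (areaMeasure_absolutelyContinuous ω).ae_le (Measure.ae_ne volume 0)
  filter_upwards [h0, ae_areaMeasure ω] with z hz hz1
  exact ⟨norm_pos_iff.2 hz, mem_ball_zero_iff.1 hz1⟩

/-- The weight `tail ω ‖z‖ ^ (-a)`, used in Schur's test. -/
def tailPow (ω : ℝ → ℝ) (a : ℝ) (z : ℂ) : ℝ≥0∞ := ENNReal.ofReal (tail ω ‖z‖ ^ (-a))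

section
variable {ω : ℝ → ℝ} (h : IsRadialWeight ω)
include h

theorem IsRadialWeight.measurable_tail_norm : Measurable fun z : ℂ => tail ω ‖z‖ := by
  -- Monotonicity of the tail is available only for nonnegative radii, so the argument is truncated;
  -- norms are unaffected.
  have h1 : Antitone fun r => tail ω (max r 0) := fun a b hab =>
    h.tail_anti (le_max_right _ _) (max_le_max_right 0 hab)
  have h2 := h1.measurable.comp (measurable_norm (α := ℂ))
  convert h2 using 2 with z
  simp

theorem IsRadialWeight.measurable_tailPow (a : ℝ) : Measurable (tailPow ω a) :=
  (h.measurable_tail_norm.pow_const _).ennreal_ofReal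

theorem IsRadialWeight.tailPow_pow {a b c : ℝ} (habc : a * b = c) {z : ℂ} (hz : ‖z‖ < 1)
    (hb : 0 ≤ b) : tailPow ω a z ^ b = tailPow ω c z := by
  have hT := h.tail_pos ‖z‖ ⟨norm_nonneg _, hz⟩
  rw [tailPow, tailPow, ENNReal.ofReal_rpow_of_nonneg (by positivity) hb, ← Real.rpow_mul hT.le,
    neg_mul, habc]

/-- In polar coordinates the integral splits at $|z|$. Inside, the integrand is
$\omega\,\widehat\omega^{-a-1}$; outside, it is $\omega\,\widehat\omega^{-a}$ times the constant
$1/\widehat\omega(|z|)$. Both integrate to multiples of $\widehat\omega(|z|)^{-a}$, the first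
needing $a>0$ and the second $a<1$. -/
theorem IsRadialWeight.exists_lintegral_mul_tailPow_le {a : ℝ} (ha : a ∈ Ioo (0 : ℝ) 1) {C : ℝ}
    (hC : 0 ≤ C) {K : ℂ → ℂ → ℝ≥0∞} (hK : Measurable (Function.uncurry K))
    (hKC : ∀ z ∈ ball (0 : ℂ) 1, ∀ t ∈ Ioo (0 : ℝ) 1,
      ∫⁻ θ, K z (polarMap (t, θ)) ∂arcMeasure ≤ ENNReal.ofReal (C / tail ω (min ‖z‖ t))) :
    ∀ᵐ z ∂areaMeasure ω, ∫⁻ ζ, K z ζ * tailPow ω a ζ ∂areaMeasure ω ≤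
      ENNReal.ofReal (2 * C * (1 / a + 1 / (1 - a))) * tailPow ω a z := by
  filter_upwards [ae_norm_mem_Ioo ω] with z hz
  have hKz : Measurable (K z) := hK.of_uncurry_left
  set s := ‖z‖
  have ha0 := ha.1
  have ha1 : 0 < 1 - a := by linarith [ha.2]
  have hTs : 0 < tail ω s := h.tail_pos s (Ioo_subset_Ico_self hz)
  have hm : Measurable fun ζ => K z ζ * tailPow ω a ζ := hKz.mul (h.measurable_tailPow a)
  have hm2 : Measurable fun r : ℝ =>
      ∫⁻ θ, K z (polarMap (r, θ)) * tailPow ω a (polarMap (r, θ)) ∂arcMeasure :=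
    (hm.comp measurable_polarMap).lintegral_prod_right'
  rw [h.lintegral_areaMeasure hm, h.lintegral_radialMeasure hm2]
  have hpt : ∀ t ∈ Ioo (0 : ℝ) 1, ENNReal.ofReal (2 * t * ω t) *
      ∫⁻ θ, K z (polarMap (t, θ)) * tailPow ω a (polarMap (t, θ)) ∂arcMeasure ≤
      ENNReal.ofReal (2 * C) * ENNReal.ofReal (ω t * (tail ω t ^ (-a) / tail ω (min s t))) := by
    intro t ht
    have hT := h.tail_pos t (Ioo_subset_Ico_self ht)
    have hTm : 0 < tail ω (min s t) :=
      h.tail_pos _ ⟨le_min hz.1.le ht.1.le, (min_le_right _ _).trans_lt ht.2⟩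
    have hω := h.nonneg t (Ioo_subset_Ico_self ht)
    have e : ∀ θ, tailPow ω a (polarMap (t, θ)) = ENNReal.ofReal (tail ω t ^ (-a)) := fun θ => by
      rw [tailPow, norm_polarMap, abs_of_pos ht.1]
    simp_rw [e]
    have ht0 := ht.1.le
    have hmθ : Measurable fun θ => K z (polarMap (t, θ)) :=
      hKz.comp (measurable_polarMap.comp measurable_prodMk_left)
    rw [lintegral_mul_const _ hmθ]
    calc _ ≤ ENNReal.ofReal (2 * t * ω t) *
          (ENNReal.ofReal (C / tail ω (min s t)) * ENNReal.ofReal (tail ω t ^ (-a))) := by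
          gcongr
          exact hKC z (mem_ball_zero_iff.2 hz.2) t ht
      _ = ENNReal.ofReal (2 * t * ω t * (C / tail ω (min s t) * tail ω t ^ (-a))) := by
          rw [← ENNReal.ofReal_mul (by positivity), ← ENNReal.ofReal_mul (by positivity)]
      _ ≤ ENNReal.ofReal (2 * C * (ω t * (tail ω t ^ (-a) / tail ω (min s t)))) := by
          refine ENNReal.ofReal_le_ofReal ?_
          have h1 : 2 * t * ω t * (C / tail ω (min s t) * tail ω t ^ (-a)) =
              t * (2 * C * (ω t * (tail ω t ^ (-a) / tail ω (min s t)))) := by ring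
          rw [h1]
          exact mul_le_of_le_one_left (by positivity) ht.2.le
      _ = _ := ENNReal.ofReal_mul (by positivity)
  have hleft : ∫⁻ t in Ioo 0 s, ENNReal.ofReal (ω t * (tail ω t ^ (-a) / tail ω (min s t))) ≤
      ENNReal.ofReal (tail ω s ^ (-a) / a) := by
    refine le_trans (le_of_eq ?_) (h.lintegral_tail_rpow_le_left ha0 hz)
    refine setLIntegral_congr_fun measurableSet_Ioo fun t ht => ?_
    have hT := h.tail_pos t ⟨ht.1.le, ht.2.trans hz.2⟩
    rw [min_eq_right ht.2.le, Real.rpow_sub_one hT.ne']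
  have hright : ∫⁻ t in Ico s 1, ENNReal.ofReal (ω t * (tail ω t ^ (-a) / tail ω (min s t))) ≤
      ENNReal.ofReal (tail ω s ^ (-a) / (1 - a)) := by
    have e : ∫⁻ t in Ico s 1, ENNReal.ofReal (ω t * (tail ω t ^ (-a) / tail ω (min s t))) =
        ∫⁻ t in Ioo s 1, ENNReal.ofReal (tail ω s)⁻¹ * ENNReal.ofReal (ω t * tail ω t ^ (-a)) := by
      rw [setLIntegral_congr Ioo_ae_eq_Ico.symm]
      refine setLIntegral_congr_fun measurableSet_Ioo fun t ht => ?_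
      rw [min_eq_left ht.1.le, ← ENNReal.ofReal_mul (by positivity)]
      congr 1
      ring
    rw [e, lintegral_const_mul' _ _ ENNReal.ofReal_ne_top]
    calc _ ≤ ENNReal.ofReal (tail ω s)⁻¹ * ENNReal.ofReal (tail ω s ^ (1 - a) / (1 - a)) := by
          gcongr
          exact h.lintegral_tail_rpow_le_right ha.2 hz
      _ = _ := by
          rw [← ENNReal.ofReal_mul (by positivity), show 1 - a = -a + 1 by ring,
            Real.rpow_add_one hTs.ne']
          congr 1
          field_simp
  calc _ ≤ ∫⁻ t in Ioo (0 : ℝ) 1, ENNReal.ofReal (2 * C) *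
        ENNReal.ofReal (ω t * (tail ω t ^ (-a) / tail ω (min s t))) :=
        setLIntegral_mono' measurableSet_Ioo hpt
    _ = ENNReal.ofReal (2 * C) * ∫⁻ t in Ioo (0 : ℝ) 1,
        ENNReal.ofReal (ω t * (tail ω t ^ (-a) / tail ω (min s t))) :=
        lintegral_const_mul' _ _ ENNReal.ofReal_ne_top
    _ ≤ ENNReal.ofReal (2 * C) * (ENNReal.ofReal (tail ω s ^ (-a) / a) +
        ENNReal.ofReal (tail ω s ^ (-a) / (1 - a))) := by
        gcongr
        rw [← Ioo_union_Ico_eq_Ioo hz.1 hz.2.le]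
        exact (lintegral_union_le _ _ _).trans (add_le_add hleft hright)
    _ = _ := by
        rw [tailPow, show ‖z‖ = s from rfl, ← ENNReal.ofReal_add (by positivity) (by positivity),
          ← ENNReal.ofReal_mul (by positivity), ← ENNReal.ofReal_mul (by positivity)]
        congr 1
        field_simp

/-- Boundedness on `L^p_ω` of an operator whose kernel has integral means controlled by the
reciprocal of the tail. -/
theorem IsRadialWeight.exists_lintegral_rpow_le {p : ℝ} (hp : 1 < p) {C : ℝ} (hC : 0 ≤ C) :
    ∃ M : ℝ, 0 < M ∧ ∀ K : ℂ → ℂ → ℝ≥0∞, Measurable (Function.uncurry K) →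
      (∀ z ∈ ball (0 : ℂ) 1, ∀ t ∈ Ioo (0 : ℝ) 1,
        ∫⁻ θ, K z (polarMap (t, θ)) ∂arcMeasure ≤ ENNReal.ofReal (C / tail ω (min ‖z‖ t))) →
      (∀ ζ ∈ ball (0 : ℂ) 1, ∀ s ∈ Ioo (0 : ℝ) 1,
        ∫⁻ θ, K (polarMap (s, θ)) ζ ∂arcMeasure ≤ ENNReal.ofReal (C / tail ω (min ‖ζ‖ s))) →
      ∀ F : ℂ → ℝ≥0∞, Measurable F →
        ∫⁻ z, (∫⁻ ζ, K z ζ * F ζ ∂areaMeasure ω) ^ p ∂areaMeasure ω ≤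
          ENNReal.ofReal M ^ p * ∫⁻ z, F z ^ p ∂areaMeasure ω := by
  have := h.isFiniteMeasure_areaMeasure
  set q := Real.conjExponent p
  have hpq : p.HolderConjugate q := Real.HolderConjugate.conjExponent hp
  have hp0 := hpq.pos
  have hq0 := hpq.symm.pos
  have hq1 : 1 < q := hpq.symm.lt
  have hip : 1 / p ∈ Ioo (0 : ℝ) 1 := ⟨by positivity, by rw [div_lt_one hp0]; exact hp⟩
  have hiq : 1 / q ∈ Ioo (0 : ℝ) 1 := ⟨by positivity, by rw [div_lt_one hq0]; exact hq1⟩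
  set A := 2 * C * (1 / (1 / p) + 1 / (1 - 1 / p))
  set B := 2 * C * (1 / (1 / q) + 1 / (1 - 1 / q))
  have hA : 0 ≤ A := by
    have : 0 < 1 - 1 / p := by linarith [hip.2]
    positivity
  have hB : 0 ≤ B := by
    have : 0 < 1 - 1 / q := by linarith [hiq.2]
    positivity
  -- The summand 1 only keeps the constant positive when `C = 0`.
  refine ⟨(A ^ (p / q) * B) ^ (1 / p) + 1, by positivity, fun K hK h1 h2 F hF => ?_⟩
  have a1 := h.exists_lintegral_mul_tailPow_le hip hC hK h1
  have a2 := h.exists_lintegral_mul_tailPow_le hiq hC (K := fun z ζ => K ζ z)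
    (hK.comp measurable_swap) h2
  -- The exponent $1/(pq)$ turns into $1/p$ under the $q$-th power and into $1/q$ under the $p$-th,
  -- both in $(0,1)$ as the two Schur conditions require.
  have main := lintegral_rpow_le_of_schur (μ := areaMeasure ω) hK hpq
    (h.measurable_tailPow (1 / (p * q))) (A := ENNReal.ofReal A) (B := ENNReal.ofReal B)
    (by
      filter_upwards [ae_areaMeasure ω] with z hz
      have := h.tail_pos ‖z‖ ⟨norm_nonneg _, mem_ball_zero_iff.1 hz⟩
      refine ⟨?_, ENNReal.ofReal_ne_top⟩
      rw [tailPow, Ne, ENNReal.ofReal_eq_zero, not_le]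
      positivity)
    (by
      filter_upwards [ae_areaMeasure ω, a1] with z hz hz1
      rw [h.tailPow_pow (c := 1 / p) (by field_simp) (mem_ball_zero_iff.1 hz) hq0.le]
      refine le_trans (le_of_eq (lintegral_congr_ae ?_)) hz1
      filter_upwards [ae_areaMeasure ω] with ζ hζ
      rw [h.tailPow_pow (c := 1 / p) (by field_simp) (mem_ball_zero_iff.1 hζ) hq0.le])
    (by
      filter_upwards [ae_areaMeasure ω, a2] with z hz hz1
      rw [h.tailPow_pow (c := 1 / q) (by field_simp) (mem_ball_zero_iff.1 hz) hp0.le]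
      refine le_trans (le_of_eq (lintegral_congr_ae ?_)) hz1
      filter_upwards [ae_areaMeasure ω] with ζ hζ
      rw [h.tailPow_pow (c := 1 / q) (by field_simp) (mem_ball_zero_iff.1 hζ) hp0.le]) hF
  refine main.trans ?_
  gcongr
  rw [ENNReal.ofReal_rpow_of_nonneg hA (by positivity), ← ENNReal.ofReal_mul (by positivity),
    ENNReal.ofReal_rpow_of_nonneg (by positivity) hp0.le]
  refine ENNReal.ofReal_le_ofReal ?_
  calc A ^ (p / q) * B = ((A ^ (p / q) * B) ^ (1 / p)) ^ p := by
        rw [← Real.rpow_mul (by positivity), one_div_mul_cancel hp0.ne', Real.rpow_one]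
    _ ≤ _ := by gcongr; linarith

end

/-! ### Boundedness of the projection for doubling weights -/

/-- The `k`-th derivative of the kernel as a function of `z * conj ζ`, set to `0` off the disc. -/
def kernelFun (ω : ℝ → ℝ) (k : ℕ) : ℂ → ℂ := (ball 0 1).indicator (powerSum (kernelCoeff ω k))

/-- The positive kernel of the operator `f ↦ (1 - |z|)^k (P f)^{(k)}`. -/
def posKernel (ω : ℝ → ℝ) (k : ℕ) (z ζ : ℂ) : ℝ≥0∞ :=
  ENNReal.ofReal ((1 - ‖z‖) ^ k) * ‖kernelFun ω k (z * conj ζ)‖ₑ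

theorem kernelFun_of_norm_lt {ω : ℝ → ℝ} {k : ℕ} {w : ℂ} (hw : ‖w‖ < 1) :
    kernelFun ω k w = powerSum (kernelCoeff ω k) w :=
  indicator_of_mem (mem_ball_zero_iff.2 hw) _

theorem conj_kernelCoeff (ω : ℝ → ℝ) (k n : ℕ) :
    conj (kernelCoeff ω k n) = kernelCoeff ω k n := by
  rw [kernelCoeff, iterate_derivCoeff_apply, map_mul, conj_invMoment, map_natCast]

theorem powerSum_conj {c : ℕ → ℂ} (hc : ∀ n, conj (c n) = c n) (w : ℂ) :
    powerSum c (conj w) = conj (powerSum c w) := by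
  rw [powerSum, powerSum, Complex.conj_tsum]
  refine tsum_congr fun n => ?_
  rw [map_mul, map_pow, hc]

theorem norm_mul_lt_one {z ζ : ℂ} (hz : ‖z‖ < 1) (hζ : ‖ζ‖ ≤ 1) : ‖z * ζ‖ < 1 := by
  rw [norm_mul]
  exact (mul_le_of_le_one_right (norm_nonneg _) hζ).trans_lt hz

section
variable {ω : ℝ → ℝ} (h : IsRadialWeight ω)
include h

theorem IsRadialWeight.measurable_kernelFun (k : ℕ) : Measurable (kernelFun ω k) := by
  classical
  unfold kernelFun
  rw [← piecewise_eq_indicator]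
  exact (h.hasUnitRadius_kernelCoeff k).continuousOn.measurable_piecewise continuousOn_const
    measurableSet_ball

theorem IsRadialWeight.measurable_posKernel (k : ℕ) :
    Measurable (Function.uncurry (posKernel ω k)) := by
  have h1 : Measurable fun x : ℂ × ℂ => x.1 * conj x.2 :=
    measurable_fst.mul (Complex.continuous_conj.measurable.comp measurable_snd)
  have h2 : Measurable fun x : ℂ × ℂ => ENNReal.ofReal ((1 - ‖x.1‖) ^ k) := by fun_prop
  exact h2.mul ((h.measurable_kernelFun k).comp h1).enorm

/-- In either variable this is the mean over the circle of radius $|z||\zeta|$. From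
$1-|z|\le1-|z||\zeta|$ the weight cancels the singular power, and monotonicity replaces the tail at
the product by the tail at the minimum. The coefficients are real, so conjugating the argument does
not change the modulus. -/
theorem IsRadialWeight.exists_lintegral_posKernel_le (hD : IsDoubling ω) {k : ℕ} (hk : 1 ≤ k) :
    ∃ C : ℝ, 0 < C ∧
      (∀ z ∈ ball (0 : ℂ) 1, ∀ t ∈ Ioo (0 : ℝ) 1,
        ∫⁻ θ, posKernel ω k z (polarMap (t, θ)) ∂arcMeasure ≤
          ENNReal.ofReal (C / tail ω (min ‖z‖ t))) ∧
      (∀ ζ ∈ ball (0 : ℂ) 1, ∀ s ∈ Ioo (0 : ℝ) 1,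
        ∫⁻ θ, posKernel ω k (polarMap (s, θ)) ζ ∂arcMeasure ≤
          ENNReal.ofReal (C / tail ω (min ‖ζ‖ s))) := by
  obtain ⟨l, rfl⟩ := Nat.exists_eq_add_of_le' hk
  obtain ⟨C, hC, hw⟩ := h.exists_integral_norm_kernel_le hD l
  have hc := h.hasUnitRadius_kernelCoeff (l + 1)
  have key : ∀ s ∈ Ico (0 : ℝ) 1, ∀ t ∈ Ico (0 : ℝ) 1, ∀ w : ℂ, ‖w‖ = s * t →
      ENNReal.ofReal ((1 - s) ^ (l + 1)) *
        ∫⁻ θ, ‖powerSum (kernelCoeff ω (l + 1)) (w * unitExp θ)‖ₑ ∂arcMeasure ≤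
        ENNReal.ofReal (C / tail ω (min s t)) := by
    intro s hs t ht w hwst
    have hst : s * t < 1 := mul_lt_one_of_nonneg_of_lt_one_left hs.1 hs.2 ht.2.le
    have hst1 : s * t ≤ min s t :=
      le_min (mul_le_of_le_one_right hs.1 ht.2.le) (mul_le_of_le_one_left ht.1 hs.2.le)
    have hst0 : 0 ≤ s * t := mul_nonneg hs.1 ht.1
    have hw1 : ‖w‖ < 1 := by rwa [hwst]
    have hcont := hc.continuous_circle hw1
    have hint : Integrable (fun θ => ‖powerSum (kernelCoeff ω (l + 1)) (w * unitExp θ)‖)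
        arcMeasure := by
      refine Integrable.smul_measure (μ := volume.restrict _) ?_ ENNReal.ofReal_ne_top
      exact (hcont.norm.integrableOn_Icc (a := -Real.pi) (b := Real.pi)).mono_set
        Ioo_subset_Icc_self
    have e : ∫⁻ θ, ‖powerSum (kernelCoeff ω (l + 1)) (w * unitExp θ)‖ₑ ∂arcMeasure =
        ENNReal.ofReal (∫ θ, ‖powerSum (kernelCoeff ω (l + 1)) (w * unitExp θ)‖ ∂arcMeasure) := by
      rw [ofReal_integral_eq_lintegral_ofReal hint (Eventually.of_forall fun _ => norm_nonneg _)]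
      simp_rw [ofReal_norm]
    have hs1 : 0 < 1 - s := by linarith [hs.2]
    rw [e, ← ENNReal.ofReal_mul (by positivity)]
    refine ENNReal.ofReal_le_ofReal ?_
    have hm : 0 ≤ min s t := le_min hs.1 ht.1
    have hTm : 0 < tail ω (min s t) := h.tail_pos _ ⟨hm, (min_le_left _ _).trans_lt hs.2⟩
    have hT := h.tail_anti hst0 hst1
    have hT0 := h.tail_nonneg hst0
    have hb := hw w hw1
    rw [hwst] at hb
    have h1 : 1 - s ≤ 1 - s * t := by linarith [mul_le_of_le_one_right hs.1 ht.2.le]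
    calc (1 - s) ^ (l + 1) * _ ≤ (1 - s) ^ (l + 1) *
          (C / (tail ω (s * t) * (1 - s * t) ^ (l + 1))) := by gcongr
      _ ≤ (1 - s) ^ (l + 1) * (C / (tail ω (min s t) * (1 - s) ^ (l + 1))) := by gcongr
      _ = _ := by field_simp
  refine ⟨C, hC, fun z hz t ht => ?_, fun ζ hζ s hs => ?_⟩
  · have hz' := mem_ball_zero_iff.1 hz
    have e : ∀ θ, posKernel ω (l + 1) z (polarMap (t, θ)) =
        ENNReal.ofReal ((1 - ‖z‖) ^ (l + 1)) *
          ‖powerSum (kernelCoeff ω (l + 1)) (conj z * t * unitExp θ)‖ₑ := fun θ => by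
      have hlt : ‖z * conj (polarMap (t, θ))‖ < 1 :=
        norm_mul_lt_one hz' (by simpa [norm_polarMap, abs_of_pos ht.1] using ht.2.le)
      have hconj : conj z * t * unitExp θ = conj (z * conj (polarMap (t, θ))) := by
        rw [polarMap_eq]
        simp [mul_assoc]
      rw [posKernel, kernelFun_of_norm_lt hlt, hconj, powerSum_conj (conj_kernelCoeff ω _),
        ← ofReal_norm, ← ofReal_norm, RCLike.norm_conj]
    simp_rw [e]
    rw [lintegral_const_mul' _ _ ENNReal.ofReal_ne_top]
    refine key ‖z‖ ⟨norm_nonneg _, hz'⟩ t (Ioo_subset_Ico_self ht) _ ?_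
    simp [abs_of_pos ht.1]
  · have hζ' := mem_ball_zero_iff.1 hζ
    have e : ∀ θ, posKernel ω (l + 1) (polarMap (s, θ)) ζ =
        ENNReal.ofReal ((1 - s) ^ (l + 1)) *
          ‖powerSum (kernelCoeff ω (l + 1)) (conj ζ * s * unitExp θ)‖ₑ := fun θ => by
      have hlt : ‖polarMap (s, θ) * conj ζ‖ < 1 :=
        norm_mul_lt_one (by simpa [norm_polarMap, abs_of_pos hs.1] using hs.2)
          (by simpa using hζ'.le)
      rw [posKernel, kernelFun_of_norm_lt hlt, norm_polarMap, abs_of_pos hs.1, polarMap_eq]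
      congr 3
      ring
    simp_rw [e]
    rw [lintegral_const_mul' _ _ ENNReal.ofReal_ne_top, min_comm]
    refine key s (Ioo_subset_Ico_self hs) ‖ζ‖ ⟨norm_nonneg _, hζ'⟩ _ ?_
    simp [abs_of_pos hs.1, mul_comm]

/-- Polar coordinates move the factor from the weight to the integrand, so measurability of the
weight is needed in the radial variable only. -/
theorem IsRadialWeight.lintegral_bracketWeight {β : ℝ} {F : ℂ → ℝ≥0∞}
    (hF : Measurable F) : ∫⁻ z, F z ∂areaMeasure (bracketWeight ω β) =
      ∫⁻ z, ENNReal.ofReal ((1 - ‖z‖) ^ β) * F z ∂areaMeasure ω := by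
  have hm : AEMeasurable (bracketWeight ω β) (volume.restrict (Ioo (0 : ℝ) 1)) :=
    h.aemeasurable.mul (by fun_prop)
  have hF2 : Measurable fun z : ℂ => ENNReal.ofReal ((1 - ‖z‖) ^ β) * F z :=
    Measurable.mul (by fun_prop) hF
  have hm1 : Measurable fun r : ℝ => ∫⁻ θ, F (polarMap (r, θ)) ∂arcMeasure :=
    (hF.comp measurable_polarMap).lintegral_prod_right'
  have hm2 : Measurable fun r : ℝ => ∫⁻ θ, ENNReal.ofReal ((1 - ‖polarMap (r, θ)‖) ^ β) *
      F (polarMap (r, θ)) ∂arcMeasure :=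
    (hF2.comp measurable_polarMap).lintegral_prod_right'
  have hd : AEMeasurable (fun r => ENNReal.ofReal (2 * r * bracketWeight ω β r))
      (volume.restrict (Ioo (0 : ℝ) 1)) :=
    ((measurable_const.mul measurable_id).aemeasurable.mul hm).ennreal_ofReal
  rw [h.lintegral_areaMeasure hF2, h.lintegral_radialMeasure hm2, areaMeasure_eq_map hm,
    lintegral_map hF measurable_polarMap, lintegral_prod (fun x => F (polarMap x))
      (hF.comp measurable_polarMap).aemeasurable, radialMeasure,
    lintegral_withDensity_eq_lintegral_mul₀ hd hm1.aemeasurable]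
  refine setLIntegral_congr_fun measurableSet_Ioo fun r hr => ?_
  have h0 := h.nonneg r (Ioo_subset_Ico_self hr)
  have h1 := hr.1.le
  simp only [Pi.mul_apply, norm_polarMap, abs_of_pos hr.1]
  rw [lintegral_const_mul' _ _ ENNReal.ofReal_ne_top, ← mul_assoc,
    ← ENNReal.ofReal_mul (by positivity)]
  congr 2
  rw [bracketWeight]
  ring

theorem IsRadialWeight.areaMeasure_bracketWeight (β : ℝ) :
    areaMeasure (bracketWeight ω β) =
      (areaMeasure ω).withDensity fun z => ENNReal.ofReal ((1 - ‖z‖) ^ β) := by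
  ext s hs
  rw [withDensity_apply _ hs, ← lintegral_indicator_one hs,
    h.lintegral_bracketWeight (measurable_one.indicator hs), ← lintegral_indicator hs]
  congr 1
  ext z
  by_cases hz : z ∈ s <;> simp [hz]

theorem IsRadialWeight.eLpNorm_bracketWeight {p : ℝ} (hp : 1 < p) (k : ℕ) (G : ℂ → ℂ) :
    eLpNorm G (ENNReal.ofReal p) (areaMeasure (bracketWeight ω (k * p))) =
      (∫⁻ z, (ENNReal.ofReal ((1 - ‖z‖) ^ k) * ‖G z‖ₑ) ^ p ∂areaMeasure ω) ^ (1 / p) := by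
  have hp0 : 0 < p := by linarith
  rw [eLpNorm_eq_lintegral_rpow_enorm_toReal (by simpa using hp0) ENNReal.ofReal_ne_top,
    ENNReal.toReal_ofReal hp0.le, h.areaMeasure_bracketWeight,
    lintegral_withDensity_eq_lintegral_mul_non_measurable _ (by fun_prop)
      (Eventually.of_forall fun _ => ENNReal.ofReal_lt_top)]
  congr 1
  refine lintegral_congr_ae ?_
  filter_upwards [ae_areaMeasure ω] with z hz
  have h1 : 0 ≤ 1 - ‖z‖ := by linarith [mem_ball_zero_iff.1 hz]
  rw [Pi.mul_apply, ENNReal.mul_rpow_of_nonneg _ _ hp0.le,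
    ENNReal.ofReal_rpow_of_nonneg (by positivity) hp0.le, ← Real.rpow_natCast,
    ← Real.rpow_mul h1]

/-- Membership in `L^p` and the norm bound for the `k`-th derivative from an integral bound. -/
theorem IsRadialWeight.memLebesgue_bracketWeight {p : ℝ} (hp : 1 < p) {k : ℕ} {G : ℂ → ℂ}
    (hG : IsAnalytic G) {M : ℝ} (hM : 0 ≤ M)
    (hle : ∫⁻ z, (ENNReal.ofReal ((1 - ‖z‖) ^ k) * ‖G z‖ₑ) ^ p ∂areaMeasure ω ≤
      ENNReal.ofReal M ^ p) :
    MemLebesgue (bracketWeight ω (k * p)) p G ∧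
      lebesgueNorm (bracketWeight ω (k * p)) p G ≤ M := by
  have hp0 : 0 < p := by linarith
  have h1 : eLpNorm G (ENNReal.ofReal p) (areaMeasure (bracketWeight ω (k * p))) ≤
      ENNReal.ofReal M := by
    rw [h.eLpNorm_bracketWeight hp]
    calc _ ≤ (ENNReal.ofReal M ^ p) ^ (1 / p) := by gcongr
      _ = _ := by rw [← ENNReal.rpow_mul, mul_one_div_cancel hp0.ne', ENNReal.rpow_one]
  refine ⟨⟨hG.aestronglyMeasurable, h1.trans_lt ENNReal.ofReal_lt_top⟩, ?_⟩
  rw [lebesgueNorm, ← ENNReal.toReal_ofReal hM]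
  exact ENNReal.toReal_mono ENNReal.ofReal_ne_top h1

omit h in
theorem iteratedDeriv_zero_eq (f : ℂ → ℂ) (j : ℕ) :
    iteratedDeriv j f 0 = j.factorial * taylorCoeff f j := by
  rw [taylorCoeff, mul_inv_cancel_left₀]
  exact_mod_cast j.factorial_ne_zero

omit h in
theorem eLpNorm_ofReal_rpow {μ : Measure ℂ} {p : ℝ} (hp : 0 < p) (f : ℂ → ℂ) :
    eLpNorm f (ENNReal.ofReal p) μ ^ p = ∫⁻ z, ‖f z‖ₑ ^ p ∂μ := by
  rw [eLpNorm_eq_lintegral_rpow_enorm_toReal (by simpa using hp) ENNReal.ofReal_ne_top,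
    ENNReal.toReal_ofReal hp.le, ← ENNReal.rpow_mul, one_div_mul_cancel hp.ne', ENNReal.rpow_one]

theorem IsRadialWeight.exists_integral_norm_le {p : ℝ} (hp : 1 < p) :
    ∃ C : ℝ, 0 < C ∧ ∀ f : ℂ → ℂ, MemLebesgue ω p f →
      ∫ z, ‖f z‖ ∂areaMeasure ω ≤ C * lebesgueNorm ω p f := by
  have := h.isFiniteMeasure_areaMeasure
  have hpq := Real.HolderConjugate.conjExponent hp
  refine ⟨(eLpNorm (fun _ => (1 : ℂ)) (ENNReal.ofReal (Real.conjExponent p))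
    (areaMeasure ω)).toReal + 1, by positivity, fun f hf => ?_⟩
  have hfn : MemLp (fun z => ((‖f z‖ : ℝ) : ℂ)) (ENNReal.ofReal p) (areaMeasure ω) :=
    hf.norm.ofReal
  have h1 := norm_integral_mul_le hpq hfn (memLp_const (1 : ℂ))
  have h2 : eLpNorm (fun z => ((‖f z‖ : ℝ) : ℂ)) (ENNReal.ofReal p) (areaMeasure ω) =
      eLpNorm f (ENNReal.ofReal p) (areaMeasure ω) :=
    eLpNorm_congr_norm_ae (Eventually.of_forall fun z => by simp)
  simp only [mul_one] at h1
  rw [integral_complex_ofReal, Complex.norm_real, h2] at h1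
  refine (le_abs_self _).trans (h1.trans ?_)
  rw [mul_comm]
  have : 0 ≤ lebesgueNorm ω p f := ENNReal.toReal_nonneg
  change _ * lebesgueNorm ω p f ≤ _
  gcongr
  linarith

/-- Differentiating the series $k$ times pulls out $\bar\zeta^k$, which has modulus at most 1, so
the weighted derivative is dominated by the operator with kernel `posKernel`. The derivatives at the
origin are controlled by the $L^1$ norm. -/
theorem IsRadialWeight.projectionBounded_of_isDoubling (hD : IsDoubling ω) {p : ℝ} (hp : 1 < p)
    {k : ℕ} (hk : 1 ≤ k) : ProjectionBounded ω p k := by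
  have hp0 : 0 < p := by linarith
  obtain ⟨C, hC, hC1, hC2⟩ := h.exists_lintegral_posKernel_le hD hk
  obtain ⟨M, hM, hMK⟩ := h.exists_lintegral_rpow_le hp hC.le
  obtain ⟨C', hC', hfC⟩ := h.exists_integral_norm_le hp
  refine ⟨M + (∑ j ∈ Finset.range (k + 1), j.factorial * ‖invMoment ω j‖) * C', by positivity,
    fun f hf => ?_⟩
  have hi := h.integrable_of_memLebesgue hp hf
  have hd := h.hasUnitRadius_projCoeff hi
  have he := h.bergmanProjection_eqOn hi
  have hE : EqOn (iteratedDeriv k (bergmanProjection ω f))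
      (powerSum (derivCoeff^[k] (projCoeff ω f))) (ball 0 1) := fun z hz => by
    rw [iteratedDeriv_congr_ball he k hz, hd.iteratedDeriv_powerSum k hz]
  have hGa : IsAnalytic (iteratedDeriv k (bergmanProjection ω f)) :=
    (hd.iterate_derivCoeff k).isAnalytic.congr hE
  have hfk : Integrable (fun ζ => f ζ * conj ζ ^ k) (areaMeasure ω) := by
    refine hi.norm.mono' (hi.1.mul (by fun_prop)) ?_
    filter_upwards [ae_areaMeasure ω] with z hz
    rw [norm_mul, norm_pow, Complex.norm_conj]
    exact mul_le_of_le_one_right (norm_nonneg _)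
      (pow_le_one₀ (norm_nonneg _) (mem_ball_zero_iff.1 hz).le)
  have hrep : ∀ z ∈ ball (0 : ℂ) 1, iteratedDeriv k (bergmanProjection ω f) z =
      ∫ ζ, f ζ * conj ζ ^ k * powerSum (kernelCoeff ω k) (z * conj ζ) ∂areaMeasure ω := by
    intro z hz
    rw [hE hz, ← (integral_mul_powerSum hfk (ae_areaMeasure ω) (h.hasUnitRadius_kernelCoeff k)
      (mem_ball_zero_iff.1 hz)).tsum_eq, powerSum]
    refine tsum_congr fun n => ?_
    rw [iterate_derivCoeff_apply, kernelCoeff, iterate_derivCoeff_apply, projCoeff]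
    have : ∀ ζ, f ζ * conj ζ ^ (n + k) = f ζ * conj ζ ^ k * conj ζ ^ n := fun ζ => by ring
    simp_rw [this]
    ring
  obtain ⟨F, hF, hfF⟩ := hi.1.enorm
  have hbound : ∫⁻ z, (ENNReal.ofReal ((1 - ‖z‖) ^ k) *
      ‖iteratedDeriv k (bergmanProjection ω f) z‖ₑ) ^ p ∂areaMeasure ω ≤
      ENNReal.ofReal (M * lebesgueNorm ω p f) ^ p := by
    calc _ ≤ ∫⁻ z, (∫⁻ ζ, posKernel ω k z ζ * F ζ ∂areaMeasure ω) ^ p ∂areaMeasure ω := by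
          refine lintegral_mono_ae ?_
          filter_upwards [ae_areaMeasure ω] with z hz
          gcongr 1
          rw [hrep z hz]
          calc _ ≤ ENNReal.ofReal ((1 - ‖z‖) ^ k) * ∫⁻ ζ,
                ‖f ζ * conj ζ ^ k * powerSum (kernelCoeff ω k) (z * conj ζ)‖ₑ ∂areaMeasure ω := by
                gcongr
                exact enorm_integral_le_lintegral_enorm _
            _ = ∫⁻ ζ, ENNReal.ofReal ((1 - ‖z‖) ^ k) *
                ‖f ζ * conj ζ ^ k * powerSum (kernelCoeff ω k) (z * conj ζ)‖ₑ ∂areaMeasure ω := by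
                rw [lintegral_const_mul' _ _ ENNReal.ofReal_ne_top]
            _ ≤ _ := by
                refine lintegral_mono_ae ?_
                filter_upwards [ae_areaMeasure ω, hfF] with ζ hζ hζF
                have hlt : ‖z * conj ζ‖ < 1 := norm_mul_lt_one (mem_ball_zero_iff.1 hz)
                  (by simpa using (mem_ball_zero_iff.1 hζ).le)
                have h1 : ‖conj ζ ^ k‖ₑ ≤ 1 := by
                  rw [← ofReal_norm, norm_pow, Complex.norm_conj]
                  exact ENNReal.ofReal_le_one.2
                    (pow_le_one₀ (norm_nonneg _) (mem_ball_zero_iff.1 hζ).le)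
                rw [← hζF, posKernel, kernelFun_of_norm_lt hlt, enorm_mul, enorm_mul]
                calc _ ≤ ENNReal.ofReal ((1 - ‖z‖) ^ k) *
                      (‖f ζ‖ₑ * 1 * ‖powerSum (kernelCoeff ω k) (z * conj ζ)‖ₑ) := by gcongr
                  _ = _ := by rw [mul_one]; ring
      _ ≤ ENNReal.ofReal M ^ p * ∫⁻ z, F z ^ p ∂areaMeasure ω :=
          hMK _ (h.measurable_posKernel k) hC1 hC2 F hF
      _ = ENNReal.ofReal M ^ p * eLpNorm f (ENNReal.ofReal p) (areaMeasure ω) ^ p := by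
          rw [eLpNorm_ofReal_rpow hp0]
          congr 1
          refine lintegral_congr_ae ?_
          filter_upwards [hfF] with ζ hζ
          rw [hζ]
      _ = _ := by
          rw [ENNReal.ofReal_mul hM.le, lebesgueNorm, ENNReal.ofReal_toReal hf.2.ne,
            ENNReal.mul_rpow_of_nonneg _ _ hp0.le]
  have hN : 0 ≤ lebesgueNorm ω p f := ENNReal.toReal_nonneg
  obtain ⟨m1, m2⟩ := h.memLebesgue_bracketWeight hp hGa (by positivity) hbound
  refine ⟨⟨hd.isAnalytic.congr he, m1⟩, ?_⟩
  rw [dirichletNorm, add_mul]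
  refine add_le_add m2 ?_
  rw [mul_assoc, Finset.sum_mul]
  refine Finset.sum_le_sum fun j _ => ?_
  rw [iteratedDeriv_zero_eq, taylorCoeff_congr he, hd.taylorCoeff_powerSum, projCoeff, norm_mul,
    norm_mul, Complex.norm_natCast, mul_assoc]
  gcongr
  exact (norm_integral_mul_conj_pow_le hi j).trans (hfC f hf)

end

/-! ### Dilations contract and converge -/

theorem map_mul_areaMeasure (ω : ℝ → ℝ) {u : ℂ} (hu : ‖u‖ = 1) :
    (areaMeasure ω).map (fun z => z * u) = areaMeasure ω := by
  let c : Circle := ⟨u, mem_sphere_zero_iff_norm.2 hu⟩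
  let e := rotation c
  have he : ∀ z, e z = z * u := fun z => (rotation_apply c z).trans (mul_comm _ _)
  have hmp : MeasurePreserving e volume volume := e.measurePreserving
  have hemb : MeasurableEmbedding e := e.toHomeomorph.measurableEmbedding
  have hfun : (fun z => z * u) = e := funext fun z => (he z).symm
  rw [hfun]
  ext s hs
  rw [Measure.map_apply hemb.measurable hs]
  simp only [areaMeasure, Measure.smul_apply]
  congr 1
  rw [withDensity_apply _ hs, withDensity_apply _ (hemb.measurable hs),
    Measure.restrict_restrict hs, Measure.restrict_restrict (hemb.measurable hs),
    ← hmp.setLIntegral_comp_preimage_emb hemb _ (s ∩ ball 0 1)]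
  have h1 : e ⁻¹' (s ∩ ball 0 1) = e ⁻¹' s ∩ ball 0 1 := by
    ext z
    simp
  rw [h1]
  simp [e.norm_map]

/-- The probability measure on the circle with the Poisson kernel of `r` as density. -/
def poissonMeasure (r : ℝ) : Measure ℝ :=
  (volume.restrict (Ioc 0 (2 * Real.pi))).withDensity fun θ =>
    ENNReal.ofReal ((2 * Real.pi)⁻¹ * poissonKernel 0 (r : ℂ) (circleMap 0 1 θ))

theorem poissonKernel_nonneg {r : ℝ} (hr : r ∈ Ioo (0 : ℝ) 1) (θ : ℝ) :
    0 ≤ poissonKernel 0 (r : ℂ) (circleMap 0 1 θ) := by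
  rw [poissonKernel_def]
  refine div_nonneg ?_ (by positivity)
  have h1 := hr.1
  have h2 := hr.2
  simp only [sub_zero, norm_circleMap_zero, Complex.norm_real, Real.norm_of_nonneg hr.1.le]
  simp only [abs_one]
  nlinarith

theorem continuous_poissonKernel {r : ℝ} (hr : r ∈ Ioo (0 : ℝ) 1) :
    Continuous fun θ => poissonKernel 0 (r : ℂ) (circleMap 0 1 θ) := by
  simp only [poissonKernel_def]
  refine Continuous.div (by fun_prop) (by fun_prop) fun θ => ?_
  have hne : circleMap 0 1 θ ≠ (r : ℂ) := fun h0 => by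
    have := congrArg norm h0
    rw [norm_circleMap_zero, Complex.norm_real, Real.norm_of_nonneg hr.1.le, abs_one] at this
    linarith [hr.2]
  have : circleMap 0 1 θ - 0 - ((r : ℂ) - 0) ≠ 0 := by simpa [sub_eq_zero] using hne
  positivity

theorem integral_poissonMeasure {r : ℝ} (hr : r ∈ Ioo (0 : ℝ) 1) {f : ℂ → ℂ}
    (hf : DiffContOnCl ℂ f (ball 0 1)) :
    ∫ θ, f (circleMap 0 1 θ) ∂poissonMeasure r = f r := by
  have hw : (r : ℂ) ∈ ball (0 : ℂ) 1 := by simpa [abs_of_pos hr.1] using hr.2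
  have h1 := hf.circleAverage_poissonKernel_smul hw
  have hm : AEMeasurable (fun θ => ENNReal.ofReal
      ((2 * Real.pi)⁻¹ * poissonKernel 0 (r : ℂ) (circleMap 0 1 θ)))
      (volume.restrict (Ioc 0 (2 * Real.pi))) :=
    (continuous_const.mul (continuous_poissonKernel hr)).measurable.ennreal_ofReal.aemeasurable
  rw [← h1, poissonMeasure, integral_withDensity_eq_integral_toReal_smul₀ hm
    (Eventually.of_forall fun _ => ENNReal.ofReal_lt_top), Real.circleAverage_def,
    intervalIntegral.integral_of_le (by positivity), ← integral_smul]
  refine integral_congr_ae (Eventually.of_forall fun θ => ?_)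
  have := poissonKernel_nonneg hr θ
  simp only
  rw [ENNReal.toReal_ofReal (by positivity)]
  simp only [Pi.smul_apply', smul_smul]

theorem isProbabilityMeasure_poissonMeasure {r : ℝ} (hr : r ∈ Ioo (0 : ℝ) 1) :
    IsProbabilityMeasure (poissonMeasure r) := by
  have h1 := integral_poissonMeasure hr (f := fun _ => 1) diffContOnCl_const
  rw [integral_const, Complex.real_smul, mul_one] at h1
  have h2 : (poissonMeasure r).real univ = 1 := by exact_mod_cast h1
  constructor
  rwa [Measure.real, ENNReal.toReal_eq_one_iff] at h2

/-- For $|z|<1$ the function $u\mapsto f(zu)$ is analytic across the closed disc, so $f(rz)$ is its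
Poisson average at $r$. Since that measure is a probability, the $L^1$ norm is at most the $L^q$
norm. -/
theorem enorm_rpow_dilation_le {f : ℂ → ℂ} (hf : IsAnalytic f) {q : ℝ} (hq : 1 ≤ q) {r : ℝ}
    (hr : r ∈ Ioo (0 : ℝ) 1) {z : ℂ} (hz : z ∈ ball (0 : ℂ) 1) :
    ‖f (r * z)‖ₑ ^ q ≤ ∫⁻ θ, ‖f (z * circleMap 0 1 θ)‖ₑ ^ q ∂poissonMeasure r := by
  have := isProbabilityMeasure_poissonMeasure hr
  have hz' := mem_ball_zero_iff.1 hz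
  have hq0 : 0 < q := by linarith
  have hmaps : MapsTo (fun u => z * u) (closedBall (0 : ℂ) 1) (ball 0 1) := fun u hu => by
    rw [mem_ball_zero_iff]
    exact norm_mul_lt_one hz' (by simpa using hu)
  have hd : DiffContOnCl ℂ (fun u => f (z * u)) (ball 0 1) := by
    refine DifferentiableOn.diffContOnCl ?_
    rw [closure_ball _ one_ne_zero]
    exact DifferentiableOn.comp hf (by fun_prop) hmaps
  have h1 := integral_poissonMeasure hr hd
  rw [mul_comm, ← h1]
  have hcont : Continuous fun θ => f (z * circleMap 0 1 θ) :=
    (DifferentiableOn.continuousOn hf).comp_continuous (by fun_prop) fun θ =>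
      hmaps (by simp)
  have h2 : eLpNorm (fun θ => f (z * circleMap 0 1 θ)) 1 (poissonMeasure r) ≤
      eLpNorm (fun θ => f (z * circleMap 0 1 θ)) (ENNReal.ofReal q) (poissonMeasure r) :=
    eLpNorm_le_eLpNorm_of_exponent_le (by
      rw [← ENNReal.ofReal_one]; exact ENNReal.ofReal_le_ofReal hq) hcont.aestronglyMeasurable
  rw [eLpNorm_one_eq_lintegral_enorm] at h2
  calc _ ≤ (∫⁻ θ, ‖f (z * circleMap 0 1 θ)‖ₑ ∂poissonMeasure r) ^ q := by
        gcongr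
        exact enorm_integral_le_lintegral_enorm _
    _ ≤ _ := by
        rw [eLpNorm_eq_lintegral_rpow_enorm_toReal (by simpa using hq0) ENNReal.ofReal_ne_top,
          ENNReal.toReal_ofReal hq0.le] at h2
        calc _ ≤ _ := ENNReal.rpow_le_rpow h2 hq0.le
          _ = _ := by rw [← ENNReal.rpow_mul, one_div_mul_cancel hq0.ne', ENNReal.rpow_one]

theorem norm_ofReal_mul_lt {r : ℝ} (hr : r ∈ Ioo (0 : ℝ) 1) {z : ℂ} (hz : ‖z‖ < 1) :
    ‖(r : ℂ) * z‖ < 1 :=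
  norm_mul_lt_one (by simpa [abs_of_pos hr.1] using hr.2) hz.le

theorem IsAnalytic.dilation {f : ℂ → ℂ} (hf : IsAnalytic f) {r : ℝ} (hr : r ∈ Ioo (0 : ℝ) 1) :
    IsAnalytic fun z => f (r * z) :=
  DifferentiableOn.comp hf (by fun_prop) fun z hz =>
    mem_ball_zero_iff.2 (norm_ofReal_mul_lt hr (mem_ball_zero_iff.1 hz))

section
variable {ω : ℝ → ℝ} (h : IsRadialWeight ω)
include h

/-- The dilate is dominated by an average of rotates, and the measure is rotation invariant; no
property of the radial weight beyond finiteness of the measure enters. -/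
theorem IsRadialWeight.lintegral_dilation_le {f : ℂ → ℂ} (hf : IsAnalytic f) {q : ℝ} (hq : 1 ≤ q)
    {r : ℝ} (hr : r ∈ Ioo (0 : ℝ) 1) :
    ∫⁻ z, ‖f (r * z)‖ₑ ^ q ∂areaMeasure ω ≤ ∫⁻ z, ‖f z‖ₑ ^ q ∂areaMeasure ω := by
  classical
  have := h.isFiniteMeasure_areaMeasure
  have := isProbabilityMeasure_poissonMeasure hr
  set F : ℂ → ℝ≥0∞ := fun z => ‖(ball (0 : ℂ) 1).indicator f z‖ₑ ^ q
  have hF : Measurable F := by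
    have : Measurable ((ball (0 : ℂ) 1).indicator f) := by
      rw [← piecewise_eq_indicator]
      exact (DifferentiableOn.continuousOn hf).measurable_piecewise continuousOn_const
        measurableSet_ball
    exact this.enorm.pow_const q
  have hFf : ∀ z ∈ ball (0 : ℂ) 1, F z = ‖f z‖ₑ ^ q := fun z hz => by
    simp only [F, indicator_of_mem hz]
  have hm : Measurable fun x : ℂ × ℝ => F (x.1 * circleMap 0 1 x.2) := hF.comp (by fun_prop)
  calc ∫⁻ z, ‖f (r * z)‖ₑ ^ q ∂areaMeasure ω
      ≤ ∫⁻ z, ∫⁻ θ, F (z * circleMap 0 1 θ) ∂poissonMeasure r ∂areaMeasure ω := by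
        refine lintegral_mono_ae ?_
        filter_upwards [ae_areaMeasure ω] with z hz
        refine (enorm_rpow_dilation_le hf hq hr hz).trans (le_of_eq (lintegral_congr fun θ => ?_))
        refine (hFf _ ?_).symm
        rw [mem_ball_zero_iff]
        exact norm_mul_lt_one (mem_ball_zero_iff.1 hz) (by simp)
    _ = ∫⁻ θ, ∫⁻ z, F (z * circleMap 0 1 θ) ∂areaMeasure ω ∂poissonMeasure r :=
        lintegral_lintegral_swap hm.aemeasurable
    _ = ∫⁻ _, ∫⁻ z, F z ∂areaMeasure ω ∂poissonMeasure r := by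
        refine lintegral_congr fun θ => ?_
        rw [← lintegral_map (f := F) (g := fun z => z * circleMap 0 1 θ) hF (by fun_prop),
          map_mul_areaMeasure ω (by simp)]
    _ = ∫⁻ z, F z ∂areaMeasure ω := by simp
    _ = _ := lintegral_congr_ae (by filter_upwards [ae_areaMeasure ω] with z hz using hFf z hz)

omit h in
/-- Convergence in `L^q` from pointwise convergence and a bound for the norms. -/
theorem tendsto_lintegral_rpow_sub {α : Type*} [MeasurableSpace α] {μ : Measure α} {q : ℝ}
    (hq' : 0 < q) {f : α → ℂ} {F : ℕ → α → ℂ} (hf : AEStronglyMeasurable f μ)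
    (hF : ∀ n, AEStronglyMeasurable (F n) μ) (hfin : ∫⁻ x, ‖f x‖ₑ ^ q ∂μ ≠ ⊤)
    (hle : ∀ n, ∫⁻ x, ‖F n x‖ₑ ^ q ∂μ ≤ ∫⁻ x, ‖f x‖ₑ ^ q ∂μ)
    (hlim : ∀ᵐ x ∂μ, Tendsto (fun n => F n x) atTop (𝓝 (f x))) :
    Tendsto (fun n => ∫⁻ x, ‖F n x - f x‖ₑ ^ q ∂μ) atTop (𝓝 0) := by
  have hq := hq'.le
  set I := ∫⁻ x, ‖f x‖ₑ ^ q ∂μ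
  set c : ℝ≥0∞ := 2 ^ q
  have hc : c ≠ ⊤ := ENNReal.rpow_ne_top_of_nonneg hq (by simp)
  set E : ℕ → ℝ≥0∞ := fun n => ∫⁻ x, ‖F n x - f x‖ₑ ^ q ∂μ
  set X := c * (I + I)
  have hX : X ≠ ⊤ := ENNReal.mul_ne_top hc (ENNReal.add_ne_top.2 ⟨hfin, hfin⟩)
  have hpt : ∀ n x, ‖F n x - f x‖ₑ ^ q ≤ c * (‖F n x‖ₑ ^ q + ‖f x‖ₑ ^ q) := fun n x => by
    calc ‖F n x - f x‖ₑ ^ q ≤ (2 * max ‖F n x‖ₑ ‖f x‖ₑ) ^ q := by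
          gcongr
          rw [two_mul]
          exact enorm_sub_le.trans (add_le_add (le_max_left _ _) (le_max_right _ _))
      _ = c * max (‖F n x‖ₑ ^ q) (‖f x‖ₑ ^ q) := by
          rw [ENNReal.mul_rpow_of_nonneg _ _ hq, (ENNReal.monotone_rpow_of_nonneg hq).map_max]
      _ ≤ _ := by
          gcongr
          exact max_le le_self_add le_add_self
  have hFm : ∀ n, AEMeasurable (fun x => ‖F n x‖ₑ ^ q) μ := fun n => (hF n).enorm.pow_const q
  have hfm : AEMeasurable (fun x => ‖f x‖ₑ ^ q) μ := hf.enorm.pow_const q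
  have hDm : ∀ n, AEMeasurable (fun x => ‖F n x - f x‖ₑ ^ q) μ := fun n =>
    ((hF n).sub hf).enorm.pow_const q
  have hsum : ∀ n, ∫⁻ x, c * (‖F n x‖ₑ ^ q + ‖f x‖ₑ ^ q) ∂μ ≤ X := fun n => by
    rw [lintegral_const_mul' _ _ hc, lintegral_add_right' _ hfm]
    exact mul_le_mul_right (add_le_add (hle n) le_rfl) _
  have hEX : ∀ n, E n ≤ X := fun n => (lintegral_mono (hpt n)).trans (hsum n)
  -- Fatou is applied to the nonnegative functions $c(|F_n|^q+|f|^q)-|F_n-f|^q$. As the norms of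
  -- $F_n$ do not exceed that of $f$, this gives $X\le X-\limsup E$, and finiteness of $X$ forces
  -- $\limsup E=0$.
  have hfatou : X ≤ liminf (fun n => X - E n) atTop := by
    calc X = ∫⁻ x, c * (‖f x‖ₑ ^ q + ‖f x‖ₑ ^ q) ∂μ := by
          rw [lintegral_const_mul' _ _ hc, lintegral_add_right' _ hfm]
      _ ≤ ∫⁻ x, liminf (fun n => c * (‖F n x‖ₑ ^ q + ‖f x‖ₑ ^ q) - ‖F n x - f x‖ₑ ^ q) atTop
            ∂μ := by
          refine lintegral_mono_ae ?_
          filter_upwards [hlim] with x hx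
          have h1 : Tendsto (fun n => ‖F n x‖ₑ ^ q) atTop (𝓝 (‖f x‖ₑ ^ q)) :=
            (ENNReal.continuous_rpow_const.tendsto _).comp hx.enorm
          have h2 : Tendsto (fun n => ‖F n x - f x‖ₑ) atTop (𝓝 0) := by
            simpa using (hx.sub_const (f x)).enorm
          have h3 : Tendsto (fun n => ‖F n x - f x‖ₑ ^ q) atTop (𝓝 0) := by
            have := (ENNReal.continuous_rpow_const (y := q)).tendsto 0
            rw [ENNReal.zero_rpow_of_pos hq'] at this
            exact this.comp h2
          have h4 := ENNReal.Tendsto.sub (ENNReal.Tendsto.const_mul (h1.add_const (‖f x‖ₑ ^ q))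
            (Or.inr hc)) h3 (Or.inr ENNReal.zero_ne_top)
          rw [tsub_zero] at h4
          exact h4.liminf_eq.ge
      _ ≤ liminf (fun n => ∫⁻ x, c * (‖F n x‖ₑ ^ q + ‖f x‖ₑ ^ q) - ‖F n x - f x‖ₑ ^ q ∂μ)
            atTop := lintegral_liminf_le' fun n =>
              (((hFm n).add hfm).const_mul c).sub (hDm n)
      _ ≤ _ := by
          refine liminf_le_liminf (Eventually.of_forall fun n => ?_)
          rw [lintegral_sub' (hDm n) ((hEX n).trans_lt hX.lt_top).ne
            (Eventually.of_forall (hpt n))]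
          exact tsub_le_tsub_right (hsum n) _
  rw [ENNReal.liminf_const_sub _ _ hX] at hfatou
  rcases eq_or_ne X 0 with hX0 | hX0
  · have : E = fun _ => 0 := funext fun n => le_antisymm (hX0 ▸ hEX n) bot_le
    rw [this]
    exact tendsto_const_nhds
  · have hl : limsup E atTop = 0 := by
      by_contra hne
      exact absurd hfatou (not_le.2 (ENNReal.sub_lt_self hX hX0 hne))
    exact tendsto_of_le_liminf_of_limsup_le bot_le hl.le

end

/-! ### Functionals applied to series, and the transposed operator -/

theorem hasUnitRadius_of_summable {c : ℕ → ℂ} (hc : Summable fun n => ‖c n‖) : HasUnitRadius c :=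
  fun _ hx => hc.of_nonneg_of_le (fun n => mul_nonneg (norm_nonneg _) (pow_nonneg hx.1 n))
    fun _ => mul_le_of_le_one_right (norm_nonneg _) (pow_le_one₀ hx.1 hx.2.le)

theorem norm_powerSum_sub_sum_le {c : ℕ → ℂ} (hc : Summable fun n => ‖c n‖) (s : Finset ℕ) {z : ℂ}
    (hz : ‖z‖ < 1) :
    ‖powerSum c z - ∑ n ∈ s, c n * z ^ n‖ ≤ ∑' n, ‖c n‖ - ∑ n ∈ s, ‖c n‖ := by
  have h1 := (hasUnitRadius_of_summable hc).hasSum hz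
  have e1 := hc.sum_add_tsum_compl (s := s)
  have e2 := h1.summable.sum_add_tsum_compl (s := s)
  rw [← e1, powerSum, ← e2, add_sub_cancel_left, add_sub_cancel_left]
  refine tsum_of_norm_bounded (hc.subtype _).hasSum fun n => ?_
  simp only [Function.comp_apply]
  rw [norm_mul, norm_pow]
  exact mul_le_of_le_one_right (norm_nonneg _) (pow_le_one₀ (norm_nonneg _) hz.le)

section
variable {ω : ℝ → ℝ} (h : IsRadialWeight ω)
include h

theorem IsRadialWeight.lebesgueNorm_le_of_bound {u : ℂ → ℂ} {B : ℝ} (hB : 0 ≤ B)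
    (hu : ∀ z ∈ ball (0 : ℂ) 1, ‖u z‖ ≤ B) (q : ℝ) :
    lebesgueNorm ω q u ≤ B * lebesgueNorm ω q fun _ => 1 := by
  have := h.isFiniteMeasure_areaMeasure
  have h1 : eLpNorm u (ENNReal.ofReal q) (areaMeasure ω) ≤
      ENNReal.ofReal B * eLpNorm (fun _ => (1 : ℂ)) (ENNReal.ofReal q) (areaMeasure ω) := by
    refine eLpNorm_le_mul_eLpNorm_of_ae_le_mul ?_ _
    filter_upwards [ae_areaMeasure ω] with z hz
    simpa using hu z hz
  have h2 : eLpNorm (fun _ => (1 : ℂ)) (ENNReal.ofReal q) (areaMeasure ω) ≠ ⊤ :=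
    (memLp_const (1 : ℂ)).2.ne
  have h3 := ENNReal.toReal_mono (ENNReal.mul_ne_top ENNReal.ofReal_ne_top h2) h1
  rwa [ENNReal.toReal_mul, ENNReal.toReal_ofReal hB] at h3

theorem IsRadialWeight.powerSum_mem_bergmanSpace {c : ℕ → ℂ} (hc : Summable fun n => ‖c n‖)
    (q : ℝ) : powerSum c ∈ bergmanSpace ω q :=
  h.mem_bergmanSpace_of_bound (C := ∑' n, ‖c n‖) (hasUnitRadius_of_summable hc).isAnalytic
    (fun z hz => by simpa using norm_powerSum_sub_sum_le hc ∅ (mem_ball_zero_iff.1 hz)) q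

/-- Absolutely summable coefficients make the partial sums converge uniformly on the disc, hence in
norm because the measure is finite; a bounded functional may then be applied termwise. -/
theorem IsRadialWeight.hasSum_functional {q : ℝ} {L : bergmanSpace ω q →ₗ[ℂ] ℂ} {M : ℝ}
    (hL : IsFunctionalBound ω q L M) {c : ℕ → ℂ} (hc : Summable fun n => ‖c n‖) :
    HasSum (fun n => c n * L ⟨_, h.pow_mem_bergmanSpace n q⟩)
      (L ⟨_, h.powerSum_mem_bergmanSpace hc q⟩) := by
  rw [HasSum, tendsto_iff_norm_sub_tendsto_zero]
  set N := lebesgueNorm ω q fun _ => 1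
  have h1 : Tendsto (fun s : Finset ℕ => M * ((∑' n, ‖c n‖ - ∑ n ∈ s, ‖c n‖) * N))
      (SummationFilter.unconditional ℕ).filter (𝓝 0) := by
    have := ((hc.hasSum.const_sub (∑' n, ‖c n‖)).mul_const N).const_mul M
    simpa using this
  refine squeeze_zero (fun _ => norm_nonneg _) (fun s => ?_) h1
  have h2 : (∑ n ∈ s, c n * L ⟨_, h.pow_mem_bergmanSpace n q⟩) -
      L ⟨_, h.powerSum_mem_bergmanSpace hc q⟩ = -L (⟨_, h.powerSum_mem_bergmanSpace hc q⟩ -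
        ∑ n ∈ s, c n • ⟨_, h.pow_mem_bergmanSpace n q⟩) := by
    rw [map_sub, map_sum, neg_sub]
    simp_rw [map_smul, smul_eq_mul]
  rw [h2, norm_neg]
  refine (hL.2 _).trans (mul_le_mul_of_nonneg_left ?_ hL.1)
  refine h.lebesgueNorm_le_of_bound (sub_nonneg.2 (hc.sum_le_tsum s fun _ _ => norm_nonneg _))
    (fun z hz => ?_) q
  have h3 := norm_powerSum_sub_sum_le hc s (mem_ball_zero_iff.1 hz)
  simpa using h3

theorem IsFunctionalBound.norm_pow_le {q : ℝ} {L : bergmanSpace ω q →ₗ[ℂ] ℂ} {M : ℝ}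
    (hL : IsFunctionalBound ω q L M) (n : ℕ) :
    ‖L ⟨_, h.pow_mem_bergmanSpace n q⟩‖ ≤ M * lebesgueNorm ω q fun _ => 1 := by
  refine (hL.2 _).trans (mul_le_mul_of_nonneg_left ?_ hL.1)
  have := h.lebesgueNorm_le_of_bound (u := fun z => z ^ n) zero_le_one (fun z hz => by
    rw [norm_pow]
    exact pow_le_one₀ (norm_nonneg _) (mem_ball_zero_iff.1 hz).le) q
  rwa [one_mul] at this

end

section
variable {ω : ℝ → ℝ} (h : IsRadialWeight ω)
include h

theorem IsRadialWeight.integrable_of_ae_bound {φ : ℂ → ℂ}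
    (hφ : AEStronglyMeasurable φ (areaMeasure ω)) {B : ℝ}
    (hB : ∀ᵐ z ∂areaMeasure ω, ‖φ z‖ ≤ B) : Integrable φ (areaMeasure ω) :=
  have := h.isFiniteMeasure_areaMeasure
  .of_bound hφ B hB

omit h in
theorem ae_norm_mul_one_sub_pow_le {φ : ℂ → ℂ} {B : ℝ}
    (hB : ∀ᵐ z ∂areaMeasure ω, ‖φ z‖ ≤ B) (k : ℕ) :
    ∀ᵐ z ∂areaMeasure ω, ‖φ z * ((1 - ‖z‖ : ℝ) : ℂ) ^ k‖ ≤ B := by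
  filter_upwards [hB, ae_areaMeasure ω] with z hz hz1
  have h1 := mem_ball_zero_iff.1 hz1
  have h2 := norm_nonneg z
  rw [norm_mul, norm_pow, Complex.norm_real, Real.norm_of_nonneg (by linarith)]
  exact (mul_le_of_le_one_right (norm_nonneg _)
    (pow_le_one₀ (by linarith) (by linarith))).trans hz

/-- The two circle estimates trade places when the variables are interchanged, so the same Schur
test applies. -/
theorem IsRadialWeight.exists_lintegral_transpose_le (hD : IsDoubling ω) {q : ℝ} (hq : 1 < q)
    {k : ℕ} (hk : 1 ≤ k) : ∃ N : ℝ, 0 < N ∧ ∀ φ : ℂ → ℂ, AEStronglyMeasurable φ (areaMeasure ω) →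
      ∫⁻ ζ, (∫⁻ z, posKernel ω k z ζ * ‖φ z‖ₑ ∂areaMeasure ω) ^ q ∂areaMeasure ω ≤
        ENNReal.ofReal N ^ q * eLpNorm φ (ENNReal.ofReal q) (areaMeasure ω) ^ q := by
  obtain ⟨C, hC, hC1, hC2⟩ := h.exists_lintegral_posKernel_le hD hk
  obtain ⟨N, hN, hNK⟩ := h.exists_lintegral_rpow_le hq hC.le
  refine ⟨N, hN, fun φ hφ => ?_⟩
  obtain ⟨F, hF, hφF⟩ := hφ.enorm
  have hm : Measurable fun x : ℂ × ℂ => posKernel ω k x.2 x.1 := by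
    have := (h.measurable_posKernel k).comp (measurable_swap (α := ℂ) (β := ℂ))
    simpa only [Function.comp_def, Function.uncurry, Prod.fst_swap, Prod.snd_swap] using this
  have h1 := hNK (fun ζ z => posKernel ω k z ζ)
    (by simpa only [Function.uncurry_def] using hm) hC2 hC1 F hF
  rw [eLpNorm_ofReal_rpow (by linarith)]
  have e1 : ∀ ζ, ∫⁻ z, posKernel ω k z ζ * ‖φ z‖ₑ ∂areaMeasure ω =
      ∫⁻ z, posKernel ω k z ζ * F z ∂areaMeasure ω := fun ζ =>
    lintegral_congr_ae (by filter_upwards [hφF] with z hz; rw [hz])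
  have e2 : ∫⁻ z, ‖φ z‖ₑ ^ q ∂areaMeasure ω = ∫⁻ z, F z ^ q ∂areaMeasure ω :=
    lintegral_congr_ae (by filter_upwards [hφF] with z hz; rw [hz])
  simp_rw [e1, e2]
  exact h1

omit h in
theorem enorm_powerSum_kernelCoeff_mul_le {z ζ : ℂ} (hz : ‖z‖ < 1) (hζ : ‖ζ‖ < 1) (k : ℕ) (a : ℂ) :
    ‖a * ((1 - ‖z‖ : ℝ) : ℂ) ^ k * powerSum (kernelCoeff ω k) (ζ * conj z)‖ₑ =
      posKernel ω k z ζ * ‖a‖ₑ := by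
  have hlt : ‖z * conj ζ‖ < 1 := norm_mul_lt_one hz (by simpa using hζ.le)
  have e : ‖powerSum (kernelCoeff ω k) (ζ * conj z)‖ₑ =
      ‖powerSum (kernelCoeff ω k) (z * conj ζ)‖ₑ := by
    have : ζ * conj z = conj (z * conj ζ) := by simp [mul_comm]
    rw [this, powerSum_conj (conj_kernelCoeff ω k), ← ofReal_norm, ← ofReal_norm, RCLike.norm_conj]
  have e2 : ‖((1 - ‖z‖ : ℝ) : ℂ) ^ k‖ₑ = ENNReal.ofReal ((1 - ‖z‖) ^ k) := by
    rw [← ofReal_norm, norm_pow, Complex.norm_real, Real.norm_of_nonneg (by linarith)]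
  rw [posKernel, kernelFun_of_norm_lt hlt, enorm_mul, e, enorm_mul, e2]
  ring

/-- The quantity is $L$ evaluated at the dilate by $\rho$ of
$V(\zeta)=\zeta^k\int\varphi(z)(1-|z|)^k\sum_n a_n(\zeta\bar z)^n\,\omega\,dA$, with $a_n$ the
`kernelCoeff`. Dilation contracts and the transposed operator is bounded, which gives the estimate.
Taking $\rho<1$ makes the coefficients absolutely summable, and boundedness of `φ` makes every
integral finite without entering the constant. -/
theorem IsRadialWeight.exists_norm_integral_le (hD : IsDoubling ω) {q : ℝ} (hq : 1 < q) {k : ℕ}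
    (hk : 1 ≤ k) : ∃ C : ℝ, 0 < C ∧ ∀ φ : ℂ → ℂ, AEStronglyMeasurable φ (areaMeasure ω) →
      ∀ B : ℝ, (∀ᵐ z ∂areaMeasure ω, ‖φ z‖ ≤ B) →
      ∀ (L : bergmanSpace ω q →ₗ[ℂ] ℂ) (M : ℝ), IsFunctionalBound ω q L M →
      ∀ ρ ∈ Ioo (0 : ℝ) 1, ‖(ρ : ℂ) ^ k * ∫ z, φ z * ((1 - ‖z‖ : ℝ) : ℂ) ^ k *
        powerSum (fun n => kernelCoeff ω k n * L ⟨_, h.pow_mem_bergmanSpace (n + k) q⟩)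
          (ρ * conj z) ∂areaMeasure ω‖ ≤ M * (C * lebesgueNorm ω q φ) := by
  have := h.isFiniteMeasure_areaMeasure
  have hq0 : 0 < q := by linarith
  obtain ⟨N, hN, hNK⟩ := h.exists_lintegral_transpose_le hD hq hk
  refine ⟨N, hN, fun φ hφ B hB L M hL ρ hρ => ?_⟩
  set ℓ : ℕ → ℂ := fun n => L ⟨_, h.pow_mem_bergmanSpace n q⟩
  set Φ : ℂ → ℂ := fun z => φ z * ((1 - ‖z‖ : ℝ) : ℂ) ^ k
  have hΦi : Integrable Φ (areaMeasure ω) := h.integrable_of_ae_bound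
    (hφ.mul (Continuous.aestronglyMeasurable (by fun_prop))) (ae_norm_mul_one_sub_pow_le hB k)
  have hkc := h.hasUnitRadius_kernelCoeff k
  have hρ1 : ‖(ρ : ℂ)‖ < 1 := by simpa [abs_of_pos hρ.1] using hρ.2
  have hφL : MemLp φ (ENNReal.ofReal q) (areaMeasure ω) := .of_bound hφ B hB
  set m : ℕ → ℂ := fun n => ∫ ζ, Φ ζ * conj ζ ^ n ∂areaMeasure ω
  set c : ℕ → ℂ := fun n => kernelCoeff ω k n * ℓ (n + k)
  have hc : HasUnitRadius c := by
    refine hkc.of_norm_le (C := M * lebesgueNorm ω q fun _ => 1) fun n => ?_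
    rw [norm_mul, mul_comm]
    exact mul_le_mul_of_nonneg_right (hL.norm_pow_le h _) (norm_nonneg _)
  have hm : HasUnitRadius fun n => kernelCoeff ω k n * m n := by
    refine hkc.of_norm_le (C := ∫ z, ‖Φ z‖ ∂areaMeasure ω) fun n => ?_
    rw [norm_mul, mul_comm]
    exact mul_le_mul_of_nonneg_right (norm_integral_mul_conj_pow_le hΦi n) (norm_nonneg _)
  have hint := integral_mul_powerSum hΦi (ae_areaMeasure ω) hc hρ1
  set V : ℂ → ℂ := fun z => z ^ k * powerSum (fun n => kernelCoeff ω k n * m n) z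
  have hVa : IsAnalytic V := (differentiableOn_id.pow k).mul hm.isAnalytic
  -- Coefficients of $V(\rho\,\cdot)$; the shift by `k` comes from the factor $\zeta^k$ and matches
  -- $L(z^{n+k})$ in the integral.
  set s : ℕ → ℂ := fun j => if k ≤ j then kernelCoeff ω k (j - k) * m (j - k) * (ρ : ℂ) ^ j else 0
  have hsk : ∀ n, s (n + k) = kernelCoeff ω k n * m n * (ρ : ℂ) ^ (n + k) := fun n => by simp [s]
  have hs0 : ∀ n < k, s n = 0 := fun n hn => by simp [s, not_le.2 hn]
  have hs : Summable fun n => ‖s n‖ := by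
    rw [← summable_nat_add_iff k]
    simp_rw [hsk, pow_add, ← mul_assoc]
    simpa using (hm.summable_norm hρ1).mul_right ‖(ρ : ℂ) ^ k‖
  have hsV : EqOn (powerSum s) (fun z => V (ρ * z)) (ball 0 1) := fun z hz => by
    have hz1 := mem_ball_zero_iff.1 hz
    have h1 := (hasUnitRadius_of_summable hs).hasSum hz1
    rw [← hasSum_nat_add_iff' k, Finset.sum_eq_zero fun i hi => by
      rw [hs0 i (Finset.mem_range.1 hi), zero_mul], sub_zero] at h1
    have h2 := (hm.hasSum (norm_mul_lt_one hρ1 hz1.le)).mul_left ((ρ * z) ^ k)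
    have e : (fun n => s (n + k) * z ^ (n + k)) = fun n =>
        (ρ * z) ^ k * (kernelCoeff ω k n * m n * (ρ * z) ^ n) := funext fun n => by
      rw [hsk]
      ring
    rw [e] at h1
    exact h1.unique h2
  have hLs : (ρ : ℂ) ^ k * ∫ z, Φ z * powerSum c (ρ * conj z) ∂areaMeasure ω =
      L ⟨_, h.powerSum_mem_bergmanSpace hs q⟩ := by
    have h1 := h.hasSum_functional hL hs
    rw [← hasSum_nat_add_iff' k, Finset.sum_eq_zero fun i hi => by
      rw [hs0 i (Finset.mem_range.1 hi), zero_mul], sub_zero] at h1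
    have h2 := hint.mul_left ((ρ : ℂ) ^ k)
    have e : (fun n => s (n + k) * ℓ (n + k)) = fun n =>
        (ρ : ℂ) ^ k * (c n * (ρ : ℂ) ^ n * m n) := funext fun n => by
      rw [hsk]
      ring
    change HasSum (fun n => s (n + k) * ℓ (n + k)) _ at h1
    rw [e] at h1
    exact h2.unique h1
  change ‖(ρ : ℂ) ^ k * ∫ z, Φ z * powerSum c (ρ * conj z) ∂areaMeasure ω‖ ≤ _
  rw [hLs]
  refine (hL.2 _).trans (mul_le_mul_of_nonneg_left ?_ hL.1)
  have hV : ∫⁻ z, ‖V z‖ₑ ^ q ∂areaMeasure ω ≤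
      ENNReal.ofReal N ^ q * eLpNorm φ (ENNReal.ofReal q) (areaMeasure ω) ^ q := by
    refine le_trans (lintegral_mono_ae ?_) (hNK φ hφ)
    filter_upwards [ae_areaMeasure ω] with ζ hζ
    gcongr 1
    have hζ1 := mem_ball_zero_iff.1 hζ
    have h1 : powerSum (fun n => kernelCoeff ω k n * m n) ζ =
        ∫ z, Φ z * powerSum (kernelCoeff ω k) (ζ * conj z) ∂areaMeasure ω := by
      rw [← (integral_mul_powerSum hΦi (ae_areaMeasure ω) hkc hζ1).tsum_eq, powerSum]
      refine tsum_congr fun n => ?_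
      simp only [m]
      ring
    have h2 : ‖ζ ^ k‖ₑ ≤ 1 := by
      rw [← ofReal_norm, norm_pow]
      exact ENNReal.ofReal_le_one.2 (pow_le_one₀ (norm_nonneg _) hζ1.le)
    calc ‖V ζ‖ₑ ≤ 1 * ‖powerSum (fun n => kernelCoeff ω k n * m n) ζ‖ₑ := by
          simp only [V, enorm_mul]
          gcongr
      _ ≤ ∫⁻ z, ‖Φ z * powerSum (kernelCoeff ω k) (ζ * conj z)‖ₑ ∂areaMeasure ω := by
          rw [one_mul, h1]
          exact enorm_integral_le_lintegral_enorm _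
      _ = _ := by
          refine lintegral_congr_ae ?_
          filter_upwards [ae_areaMeasure ω] with z hz
          exact enorm_powerSum_kernelCoeff_mul_le (mem_ball_zero_iff.1 hz) hζ1 k _
  have hfin : eLpNorm (powerSum s) (ENNReal.ofReal q) (areaMeasure ω) ≤
      ENNReal.ofReal N * eLpNorm φ (ENNReal.ofReal q) (areaMeasure ω) := by
    rw [← ENNReal.rpow_le_rpow_iff hq0, ENNReal.mul_rpow_of_nonneg _ _ hq0.le,
      eLpNorm_ofReal_rpow hq0]
    refine le_trans ?_ ((h.lintegral_dilation_le hVa hq.le hρ).trans hV)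
    refine lintegral_mono_ae ?_
    filter_upwards [ae_areaMeasure ω] with z hz
    rw [hsV hz]
  have := ENNReal.toReal_mono (ENNReal.mul_ne_top ENNReal.ofReal_ne_top hφL.2.ne) hfin
  rwa [ENNReal.toReal_mul, ENNReal.toReal_ofReal hN.le] at this

end

/-! ### Representation of functionals for doubling weights -/

/-- The norm of a bounded function in `L^p` by duality with bounded functions. -/
theorem eLpNorm_le_of_forall_integral_le {μ : Measure ℂ} [IsFiniteMeasure μ] {p q : ℝ}
    (hpq : p.HolderConjugate q) {u : ℂ → ℂ} (hu : AEStronglyMeasurable u μ) {B : ℝ}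
    (hB : ∀ᵐ z ∂μ, ‖u z‖ ≤ B) {A : ℝ} (hA : 0 ≤ A)
    (hle : ∀ φ : ℂ → ℂ, AEStronglyMeasurable φ μ → ∀ B' : ℝ, (∀ᵐ z ∂μ, ‖φ z‖ ≤ B') →
      ‖∫ z, φ z * conj (u z) ∂μ‖ ≤ A * (eLpNorm φ (ENNReal.ofReal q) μ).toReal) :
    eLpNorm u (ENNReal.ofReal p) μ ≤ ENNReal.ofReal A := by
  have hp := hpq.lt
  have hp0 := hpq.pos
  have hp1 : 0 < p - 1 := by linarith
  have huL : MemLp u (ENNReal.ofReal p) μ := .of_bound hu B hB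
  set N := (eLpNorm u (ENNReal.ofReal p) μ).toReal
  have hN0 : 0 ≤ N := ENNReal.toReal_nonneg
  -- The extremal function in Hölder's inequality: $\varphi\bar u=|u|^p$ and $|\varphi|^q=|u|^p$. At
  -- zeros of `u` the second factor vanishes, whatever value the negative power takes.
  set φ : ℂ → ℂ := fun z => ((‖u z‖ ^ (p - 2) : ℝ) : ℂ) * u z
  have hφ : AEStronglyMeasurable φ μ := by
    have h1 : AEMeasurable (fun z => ‖u z‖ ^ (p - 2)) μ := hu.norm.aemeasurable.pow_const _
    exact (Complex.measurable_ofReal.comp_aemeasurable h1).aestronglyMeasurable.mul hu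
  have hφn : ∀ z, ‖φ z‖ = ‖u z‖ ^ (p - 1) := fun z => by
    simp only [φ, norm_mul, Complex.norm_real]
    rw [Real.norm_of_nonneg (by positivity)]
    rcases (norm_nonneg (u z)).eq_or_lt with h0 | h0
    · rw [← h0, Real.zero_rpow hp1.ne', mul_zero]
    · rw [← Real.rpow_add_one h0.ne']
      congr 1
      ring
  have hφu : ∀ z, φ z * conj (u z) = ((‖u z‖ ^ p : ℝ) : ℂ) := fun z => by
    simp only [φ]
    rw [mul_assoc, Complex.mul_conj, Complex.normSq_eq_norm_sq, ← Complex.ofReal_mul]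
    congr 1
    rcases (norm_nonneg (u z)).eq_or_lt with h0 | h0
    · rw [← h0, Real.zero_rpow hp0.ne']
      simp
    · rw [← Real.rpow_natCast, ← Real.rpow_add h0]
      congr 1
      push_cast
      ring
  have hφB : ∀ᵐ z ∂μ, ‖φ z‖ ≤ B ^ (p - 1) := by
    filter_upwards [hB] with z hz
    rw [hφn]
    gcongr
  have hφN : (eLpNorm φ (ENNReal.ofReal q) μ).toReal = N ^ (p - 1) := by
    have e1 : eLpNorm φ (ENNReal.ofReal q) μ =
        eLpNorm (fun z => ‖u z‖ ^ (p - 1)) (ENNReal.ofReal q) μ :=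
      eLpNorm_congr_norm_ae (Eventually.of_forall fun z => by
        rw [hφn, Real.norm_of_nonneg (by positivity)])
    rw [e1, eLpNorm_norm_rpow _ hp1, ← ENNReal.ofReal_mul hpq.symm.nonneg,
      show q * (p - 1) = p by rw [mul_comm]; exact hpq.sub_one_mul_conj, ENNReal.toReal_rpow]
  have hX : ∫ z, φ z * conj (u z) ∂μ = ((N ^ p : ℝ) : ℂ) := by
    simp_rw [hφu]
    rw [integral_complex_ofReal]
    congr 1
    rw [integral_eq_lintegral_of_nonneg_ae (Eventually.of_forall fun z => by positivity)
      (hu.norm.aemeasurable.pow_const _).aestronglyMeasurable, ENNReal.toReal_rpow,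
      eLpNorm_ofReal_rpow hp0]
    congr 1
    refine lintegral_congr fun z => ?_
    rw [← ENNReal.ofReal_rpow_of_nonneg (norm_nonneg _) hp0.le, ofReal_norm]
  have key := hle φ hφ _ hφB
  rw [hX, hφN, Complex.norm_real, Real.norm_of_nonneg (by positivity)] at key
  rw [← ENNReal.ofReal_toReal huL.2.ne]
  refine ENNReal.ofReal_le_ofReal ?_
  change N ≤ A
  rcases hN0.eq_or_lt with h0 | h0
  · rw [← h0]; exact hA
  · have h1 : N ^ p = N * N ^ (p - 1) := by
      rw [Real.rpow_sub_one h0.ne']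
      field_simp
    rw [h1] at key
    exact le_of_mul_le_mul_right key (by positivity)

/-- The coefficients of the function representing `L`. -/
def representerCoeff {ω : ℝ → ℝ} (h : IsRadialWeight ω) {q : ℝ} (L : bergmanSpace ω q →ₗ[ℂ] ℂ)
    (n : ℕ) : ℂ :=
  conj (L ⟨_, h.pow_mem_bergmanSpace n q⟩) * invMoment ω n

section
variable {ω : ℝ → ℝ} (h : IsRadialWeight ω)
include h

theorem IsFunctionalBound.norm_representerCoeff_le {q : ℝ} {L : bergmanSpace ω q →ₗ[ℂ] ℂ} {M : ℝ}
    (hL : IsFunctionalBound ω q L M) (n : ℕ) :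
    ‖representerCoeff h L n‖ ≤ (M * lebesgueNorm ω q fun _ => 1) * ‖invMoment ω n‖ := by
  rw [representerCoeff, norm_mul, RCLike.norm_conj]
  exact mul_le_mul_of_nonneg_right (hL.norm_pow_le h n) (norm_nonneg _)

theorem IsFunctionalBound.hasUnitRadius_representerCoeff {q : ℝ} {L : bergmanSpace ω q →ₗ[ℂ] ℂ}
    {M : ℝ} (hL : IsFunctionalBound ω q L M) : HasUnitRadius (representerCoeff h L) :=
  h.hasUnitRadius_invMoment.of_norm_le (hL.norm_representerCoeff_le h)

theorem conj_powerSum_representerCoeff {q : ℝ} (L : bergmanSpace ω q →ₗ[ℂ] ℂ) (k : ℕ) (w : ℂ) :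
    conj (powerSum (derivCoeff^[k] (representerCoeff h L)) w) =
      powerSum (fun n => kernelCoeff ω k n * L ⟨_, h.pow_mem_bergmanSpace (n + k) q⟩)
        (conj w) := by
  rw [powerSum, powerSum, Complex.conj_tsum]
  refine tsum_congr fun n => ?_
  rw [iterate_derivCoeff_apply, kernelCoeff, iterate_derivCoeff_apply, representerCoeff]
  simp only [map_mul, map_pow, Complex.conj_conj, conj_invMoment, map_natCast]
  ring

omit h in
theorem exists_tendsto_one : ∃ r : ℕ → ℝ, (∀ n, r n ∈ Ioo (0 : ℝ) 1) ∧ Tendsto r atTop (𝓝 1) := by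
  obtain ⟨r, -, hr, hr1⟩ := exists_seq_strictMono_tendsto' (zero_lt_one (α := ℝ))
  exact ⟨r, hr, hr1⟩

/-- Dilating the derivative makes it bounded, so its norm may be tested against bounded functions;
conjugating the coefficients turns the test integral into the one of `exists_norm_integral_le`. The
bound is uniform in $\rho$, and Fatou passes to $\rho\to1$. -/
theorem IsRadialWeight.exists_eLpNorm_representer_le (hD : IsDoubling ω) {p : ℝ} (hp : 1 < p)
    {k : ℕ} (hk : 1 ≤ k) : ∃ C : ℝ, 0 < C ∧
      ∀ (L : bergmanSpace ω (Real.conjExponent p) →ₗ[ℂ] ℂ) (M : ℝ),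
      IsFunctionalBound ω (Real.conjExponent p) L M →
      eLpNorm (fun z => ((1 - ‖z‖ : ℝ) : ℂ) ^ k *
        powerSum (derivCoeff^[k] (representerCoeff h L)) z) (ENNReal.ofReal p) (areaMeasure ω) ≤
      ENNReal.ofReal (C * M) := by
  have := h.isFiniteMeasure_areaMeasure
  have hpq : p.HolderConjugate (Real.conjExponent p) := Real.HolderConjugate.conjExponent hp
  obtain ⟨C, hC, hCL⟩ := h.exists_norm_integral_le hD hpq.symm.lt hk
  refine ⟨C, hC, fun L M hL => ?_⟩
  have hd := (hL.hasUnitRadius_representerCoeff h).iterate_derivCoeff k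
  set D := derivCoeff^[k] (representerCoeff h L)
  have hw : Continuous fun z : ℂ => ((1 - ‖z‖ : ℝ) : ℂ) ^ k := by fun_prop
  have hbound : ∀ ρ ∈ Ioo (0 : ℝ) 1, eLpNorm (fun z => ((1 - ‖z‖ : ℝ) : ℂ) ^ k *
      ((ρ : ℂ) ^ k * powerSum D (ρ * z))) (ENNReal.ofReal p) (areaMeasure ω) ≤
      ENNReal.ofReal (C * M) := by
    intro ρ hρ
    have hB : ∀ᵐ z ∂areaMeasure ω, ‖(ρ : ℂ) ^ k * powerSum D (ρ * z)‖ ≤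
        ∑' n, ‖D n‖ * ρ ^ n := by
      filter_upwards [ae_areaMeasure ω] with z hz
      have h1 : ‖(ρ : ℂ) ^ k‖ ≤ 1 := by
        rw [norm_pow, Complex.norm_real, Real.norm_of_nonneg hρ.1.le]
        exact pow_le_one₀ hρ.1.le hρ.2.le
      rw [norm_mul]
      refine (mul_le_of_le_one_left (norm_nonneg _) h1).trans
        (hd.norm_powerSum_le (Ioo_subset_Ico_self hρ) ?_)
      rw [norm_mul, Complex.norm_real, Real.norm_of_nonneg hρ.1.le]
      exact mul_le_of_le_one_right hρ.1.le (mem_ball_zero_iff.1 hz).le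
    have hm : AEStronglyMeasurable (fun z => (ρ : ℂ) ^ k * powerSum D (ρ * z))
        (areaMeasure ω) := ((hd.isAnalytic.dilation hρ).aestronglyMeasurable).const_mul _
    have hB' : ∀ᵐ z ∂areaMeasure ω, ‖((1 - ‖z‖ : ℝ) : ℂ) ^ k *
        ((ρ : ℂ) ^ k * powerSum D (ρ * z))‖ ≤ ∑' n, ‖D n‖ * ρ ^ n := by
      filter_upwards [ae_norm_mul_one_sub_pow_le hB k] with z hz
      rwa [mul_comm]
    refine eLpNorm_le_of_forall_integral_le hpq (hw.aestronglyMeasurable.mul hm) hB'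
      (mul_nonneg hC.le hL.1) fun φ hφ B' hφB => ?_
    have h1 := hCL φ hφ B' hφB L M hL ρ hρ
    rw [← integral_const_mul] at h1
    have h2 : ∀ z, φ z * conj (((1 - ‖z‖ : ℝ) : ℂ) ^ k * ((ρ : ℂ) ^ k * powerSum D (ρ * z))) =
        (ρ : ℂ) ^ k * (φ z * ((1 - ‖z‖ : ℝ) : ℂ) ^ k *
          powerSum (fun n => kernelCoeff ω k n *
            L ⟨_, h.pow_mem_bergmanSpace (n + k) (Real.conjExponent p)⟩) (ρ * conj z)) := by
      intro z
      rw [map_mul, map_mul, conj_powerSum_representerCoeff]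
      simp only [map_mul, map_pow, Complex.conj_ofReal]
      ring
    refine (le_of_eq (congrArg norm (integral_congr_ae (Eventually.of_forall h2)))).trans
      (h1.trans (le_of_eq ?_))
    rw [lebesgueNorm]
    ring
  obtain ⟨r, hr, hr1⟩ := exists_tendsto_one
  have hr1' : Tendsto (fun n => (r n : ℂ)) atTop (𝓝 1) := by
    simpa [Function.comp_def] using (Complex.continuous_ofReal.tendsto 1).comp hr1
  have hm : ∀ n, AEStronglyMeasurable (fun z => ((1 - ‖z‖ : ℝ) : ℂ) ^ k *
      ((r n : ℂ) ^ k * powerSum D (r n * z))) (areaMeasure ω) := fun n =>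
    hw.aestronglyMeasurable.mul
      (((hd.isAnalytic.dilation (hr n)).aestronglyMeasurable).const_mul _)
  refine (Lp.eLpNorm_lim_le_liminf_eLpNorm hm _ ?_).trans
    (liminf_le_of_le (by isBoundedDefault) fun b hb => ?_)
  · filter_upwards [ae_areaMeasure ω] with z hz
    have h1 : Tendsto (fun n => (r n : ℂ) * z) atTop (𝓝 z) := by
      simpa using hr1'.mul_const z
    have h2 : Tendsto (fun n => powerSum D (r n * z)) atTop (𝓝 (powerSum D z)) :=
      (hd.continuousOn.continuousAt (isOpen_ball.mem_nhds hz)).tendsto.comp h1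
    simpa using ((hr1'.pow k).mul h2).const_mul (((1 - ‖z‖ : ℝ) : ℂ) ^ k)
  · obtain ⟨n, hn⟩ := hb.exists
    exact hn.trans (hbound _ (hr n))

end

/-- The infimum is itself admissible. For functions of norm zero one divides by nothing: any
admissible constant already forces the value 0. -/
theorem IsBoundedFunctional.isFunctionalBound {ω : ℝ → ℝ} {q : ℝ}
    {L : bergmanSpace ω q →ₗ[ℂ] ℂ} (hL : IsBoundedFunctional ω q L) :
    IsFunctionalBound ω q L (functionalNorm ω q L) := by
  refine ⟨le_csInf hL fun _ hM => hM.1, fun f => ?_⟩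
  have h0 : 0 ≤ lebesgueNorm ω q (f : ℂ → ℂ) := ENNReal.toReal_nonneg
  rcases h0.eq_or_lt with h1 | h1
  · obtain ⟨M, hM⟩ := hL
    have := hM.2 f
    rw [← h1, mul_zero] at this ⊢
    exact this
  · rw [← div_le_iff₀ h1]
    exact le_csInf hL fun M hM => (div_le_iff₀ h1).2 (hM.2 f)

section
variable {ω : ℝ → ℝ} (h : IsRadialWeight ω)
include h

theorem IsRadialWeight.tendsto_lebesgueNorm_dilation_sub {q : ℝ} (hq : 1 < q) {f : ℂ → ℂ}
    (hf : f ∈ bergmanSpace ω q) :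
    Tendsto (fun r : ℝ => lebesgueNorm ω q fun z => f (r * z) - f z) (𝓝[<] 1) (𝓝 0) := by
  have hq0 : 0 < q := by linarith
  have hfin : ∫⁻ z, ‖f z‖ₑ ^ q ∂areaMeasure ω ≠ ⊤ := by
    rw [← eLpNorm_ofReal_rpow hq0]
    exact ENNReal.rpow_ne_top_of_nonneg hq0.le hf.2.2.ne
  refine tendsto_of_seq_tendsto fun x hx => ?_
  -- Dropping finitely many terms puts the whole sequence in $(0,1)$, where dilations are defined
  -- and contract.
  obtain ⟨N, hN⟩ := eventually_atTop.1 (hx.eventually (Ioo_mem_nhdsLT zero_lt_one))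
  rw [← tendsto_add_atTop_iff_nat N]
  have hx1 : Tendsto (fun n => (x (n + N) : ℂ)) atTop (𝓝 1) := by
    have h1 := (hx.mono_right nhdsWithin_le_nhds).comp (tendsto_add_atTop_nat N)
    simpa [Function.comp_def] using (Complex.continuous_ofReal.tendsto 1).comp h1
  have hxN : ∀ n, x (n + N) ∈ Ioo (0 : ℝ) 1 := fun n => hN _ (Nat.le_add_left _ _)
  have h1 := tendsto_lintegral_rpow_sub (μ := areaMeasure ω) hq0
    (F := fun n z => f (x (n + N) * z)) hf.1.aestronglyMeasurable
    (fun n => (hf.1.dilation (hxN n)).aestronglyMeasurable) hfin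
    (fun n => h.lintegral_dilation_le hf.1 hq.le (hxN n)) (by
      filter_upwards [ae_areaMeasure ω] with z hz
      have h2 : Tendsto (fun n => (x (n + N) : ℂ) * z) atTop (𝓝 z) := by
        simpa using hx1.mul_const z
      exact ((DifferentiableOn.continuousOn hf.1).continuousAt
        (isOpen_ball.mem_nhds hz)).tendsto.comp h2)
  have h2 : Tendsto (fun n => ((∫⁻ z, ‖f (x (n + N) * z) - f z‖ₑ ^ q ∂areaMeasure ω) ^
      (1 / q)).toReal) atTop (𝓝 ((0 : ℝ≥0∞) ^ (1 / q)).toReal) := by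
    refine (ENNReal.tendsto_toReal ?_).comp ((ENNReal.continuous_rpow_const.tendsto _).comp h1)
    rw [ENNReal.zero_rpow_of_pos (by positivity)]
    exact ENNReal.zero_ne_top
  rw [ENNReal.zero_rpow_of_pos (by positivity), ENNReal.toReal_zero] at h2
  refine h2.congr fun n => ?_
  simp only [Function.comp_apply, lebesgueNorm]
  rw [eLpNorm_eq_lintegral_rpow_enorm_toReal (by simpa using hq0)
    ENNReal.ofReal_ne_top, ENNReal.toReal_ofReal hq0.le]

/-- For fixed $r$ the coefficients of $f_r$ are absolutely summable, while $\bar g_nW_n=L(z^n)$ is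
bounded and partial moments do not exceed moments. Dominated convergence in $\rho$ gives $L(f_r)$,
and $f_r\to f$ in norm gives $L(f)$. Doubling plays no role here, only in the norm of $g$. -/
theorem IsFunctionalBound.represents {q : ℝ} (hq : 1 < q) {L : bergmanSpace ω q →ₗ[ℂ] ℂ} {M : ℝ}
    (hL : IsFunctionalBound ω q L M) : Represents ω q L (powerSum (representerCoeff h L)) := by
  intro f
  have hfa : IsAnalytic (f : ℂ → ℂ) := f.2.1
  have hd := hL.hasUnitRadius_representerCoeff h
  have hc := hfa.hasUnitRadius
  set c := taylorCoeff (f : ℂ → ℂ)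
  set ℓ : ℕ → ℂ := fun n => L ⟨_, h.pow_mem_bergmanSpace n q⟩
  have hsum : ∀ r ∈ Ioo (0 : ℝ) 1, Summable fun n => ‖c n * (r : ℂ) ^ n‖ := fun r hr =>
    hc.summable_norm (by simpa [abs_of_pos hr.1] using hr.2)
  have hdil : ∀ r ∈ Ioo (0 : ℝ) 1, EqOn (fun z => (f : ℂ → ℂ) (r * z))
      (powerSum fun n => c n * (r : ℂ) ^ n) (ball 0 1) := fun r hr z hz => by
    simp only
    rw [hfa.eqOn_powerSum (mem_ball_zero_iff.2 (norm_ofReal_mul_lt hr (mem_ball_zero_iff.1 hz))),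
      powerSum, powerSum]
    refine tsum_congr fun n => ?_
    rw [mul_pow, mul_assoc]
  refine ⟨fun r => ∑' n, c n * (r : ℂ) ^ n * ℓ n, fun r hr => ?_, ?_⟩
  · have hℓ : ∀ n, conj (representerCoeff h L n) * moment ω n = ℓ n := fun n => by
      rw [representerCoeff, map_mul, Complex.conj_conj, conj_invMoment, mul_assoc,
        h.invMoment_mul_moment, mul_one]
    have hu := hasUnitRadius_of_summable (hsum r hr)
    have h1 : Tendsto (fun ρ => ∑' n, c n * (r : ℂ) ^ n * conj (representerCoeff h L n) *
        partialMoment ω ρ n) (𝓝[<] 1) (𝓝 (∑' n, c n * (r : ℂ) ^ n * ℓ n)) := by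
      refine tendsto_tsum_of_dominated_convergence
        (bound := fun n => ‖c n * (r : ℂ) ^ n‖ * (M * lebesgueNorm ω q fun _ => 1))
        ((hsum r hr).mul_right _) (fun n => ?_) (Eventually.of_forall fun ρ n => ?_)
      · rw [← hℓ n, ← mul_assoc]
        exact ((Complex.continuous_ofReal.tendsto _).comp
          (h.tendsto_partialMoment n)).const_mul _
      · have h2 : ‖conj (representerCoeff h L n)‖ * moment ω n ≤
            M * lebesgueNorm ω q fun _ => 1 := by
          have h3 := hL.norm_pow_le h n
          change ‖ℓ n‖ ≤ _ at h3
          rwa [← hℓ n, norm_mul, Complex.norm_real, Real.norm_of_nonneg (h.moment_pos n).le] at h3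
        rw [mul_assoc, norm_mul, norm_mul (conj _), Complex.norm_real,
          Real.norm_of_nonneg (partialMoment_nonneg ω ρ n)]
        refine mul_le_mul_of_nonneg_left (le_trans ?_ h2) (norm_nonneg _)
        exact mul_le_mul_of_nonneg_left (h.partialMoment_le ρ n) (norm_nonneg _)
    refine h1.congr' ?_
    filter_upwards [Ioo_mem_nhdsLT zero_lt_one] with ρ hρ
    rw [(h.hasSum_setIntegral_mul_conj hu hd hρ).tsum_eq]
    refine setIntegral_congr_fun measurableSet_ball fun z hz => ?_
    rw [← hdil r hr (ball_subset_ball hρ.2.le hz)]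
  · rw [tendsto_iff_norm_sub_tendsto_zero]
    have h1 := (h.tendsto_lebesgueNorm_dilation_sub hq f.2).const_mul M
    rw [mul_zero] at h1
    refine squeeze_zero' (Eventually.of_forall fun _ => norm_nonneg _) ?_ h1
    filter_upwards [Ioo_mem_nhdsLT zero_lt_one] with r hr
    have h2 := (h.hasSum_functional hL (hsum r hr)).tsum_eq
    change ∑' n, c n * (r : ℂ) ^ n * ℓ n = _ at h2
    rw [h2, ← map_sub]
    refine (hL.2 _).trans (le_of_eq ?_)
    congr 1
    refine lebesgueNorm_congr fun z hz => ?_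
    have h3 := hdil r hr hz
    simp only at h3
    rw [h3]
    rfl

theorem IsRadialWeight.dualEmbedded_of_isDoubling (hD : IsDoubling ω) {p : ℝ} (hp : 1 < p)
    {k : ℕ} (hk : 1 ≤ k) : DualEmbedded ω p k := by
  have hp0 : 0 < p := by linarith
  have hpq : p.HolderConjugate (Real.conjExponent p) := Real.HolderConjugate.conjExponent hp
  obtain ⟨C, hC, hCL⟩ := h.exists_eLpNorm_representer_le hD hp hk
  set N := lebesgueNorm ω (Real.conjExponent p) fun _ => 1
  have hN : 0 ≤ N := ENNReal.toReal_nonneg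
  refine ⟨C + ∑ j ∈ Finset.range (k + 1), j.factorial * (N * ‖invMoment ω j‖), by positivity,
    fun L hLb => ?_⟩
  have hL := hLb.isFunctionalBound
  set M := functionalNorm ω (Real.conjExponent p) L
  have hd := hL.hasUnitRadius_representerCoeff h
  have hE := hd.iteratedDeriv_powerSum k
  have hle : ∫⁻ z, (ENNReal.ofReal ((1 - ‖z‖) ^ k) *
      ‖iteratedDeriv k (powerSum (representerCoeff h L)) z‖ₑ) ^ p ∂areaMeasure ω ≤
      ENNReal.ofReal (C * M) ^ p := by
    refine le_trans (le_of_eq ?_) (ENNReal.rpow_le_rpow (hCL L M hL) hp0.le)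
    rw [eLpNorm_ofReal_rpow hp0]
    refine lintegral_congr_ae ?_
    filter_upwards [ae_areaMeasure ω] with z hz
    have h1 : 0 ≤ 1 - ‖z‖ := by linarith [mem_ball_zero_iff.1 hz]
    rw [hE hz, enorm_mul, ← ofReal_norm (((1 - ‖z‖ : ℝ) : ℂ) ^ k), norm_pow, Complex.norm_real,
      Real.norm_of_nonneg h1]
  obtain ⟨m1, m2⟩ := h.memLebesgue_bracketWeight hp ((hd.iterate_derivCoeff k).isAnalytic.congr hE)
    (mul_nonneg hC.le hL.1) hle
  refine ⟨powerSum (representerCoeff h L), ⟨hd.isAnalytic, m1⟩, hL.represents h hpq.symm.lt, ?_,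
    fun g' hg' hg'L => ?_⟩
  · rw [dirichletNorm, add_mul, Finset.sum_mul]
    refine add_le_add m2 (Finset.sum_le_sum fun j _ => ?_)
    rw [iteratedDeriv_zero_eq, hd.taylorCoeff_powerSum, norm_mul, Complex.norm_natCast, mul_assoc]
    refine mul_le_mul_of_nonneg_left ?_ (Nat.cast_nonneg _)
    refine (hL.norm_representerCoeff_le h j).trans (le_of_eq ?_)
    ring
  · refine hg'.1.eqOn_of_taylorCoeff_eq hd.isAnalytic (funext fun n => ?_)
    rw [h.taylorCoeff_of_represents hg'.1 hg'L, hd.taylorCoeff_powerSum, representerCoeff]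

end

/-! ### From the identity to doubling: tests on monomials -/

/-- The moments of the radial measure of order `p * n`. -/
def rpowMoment (ω : ℝ → ℝ) (p : ℝ) (n : ℕ) : ℝ := ∫ r, (r ^ p) ^ n ∂radialMeasure ω

section
variable {ω : ℝ → ℝ} (h : IsRadialWeight ω)
include h

theorem IsRadialWeight.lintegral_norm {g : ℝ → ℝ} (hg : Measurable g)
    (hg0 : ∀ r ∈ Ioo (0 : ℝ) 1, 0 ≤ g r) {C : ℝ} (hC : ∀ r ∈ Ioo (0 : ℝ) 1, g r ≤ C) :
    ∫⁻ z, ENNReal.ofReal (g ‖z‖) ∂areaMeasure ω = ENNReal.ofReal (∫ r, g r ∂radialMeasure ω) := by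
  rw [h.lintegral_areaMeasure (by fun_prop), ofReal_integral_eq_lintegral_ofReal
    (h.integrable_of_bound hg fun r hr => (abs_of_nonneg (hg0 r hr)).trans_le (hC r hr))
    (by filter_upwards [ae_radialMeasure ω] with r hr using hg0 r hr)]
  refine lintegral_congr_ae ?_
  filter_upwards [ae_radialMeasure ω] with r hr
  simp [norm_polarMap, abs_of_pos hr.1]

omit h in
theorem rpow_pow_le_one {p : ℝ} (hp : 0 ≤ p) {r : ℝ} (hr : r ∈ Ioo (0 : ℝ) 1) (n : ℕ) :
    (r ^ p) ^ n ≤ 1 :=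
  pow_le_one₀ (Real.rpow_nonneg hr.1.le _) (Real.rpow_le_one hr.1.le hr.2.le hp)

theorem IsRadialWeight.integrable_rpow_pow {p : ℝ} (hp : 0 ≤ p) (n : ℕ) :
    Integrable (fun r => (r ^ p) ^ n) (radialMeasure ω) :=
  h.integrable_of_bound (C := 1) (by fun_prop) fun r hr => by
    have := hr.1.le
    rw [abs_of_nonneg (by positivity)]
    exact rpow_pow_le_one hp hr n

omit h in
theorem rpowMoment_nonneg (p : ℝ) (n : ℕ) : 0 ≤ rpowMoment ω p n :=
  integral_nonneg_of_ae (by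
    filter_upwards [ae_radialMeasure ω] with r hr
    have := hr.1.le
    positivity)

theorem IsRadialWeight.rpowMoment_anti {p : ℝ} (hp : 0 ≤ p) {m n : ℕ} (hmn : m ≤ n) :
    rpowMoment ω p n ≤ rpowMoment ω p m := by
  refine integral_mono_ae (h.integrable_rpow_pow hp n) (h.integrable_rpow_pow hp m) ?_
  filter_upwards [ae_radialMeasure ω] with r hr
  exact pow_le_pow_of_le_one (Real.rpow_nonneg hr.1.le _) (Real.rpow_le_one hr.1.le hr.2.le hp) hmn

omit h in
theorem pow_rpow_comm {r : ℝ} (hr : 0 ≤ r) (p : ℝ) (n : ℕ) : (r ^ n) ^ p = (r ^ p) ^ n := by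
  rw [← Real.rpow_natCast, ← Real.rpow_natCast, ← Real.rpow_mul hr, ← Real.rpow_mul hr, mul_comm]

theorem IsRadialWeight.lebesgueNorm_pow {p : ℝ} (hp : 0 < p) (n : ℕ) :
    lebesgueNorm ω p (fun z => z ^ n) ^ p = rpowMoment ω p n := by
  rw [lebesgueNorm, ENNReal.toReal_rpow, eLpNorm_ofReal_rpow hp,
    ← ENNReal.toReal_ofReal (rpowMoment_nonneg p n), rpowMoment,
    ← h.lintegral_norm (by fun_prop) (fun r hr => ?_) fun r hr => rpow_pow_le_one hp.le hr n]
  · congr 1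
    refine lintegral_congr fun z => ?_
    rw [← ofReal_norm, ENNReal.ofReal_rpow_of_nonneg (norm_nonneg _) hp.le, norm_pow,
      pow_rpow_comm (norm_nonneg _)]
  · have := hr.1.le
    positivity

theorem IsRadialWeight.lebesgueNorm_iteratedDeriv_pow {p : ℝ} (hp : 1 < p) (k j : ℕ) :
    lebesgueNorm (bracketWeight ω (k * p)) p (iteratedDeriv k fun z => z ^ (j + k)) ^ p =
      ∫ r, ((1 - r) ^ k * ((j + k).descFactorial k * r ^ j)) ^ p ∂radialMeasure ω := by
  have hp0 : 0 < p := by linarith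
  have hnn : ∀ r ∈ Ioo (0 : ℝ) 1, 0 ≤ (1 - r) ^ k * ((j + k).descFactorial k * r ^ j) :=
    fun r hr => by
      have h1 := hr.1.le
      have h2 : 0 ≤ 1 - r := by linarith [hr.2]
      positivity
  rw [lebesgueNorm, h.eLpNorm_bracketWeight hp, ENNReal.toReal_rpow, ← ENNReal.rpow_mul,
    one_div_mul_cancel hp0.ne', ENNReal.rpow_one, ← ENNReal.toReal_ofReal (integral_nonneg_of_ae
      (by filter_upwards [ae_radialMeasure ω] with r hr using Real.rpow_nonneg (hnn r hr) p)),
    ← h.lintegral_norm (C := (((j + k).descFactorial k : ℕ) : ℝ) ^ p) (by fun_prop)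
      (fun r hr => Real.rpow_nonneg (hnn r hr) p) fun r hr => ?_]
  · congr 1
    refine lintegral_congr_ae ?_
    filter_upwards [ae_areaMeasure ω] with z hz
    have h1 : 0 ≤ 1 - ‖z‖ := by linarith [mem_ball_zero_iff.1 hz]
    rw [← ofReal_norm, ← ENNReal.ofReal_mul (by positivity),
      ENNReal.ofReal_rpow_of_nonneg (by positivity) hp0.le, iteratedDeriv_pow,
      Nat.add_sub_cancel, norm_mul, norm_pow, Complex.norm_natCast]
  · refine Real.rpow_le_rpow (hnn r hr) ?_ hp0.le
    have h1 := hr.1.le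
    have h2 : 0 ≤ 1 - r := by linarith [hr.2]
    calc _ ≤ 1 * (((j + k).descFactorial k : ℕ) * 1 : ℝ) := by
          gcongr
          · exact pow_le_one₀ h2 (by linarith)
          · exact pow_le_one₀ h1 hr.2.le
      _ = _ := by ring

-- With $y=(j+1)(1-r)$, Bernoulli gives $(j+1)(1-r^p)\le py$, and $y\le1+y^{kp}$ because $kp\ge1$.
-- The falling factorial dominates $(j+1)^k$, so $y^{kp}r^{pj}$ is at most the weighted $k$-th
-- derivative of $z^{j+k}$ to the power $p$.
omit h in
theorem mul_rpow_pow_sub_le {p : ℝ} (hp : 1 < p) {k : ℕ} (hk : 1 ≤ k) (j : ℕ) {r : ℝ}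
    (hr : r ∈ Ioo (0 : ℝ) 1) :
    (j + 1) * ((r ^ p) ^ j - (r ^ p) ^ (j + 1)) ≤
      p * ((r ^ p) ^ j + ((1 - r) ^ k * ((j + k).descFactorial k * r ^ j)) ^ p) := by
  have hp0 : 0 < p := by linarith
  have h0 := hr.1.le
  have h1 : 0 ≤ 1 - r := by linarith [hr.2]
  have hx : 0 ≤ (r ^ p) ^ j := by positivity
  have hb : 1 - r ^ p ≤ p * (1 - r) := by
    have := one_add_mul_self_le_rpow_one_add (s := r - 1) (by linarith) hp.le
    rw [add_sub_cancel] at this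
    linarith
  set y := (j + 1) * (1 - r)
  have hy0 : 0 ≤ y := by positivity
  have hy : y ≤ 1 + (y ^ k) ^ p := by
    rcases le_total y 1 with hy1 | hy1
    · have : 0 ≤ (y ^ k) ^ p := by positivity
      linarith
    · have h2 : y ≤ y ^ k := le_self_pow₀ hy1 (by omega)
      have h3 : y ^ k ≤ (y ^ k) ^ p := Real.self_le_rpow_of_one_le (hy1.trans h2) hp.le
      linarith
  have hd : ((j + 1 : ℝ)) ^ k ≤ ((j + k).descFactorial k : ℕ) := by
    have := Nat.pow_sub_le_descFactorial (j + k) k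
    rw [show j + k + 1 - k = j + 1 by omega] at this
    exact_mod_cast this
  have hG : (y ^ k) ^ p * (r ^ p) ^ j ≤
      ((1 - r) ^ k * ((j + k).descFactorial k * r ^ j)) ^ p := by
    rw [← pow_rpow_comm h0, ← Real.mul_rpow (by positivity) (by positivity)]
    refine Real.rpow_le_rpow (by positivity) ?_ hp0.le
    simp only [y]
    rw [mul_pow]
    calc _ = (1 - r) ^ k * ((j + 1 : ℝ) ^ k * r ^ j) := by ring
      _ ≤ _ := by gcongr
  calc (j + 1) * ((r ^ p) ^ j - (r ^ p) ^ (j + 1)) = (j + 1) * (1 - r ^ p) * (r ^ p) ^ j := by ring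
    _ ≤ (j + 1) * (p * (1 - r)) * (r ^ p) ^ j := by gcongr
    _ = p * (y * (r ^ p) ^ j) := by simp only [y]; ring
    _ ≤ p * ((1 + (y ^ k) ^ p) * (r ^ p) ^ j) := by gcongr
    _ = p * ((r ^ p) ^ j + (y ^ k) ^ p * (r ^ p) ^ j) := by ring
    _ ≤ _ := by gcongr

theorem IsRadialWeight.exists_rpowMoment_sub_le {p : ℝ} (hp : 1 < p) {k : ℕ} (hk : 1 ≤ k)
    (hI : IdentityBounded ω p k) :
    ∃ c : ℝ, 0 < c ∧ ∀ j : ℕ,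
      (j + 1) * (rpowMoment ω p j - rpowMoment ω p (j + 1)) ≤ c * rpowMoment ω p j := by
  have hp0 : 0 < p := by linarith
  obtain ⟨C, hC, hCI⟩ := hI
  refine ⟨p * (1 + C ^ p), by positivity, fun j => ?_⟩
  set G : ℝ → ℝ := fun r => ((1 - r) ^ k * ((j + k).descFactorial k * r ^ j)) ^ p
  have hGi : Integrable G (radialMeasure ω) := by
    refine h.integrable_of_bound (C := (((j + k).descFactorial k : ℕ) : ℝ) ^ p) (by fun_prop)
      fun r hr => ?_
    have h1 := hr.1.le
    have h2 : 0 ≤ 1 - r := by linarith [hr.2]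
    rw [abs_of_nonneg (by positivity)]
    refine Real.rpow_le_rpow (by positivity) ?_ hp0.le
    calc _ ≤ 1 * (((j + k).descFactorial k : ℕ) * 1 : ℝ) := by
          gcongr
          · exact pow_le_one₀ h2 (by linarith)
          · exact pow_le_one₀ h1 hr.2.le
      _ = _ := by ring
  have hG : ∫ r, G r ∂radialMeasure ω ≤ C ^ p * rpowMoment ω p j := by
    obtain ⟨-, h1⟩ := hCI _ (h.pow_mem_bergmanSpace (j + k) p)
    have h2 : lebesgueNorm (bracketWeight ω (k * p)) p (iteratedDeriv k fun z => z ^ (j + k)) ≤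
        C * lebesgueNorm ω p fun z => z ^ (j + k) :=
      le_trans (le_add_of_nonneg_right (Finset.sum_nonneg fun _ _ => norm_nonneg _)) h1
    have hN : ∀ ω' f, 0 ≤ lebesgueNorm ω' p f := fun _ _ => ENNReal.toReal_nonneg
    have h3 := Real.rpow_le_rpow (hN _ _) h2 hp0.le
    rw [Real.mul_rpow hC.le (hN _ _), h.lebesgueNorm_pow hp0,
      h.lebesgueNorm_iteratedDeriv_pow hp] at h3
    refine h3.trans ?_
    gcongr
    exact h.rpowMoment_anti hp0.le (Nat.le_add_right _ _)
  have i1 := h.integrable_rpow_pow hp0.le j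
  have i2 := h.integrable_rpow_pow hp0.le (j + 1)
  have key : ∫ r, (j + 1 : ℝ) * ((r ^ p) ^ j - (r ^ p) ^ (j + 1)) ∂radialMeasure ω ≤
      ∫ r, p * ((r ^ p) ^ j + G r) ∂radialMeasure ω := by
    refine integral_mono_ae ((i1.sub i2).const_mul _) ((i1.add hGi).const_mul _) ?_
    filter_upwards [ae_radialMeasure ω] with r hr using mul_rpow_pow_sub_le hp hk j hr
  rw [integral_const_mul, integral_const_mul, integral_sub i1 i2, integral_add i1 hGi] at key
  refine key.trans ?_
  rw [mul_assoc, add_mul, one_mul]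
  gcongr
  exact le_rfl

end

/-- With $m=i+1$ the hypothesis says $mA_{i+1}\ge(m-c)A_i$, while $((m+1)/m)^N\ge1+N/m$. The product
$(1-c/m)(1+N/m)$ is at least 1 as soon as $N$ and $m$ are at least $2c$. -/
theorem mul_pow_le_of_mul_sub_le {A : ℕ → ℝ} {c : ℝ} (hA : ∀ n, 0 ≤ A n)
    (hle : ∀ j : ℕ, (j + 1) * (A j - A (j + 1)) ≤ c * A j) {N j i : ℕ} (hN : 2 * c ≤ N)
    (hj : 2 * c ≤ j + 1) (hij : j ≤ i) : A j * (j + 1 : ℝ) ^ N ≤ A i * (i + 1 : ℝ) ^ N := by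
  induction i, hij using Nat.le_induction with
  | base => exact le_rfl
  | succ i hji ih =>
    refine ih.trans ?_
    have hji' : (j : ℝ) ≤ i := by exact_mod_cast hji
    have h0 := hA i
    have hi := hle i
    push_cast
    set m : ℝ := (i : ℝ) + 1
    have hm0 : 0 < m := by positivity
    have hm : 2 * c ≤ m := by simp only [m]; linarith
    have h1 : (m - c) * A i ≤ m * A (i + 1) := by linarith
    have h2 : m ^ N * (1 + N / m) ≤ (m + 1) ^ N := by
      have h3 := one_add_mul_le_pow (a := 1 / m)
        (by have : (0 : ℝ) ≤ 1 / m := by positivity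
            linarith) N
      calc m ^ N * (1 + N / m) = m ^ N * (1 + N * (1 / m)) := by ring
        _ ≤ m ^ N * (1 + 1 / m) ^ N := by gcongr
        _ = (m + 1) ^ N := by rw [← mul_pow, mul_add, mul_one, mul_one_div_cancel hm0.ne']
    have hN0 : (0 : ℝ) ≤ N := Nat.cast_nonneg _
    have h4 : m ≤ (m - c) * (1 + N / m) := by
      have h5 : (m - c) * (1 + N / m) - m = (N * (m - 2 * c) + (N - 2 * c) * m) / (2 * m) := by
        field_simp
        ring
      have h6 : 0 ≤ (N * (m - 2 * c) + (N - 2 * c) * m) / (2 * m) :=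
        div_nonneg (add_nonneg (mul_nonneg hN0 (by linarith))
          (mul_nonneg (by linarith) hm0.le)) (by positivity)
      linarith
    refine le_of_mul_le_mul_left ?_ hm0
    calc m * (A i * m ^ N) ≤ ((m - c) * (1 + N / m)) * (A i * m ^ N) := by gcongr
      _ = (m - c) * A i * (m ^ N * (1 + N / m)) := by ring
      _ ≤ (m - c) * A i * (m + 1) ^ N := by
          have : 0 ≤ m - c := by linarith
          gcongr
      _ ≤ m * A (i + 1) * (m + 1) ^ N := by gcongr
      _ = _ := by ring

section
variable {ω : ℝ → ℝ} (h : IsRadialWeight ω)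
include h

theorem IsRadialWeight.measureReal_Ico {y : ℝ} (hy : y ∈ Ioo (0 : ℝ) 1) :
    (radialMeasure ω).real (Ico y 1) = ∫ r in Ico y 1, 2 * r * ω r := by
  rw [← integral_indicator_one measurableSet_Ico, h.integral_radialMeasure]
  have e : ∀ r, 2 * r * ω r * (Ico y 1).indicator 1 r =
      (Ico y 1).indicator (fun r => 2 * r * ω r) r := fun r => by
    by_cases hr : r ∈ Ico y 1 <;> simp [hr]
  simp_rw [e]
  rw [setIntegral_indicator measurableSet_Ico]
  congr 2
  exact inter_eq_right.2 fun r hr => ⟨hy.1.trans_le hr.1, hr.2⟩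

theorem IsRadialWeight.integrableOn_two_mul {y : ℝ} (hy : y ∈ Ioo (0 : ℝ) 1) :
    IntegrableOn (fun r => 2 * r * ω r) (Ico y 1) := by
  refine ((h.integrableOn_mul (F := fun r => 2 * r) (by fun_prop) (C := 2) fun r hr => ?_).mono_set
    fun r hr => ⟨hy.1.trans_le hr.1, hr.2⟩).congr_fun (fun r _ => by ring) measurableSet_Ico
  rw [abs_of_nonneg (by linarith [hr.1])]
  linarith [hr.2]

theorem IsRadialWeight.measureReal_Ico_le {y : ℝ} (hy : y ∈ Ioo (0 : ℝ) 1) :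
    (radialMeasure ω).real (Ico y 1) ≤ 2 * tail ω y := by
  rw [h.measureReal_Ico hy, tail, ← integral_const_mul]
  have hsub : Ico y 1 ⊆ Ico 0 1 := Ico_subset_Ico_left hy.1.le
  refine setIntegral_mono_on (h.integrableOn_two_mul hy)
    ((h.integrable.mono_set hsub).const_mul 2) measurableSet_Ico fun r hr => ?_
  have := h.nonneg r (hsub hr)
  have := hr.2.le
  calc 2 * r * ω r ≤ 2 * 1 * ω r := by gcongr
    _ = _ := by ring

theorem IsRadialWeight.le_measureReal_Ico {y : ℝ} (hy : y ∈ Ioo (0 : ℝ) 1) :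
    2 * y * tail ω y ≤ (radialMeasure ω).real (Ico y 1) := by
  rw [h.measureReal_Ico hy, tail, ← integral_const_mul]
  have hsub : Ico y 1 ⊆ Ico 0 1 := Ico_subset_Ico_left hy.1.le
  refine setIntegral_mono_on ((h.integrable.mono_set hsub).const_mul _)
    (h.integrableOn_two_mul hy) measurableSet_Ico fun r hr => ?_
  have := h.nonneg r (hsub hr)
  have := hr.1
  gcongr

theorem IsRadialWeight.rpow_pow_mul_tail_le {p : ℝ} (hp : 0 ≤ p) (n : ℕ) {y : ℝ}
    (hy : y ∈ Ioo (0 : ℝ) 1) : (y ^ p) ^ n * (2 * y * tail ω y) ≤ rpowMoment ω p n := by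
  have := h.isFiniteMeasure_radialMeasure
  have hy0 := hy.1.le
  calc (y ^ p) ^ n * (2 * y * tail ω y) ≤ (y ^ p) ^ n * (radialMeasure ω).real (Ico y 1) := by
        gcongr
        exact h.le_measureReal_Ico hy
    _ = ∫ r, (Ico y 1).indicator (fun _ => (y ^ p) ^ n) r ∂radialMeasure ω := by
        rw [integral_indicator measurableSet_Ico, setIntegral_const, smul_eq_mul, mul_comm]
    _ ≤ _ := by
        refine integral_mono_ae ((integrable_const _).indicator measurableSet_Ico)
          (h.integrable_rpow_pow hp n) ?_
        filter_upwards [ae_radialMeasure ω] with r hr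
        have hr0 := hr.1.le
        by_cases hr1 : r ∈ Ico y 1
        · have := hr1.1
          simp only [indicator_of_mem hr1]
          gcongr
        · simp only [indicator_of_notMem hr1]
          positivity

/-- Below `y` the extra power is at most $y^{pm}$; above it the integrand is at most 1 and the mass
at most twice the tail. -/
theorem IsRadialWeight.rpowMoment_add_le {p : ℝ} (hp : 0 ≤ p) (m n : ℕ) {y : ℝ}
    (hy : y ∈ Ioo (0 : ℝ) 1) :
    rpowMoment ω p (n + m) ≤ (y ^ p) ^ m * rpowMoment ω p n + 2 * tail ω y := by
  have := h.isFiniteMeasure_radialMeasure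
  have hy0 := hy.1.le
  have i1 := (h.integrable_rpow_pow hp n).const_mul ((y ^ p) ^ m)
  have i2 : Integrable ((Ico y 1).indicator fun _ => (1 : ℝ)) (radialMeasure ω) :=
    (integrable_const _).indicator measurableSet_Ico
  calc _ ≤ ∫ r, (y ^ p) ^ m * (r ^ p) ^ n + (Ico y 1).indicator (fun _ => 1) r
        ∂radialMeasure ω := by
        refine integral_mono_ae (h.integrable_rpow_pow hp _) (i1.add i2) ?_
        filter_upwards [ae_radialMeasure ω] with r hr
        have hr0 := hr.1.le
        by_cases hr1 : r ∈ Ico y 1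
        · rw [indicator_of_mem hr1]
          have := rpow_pow_le_one hp hr (n + m)
          have : 0 ≤ (y ^ p) ^ m * (r ^ p) ^ n := by positivity
          linarith
        · rw [indicator_of_notMem hr1, add_zero, pow_add, mul_comm]
          have : r ≤ y := by
            by_contra hlt
            exact hr1 ⟨(not_le.1 hlt).le, hr.2⟩
          gcongr
    _ = (y ^ p) ^ m * rpowMoment ω p n + (radialMeasure ω).real (Ico y 1) := by
        rw [integral_add i1 i2, integral_const_mul, integral_indicator measurableSet_Ico,
          setIntegral_const, smul_eq_mul, mul_one, rpowMoment]
    _ ≤ _ := by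
        gcongr
        exact h.measureReal_Ico_le hy

omit h in
theorem exists_pow_mul_exp_le {a : ℝ} (ha : 0 < a) (N : ℕ) :
    ∃ l : ℕ, ((l : ℝ) + 1) ^ N * Real.exp (-(l / a)) ≤ 1 / 2 := by
  have h1 : Tendsto (fun l : ℕ => ((l : ℝ) + 1) / a) atTop atTop :=
    (tendsto_atTop_add_const_right _ 1 tendsto_natCast_atTop_atTop).atTop_div_const ha
  have h2 := ((Real.tendsto_pow_mul_exp_neg_atTop_nhds_zero N).comp h1).const_mul
    (a ^ N * Real.exp (1 / a))
  rw [mul_zero] at h2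
  obtain ⟨l, hl⟩ := (h2.eventually (ge_mem_nhds (show (0 : ℝ) < 1 / 2 by norm_num))).exists
  refine ⟨l, le_of_eq_of_le ?_ hl⟩
  have h3 : -((l : ℝ) / a) = 1 / a + -(((l : ℝ) + 1) / a) := by ring
  rw [h3, Real.exp_add, Function.comp_apply, div_pow]
  field_simp

/-- Near the boundary a moment of order about $1/(1-r)$ sees the tail at $r$. Multiplying the order
by $l+1$ costs $Q=(l+1)^N$, but reduces the part below $(1+r)/2$ by $e^{-l/(4p)}$; `l` is chosen so
that the product is at most $1/2$ and that part is absorbed. -/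
theorem IsRadialWeight.isDoubling_of_identityBounded {p : ℝ} (hp : 1 < p) {k : ℕ} (hk : 1 ≤ k)
    (hI : IdentityBounded ω p k) : IsDoubling ω := by
  have hp0 : 0 < p := by linarith
  obtain ⟨c, hc, hcj⟩ := h.exists_rpowMoment_sub_le hp hk hI
  obtain ⟨N, hN⟩ := exists_nat_ge (2 * c)
  obtain ⟨l, hl⟩ := exists_pow_mul_exp_le (a := 4 * p) (by positivity) N
  set Q : ℝ := ((l : ℝ) + 1) ^ N
  have hQ : 1 ≤ Q := one_le_pow₀ (by linarith [(Nat.cast_nonneg l : (0 : ℝ) ≤ l)])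
  -- The bound $1/2$ keeps $2r\ge1$ in the lower moment estimate; the bound $1/(4pc)$ ensures
  -- $j+1\ge2c$ below, the range where $A_j(j+1)^N$ is nondecreasing.
  set δ := min (1 / 2) (1 / (4 * p * c))
  have hδ0 : 0 < δ := lt_min (by norm_num) (by positivity)
  have hδ2 : δ ≤ 1 / 2 := min_le_left _ _
  have hlarge : ∀ r ∈ Ico (1 - δ) 1, tail ω r ≤ 8 * Q * tail ω ((1 + r) / 2) := by
    intro r hr
    have hr2 : 1 / 2 ≤ r := by linarith [hr.1]
    have hr01 : r ∈ Ioo (0 : ℝ) 1 := ⟨by linarith, hr.2⟩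
    set t := 1 - r with ht
    have ht0 : 0 < t := by linarith [hr.2]
    have htδ : t ≤ δ := by linarith [hr.1]
    -- Small enough that $r^{pj}\ge1-jpt\ge1/2$, and large enough that $(j+1)t>1/(2p)$ for the
    -- exponential decay.
    set j := ⌊1 / (2 * p * t)⌋₊
    have hj1 : (j : ℝ) ≤ 1 / (2 * p * t) := Nat.floor_le (by positivity)
    have hj2 : 1 / (2 * p * t) < j + 1 := Nat.lt_floor_add_one _
    rw [le_div_iff₀ (by positivity)] at hj1
    rw [div_lt_iff₀ (by positivity)] at hj2
    have hcj1 : 2 * c ≤ j + 1 := by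
      have h1 : t * (4 * p * c) ≤ 1 :=
        (le_div_iff₀ (by positivity)).1 (htδ.trans (min_le_right _ _))
      have h2 : (2 * c) * (2 * p * t) ≤ (j + 1) * (2 * p * t) := by linarith
      exact le_of_mul_le_mul_right h2 (by positivity)
    set y := (1 + r) / 2
    have hy : y ∈ Ioo (0 : ℝ) 1 := ⟨by simp only [y]; linarith, by simp only [y]; linarith [hr.2]⟩
    have hyt : y = -(t / 2) + 1 := by simp only [y, t]; ring
    set A := rpowMoment ω p
    have hA0 : ∀ n, 0 ≤ A n := rpowMoment_nonneg p
    have hlow : tail ω r / 2 ≤ A j := by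
      have h1 : 1 / 2 ≤ (r ^ p) ^ j := by
        have hb := one_add_mul_self_le_rpow_one_add (s := -t) (by linarith) hp.le
        rw [show 1 + -t = r by simp only [t]; ring] at hb
        rcases Nat.eq_zero_or_pos j with hj0 | hj0
        · rw [hj0]
          norm_num
        · have h3 : (1 : ℝ) ≤ j := by exact_mod_cast hj0
          have h4 : p * t ≤ 1 / 2 := by nlinarith [mul_pos hp0 ht0]
          have h5 := one_add_mul_le_pow (a := -(p * t)) (by linarith) j
          have h6 : (1 + -(p * t)) ^ j ≤ (r ^ p) ^ j :=
            pow_le_pow_left₀ (by linarith) (by linarith) j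
          linarith
      have h2 := h.rpow_pow_mul_tail_le hp0.le j hr01
      have hT := h.tail_nonneg hr01.1.le
      refine le_trans ?_ h2
      calc tail ω r / 2 = 1 / 2 * (2 * (1 / 2) * tail ω r) := by ring
        _ ≤ _ := by gcongr
    -- The index is chosen so that, increased by 1, it equals $(l+1)(j+1)$; the ratio of the powers
    -- is then exactly `Q`.
    have hgrow : A j ≤ Q * A (j + l * (j + 1)) := by
      have h1 := mul_pow_le_of_mul_sub_le hA0 hcj hN hcj1 (Nat.le_add_right j (l * (j + 1)))
      have h2 : ((j + l * (j + 1) : ℕ) : ℝ) + 1 = (l + 1) * (j + 1) := by push_cast; ring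
      rw [h2, mul_pow] at h1
      have h3 : (0 : ℝ) < (j + 1 : ℝ) ^ N := by positivity
      refine le_of_mul_le_mul_right ?_ h3
      calc _ ≤ _ := h1
        _ = _ := by simp only [Q]; ring
    have hsplit := h.rpowMoment_add_le hp0.le (l * (j + 1)) j hy
    have hyp : (y ^ p) ^ (l * (j + 1)) ≤ Real.exp (-(l / (4 * p))) := by
      have h1 : y ^ p ≤ Real.exp (-(t / 2)) := by
        calc y ^ p ≤ y ^ (1 : ℝ) := Real.rpow_le_rpow_of_exponent_ge hy.1 hy.2.le hp.le
          _ = -(t / 2) + 1 := by rw [Real.rpow_one, hyt]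
          _ ≤ _ := Real.add_one_le_exp _
      calc _ ≤ Real.exp (-(t / 2)) ^ (l * (j + 1)) :=
            pow_le_pow_left₀ (Real.rpow_nonneg hy.1.le _) h1 _
        _ = Real.exp ((l * (j + 1) : ℕ) * -(t / 2)) := (Real.exp_nat_mul _ _).symm
        _ ≤ _ := by
          refine Real.exp_le_exp.2 ?_
          push_cast
          have h2 : (l : ℝ) / (4 * p) ≤ l * ((j + 1) * (t / 2)) := by
            rw [div_le_iff₀ (by positivity)]
            have h3 : (1 : ℝ) ≤ (j + 1) * (t / 2) * (4 * p) := by linarith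
            have := mul_le_mul_of_nonneg_left h3 (Nat.cast_nonneg l : (0 : ℝ) ≤ l)
            linarith
          linarith
    have hfin : (y ^ p) ^ (l * (j + 1)) * A j ≤ A (j + l * (j + 1)) / 2 := by
      calc _ ≤ Real.exp (-(l / (4 * p))) * (Q * A (j + l * (j + 1))) := by
            have := hA0 j
            gcongr
        _ = Q * Real.exp (-(l / (4 * p))) * A (j + l * (j + 1)) := by ring
        _ ≤ 1 / 2 * A (j + l * (j + 1)) := by
            have := hA0 (j + l * (j + 1))
            gcongr
        _ = _ := by ring
    have h4 : A (j + l * (j + 1)) ≤ 4 * tail ω y := by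
      change A (j + l * (j + 1)) ≤ _ * A j + _ at hsplit
      linarith
    calc tail ω r ≤ 2 * A j := by linarith
      _ ≤ 2 * (Q * (4 * tail ω y)) := by gcongr; exact hgrow.trans (by gcongr)
      _ = _ := by ring
  have hr0 : (2 - δ) / 2 ∈ Ico (0 : ℝ) 1 := ⟨by linarith, by linarith⟩
  have hT0 := h.tail_pos _ hr0
  have hTT := h.tail_pos 0 (by norm_num)
  refine ⟨8 * Q + tail ω 0 / tail ω ((2 - δ) / 2),
    by have : 0 ≤ tail ω 0 / tail ω ((2 - δ) / 2) := by positivity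
       linarith, fun r hr => ?_⟩
  have hy0 : 0 ≤ (1 + r) / 2 := by linarith [hr.1]
  have hTy := h.tail_nonneg hy0
  have hx : 0 ≤ tail ω 0 / tail ω ((2 - δ) / 2) := by positivity
  rcases le_or_gt (1 - δ) r with h1 | h1
  · refine (hlarge r ⟨h1, hr.2⟩).trans ?_
    gcongr
    linarith
  -- Away from the boundary $(1+r)/2$ stays below the fixed radius $(2-\delta)/2$, where the tail is
  -- positive.
  · have h2 : tail ω ((2 - δ) / 2) ≤ tail ω ((1 + r) / 2) := h.tail_anti hy0 (by linarith)
    calc tail ω r ≤ tail ω 0 := h.tail_anti le_rfl hr.1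
      _ = tail ω 0 / tail ω ((2 - δ) / 2) * tail ω ((2 - δ) / 2) := by field_simp
      _ ≤ tail ω 0 / tail ω ((2 - δ) / 2) * tail ω ((1 + r) / 2) := by gcongr
      _ ≤ _ := by
        gcongr
        linarith

end

end RadialBergman

end

/-! ### The equivalence -/

theorem mainTheorem10 (ω : ℝ → ℝ) (hω : RadialBergman.IsRadialWeight ω)
    (p : ℝ) (hp : 1 < p) (k : ℕ) (hk : 1 ≤ k) :
    List.TFAE
      [RadialBergman.ProjectionBounded ω p k,
        RadialBergman.DualEmbedded ω p k,
        RadialBergman.IdentityBounded ω p k,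
        RadialBergman.IsDoubling ω] := by
  tfae_have 1 → 3 := hω.identityBounded_of_projectionBounded hp
  tfae_have 2 → 3 := hω.identityBounded_of_dualEmbedded hp
  tfae_have 4 → 1 := fun hD => hω.projectionBounded_of_isDoubling hD hp hk
  tfae_have 4 → 2 := fun hD => hω.dualEmbedded_of_isDoubling hD hp hk
  tfae_have 3 → 4 := hω.isDoubling_of_identityBounded hp hk
  tfae_finish
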